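/- **Notation.** $\langle x\rangle=(1+x^2)^{1/2}$; all complex powers are principal branches. For a measurable $V:(0,\infty)\to\mathbb C$, $H_V$ is the maximal operator $H_Vf=-f''+Vf$ (weak derivatives) in $L^2(\mathbb R_+)$, with domain $\{f\in L^2(\mathbb R_+):-f''+Vf\in L^2(\mathbb R_+)\}$. **Potentials.** Let $N\ge 2$ be an integer, $\nu\in\mathbb R$, $\varepsilon_1>0$, and let (the continuous representative of) $V\in W^{N,\infty}_{\rm loc}([0,\infty);\mathbb C)$ satisfy: - $\operatorname{Im}V(x)\to+\infty$ as $x\to+\infty$; - for all $1\le m\le N$, as $x\to+\infty$, $|\operatorname{Im}V^{(m)}(x)|=O(|\operatorname{Im}V(x)|\langle x\rangle^{m\nu})$ and $|V^{(m)}(x)|=O(|V(x)|\langle x\rangle^{m\nu})$; - $\langle x\rangle^{4(\nu+\varepsilon_1)+2}\big(\langle x\rangle^{4\nu+2}+|\operatorname{Re}V(x)|\big)=O(|\operatorname{Im}V(x)|^2)$ as $x\to+\infty$; - there is $c_0>0$ with $\operatorname{Im}V'(x)\ge c_0\operatorname{Im}V(x)\langle x\rangle^{\nu}$ for all sufficiently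 large $x$. **Pseudomode.** Let $\lambda=a+ib$ with $a\in\mathbb R$, $b>0$. For all sufficiently large $b$ there is a unique $x_b>0$ with $\operatorname{Im}V(x_b)=b$. Put $\delta=\tfrac12x_b^{-\nu}$, $\Delta=\delta/4$, $J_b=(x_b-\delta,x_b+\delta)$. Fix constants $c_1,c_2,c_3,K>0$ and suppose that $a$ satisfies, for all $x\in J_b$, $$b^{2/3}x_b^{2\nu/3}\le c_1|a|,\qquad |a|\le c_2\,(a-\operatorname{Re}V(x)),\qquad a-\operatorname{Re}V(x)\le c_3\,b^2x_b^{-4\nu-4\varepsilon_1-2}.$$ Let $\xi\in C_0^\infty((0,\infty))$ satisfy $0\le\xi\le1$, $\xi=1$ on $(x_b-\delta+\Delta,x_b+\delta-\Delta)$, $\xi=0$ outside $J_b$, and $|\xi^{(j)}|\le K\Delta^{-j}$ for $j=1,2$. Let $n=N-1$ and define on $J_b$ $$\psi_{-1}'=i\lambda^{-1/2}(\lambda-V)^{1/2},\qquad \psi_{k+1}'=\frac1{2\psi_{-1}'}\Big(\psi_k''-\sum_{\alpha+\beta=k,\ \alpha,\beta\ge0}\psi_\alpha'\psi_\beta'\Big),\quad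 -1\le k\le n-2,$$ $$f(x)=\xi(x)\exp\Big(-\sum_{k=-1}^{n-1}\lambda^{-k/2}\int_{x_b}^x\psi_k'(t)\,dt\Big).$$ **Theorem.** There exist $c,C,b_0>0$, depending only on $N,\nu,\varepsilon_1,V,c_1,c_2,c_3,K$, such that for every $b\ge b_0$, every such $a$ and every such $\xi$, one has $f\in\operatorname{Dom}(H_V)$, $f\ne0$, and $$\frac{\|(H_V-\lambda)f\|_{L^2(\mathbb R_+)}}{\|f\|_{L^2(\mathbb R_+)}}\le C\Bigg(\exp(-c\,x_b^{\nu+1+2\varepsilon_1})+x_b^{N\nu}\sup_{x\in J_b}\frac{b+|\operatorname{Re}V(x)|}{(a-\operatorname{Re}V(x))^{N/2}}+\sum_{k=0}^{N-2}\sum_{l=2}^{N+k}x_b^{(N+k)\nu}\sup_{x\in J_b}\frac{(b+|\operatorname{Re}V(x)|)^l}{(a-\operatorname{Re}V(x))^{\frac{N-2+k}2+l}}\Bigg).$$ -/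

import Mathlib

open Set Filter Topology MeasureTheory Asymptotics
open scoped ContDiff

namespace Pseudomode

noncomputable section

/-- The bracket `⟨x⟩ = (1 + x²)^{1/2}`. -/
def bracket (x : ℝ) : ℝ := Real.sqrt (1 + x ^ 2)

/-- Test functions on the open half-line: elements of `C_0^∞((0,∞))`. -/
def IsTestFunction (φ : ℝ → ℂ) : Prop :=
  ContDiff ℝ ∞ φ ∧ HasCompactSupport φ ∧ tsupport φ ⊆ Ioi 0

/-- `w` is the weak derivative of order `m` of `u` on the open half-line `(0,∞)`. -/
def HasWeakDeriv (m : ℕ) (u w : ℝ → ℂ) : Prop :=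
  LocallyIntegrableOn u (Ioi 0) ∧ LocallyIntegrableOn w (Ioi 0) ∧
    ∀ φ : ℝ → ℂ, IsTestFunction φ →
      ∫ x in Ioi 0, u x * iteratedDeriv m φ x = (-1) ^ m * ∫ x in Ioi 0, w x * φ x

/-- The space `W^{N,∞}_loc([0,∞))`: all weak derivatives of order at most `N` exist on `(0,∞)` and
are essentially bounded on every interval `(0,R)`. -/
def MemSobolevLocInfty (N : ℕ) (u : ℝ → ℂ) : Prop :=
  ∀ m ≤ N, ∃ w : ℝ → ℂ, HasWeakDeriv m u w ∧
    ∀ R > 0, MemLp w ⊤ (volume.restrict (Ioo 0 R))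

/-- The class of potentials on the half-line. Only the values of `V` on `(0,∞)` matter.
Bounds on weak derivatives, which are defined almost everywhere, are required for almost every
sufficiently large `x`. -/
structure Admissible (N : ℕ) (ν ε₁ : ℝ) (V : ℝ → ℂ) : Prop where
  /-- `V ∈ W^{N,∞}_loc([0,∞))` ... -/
  sobolev : MemSobolevLocInfty N V
  /-- ... and `V` is its continuous representative. -/
  continuousOn : ContinuousOn V (Ioi 0)
  /-- `Im V(x) → +∞` as `x → +∞`. -/
  tendsto_im : Tendsto (fun x => (V x).im) atTop atTop
  /-- `|Im V^{(m)}(x)| = O(|Im V(x)| ⟨x⟩^{mν})` for `1 ≤ m ≤ N`. -/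
  im_deriv : ∀ m ∈ Finset.Icc 1 N, ∀ w : ℝ → ℂ, HasWeakDeriv m V w →
    (fun x => (w x).im) =O[atTop ⊓ ae volume] fun x => |(V x).im| * bracket x ^ ((m : ℝ) * ν)
  /-- `|V^{(m)}(x)| = O(|V(x)| ⟨x⟩^{mν})` for `1 ≤ m ≤ N`. -/
  deriv : ∀ m ∈ Finset.Icc 1 N, ∀ w : ℝ → ℂ, HasWeakDeriv m V w →
    w =O[atTop ⊓ ae volume] fun x => ‖V x‖ * bracket x ^ ((m : ℝ) * ν)
  eps_pos : 0 < ε₁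
  /-- `⟨x⟩^{4(ν+ε₁)+2} (⟨x⟩^{4ν+2} + |Re V(x)|) = O(|Im V(x)|²)`. -/
  re_bound :
    (fun x => bracket x ^ (4 * (ν + ε₁) + 2) * (bracket x ^ (4 * ν + 2) + |(V x).re|))
      =O[atTop] fun x => |(V x).im| ^ 2
  /-- `Im V'(x) ≳ Im V(x) ⟨x⟩^ν` for all large `x`. -/
  im_deriv_lower : ∀ w : ℝ → ℂ, HasWeakDeriv 1 V w →
    ∃ c > 0, ∀ᶠ x in atTop ⊓ ae volume, c * ((V x).im * bracket x ^ ν) ≤ (w x).im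

/-- `δ = x_b^{-ν} / 2`. -/
def delta (ν xb : ℝ) : ℝ := xb ^ (-ν) / 2

/-- `Δ = δ / 4`. -/
def Delta (ν xb : ℝ) : ℝ := delta ν xb / 4

/-- The interval `J_b = (x_b - δ, x_b + δ)`. -/
def J (ν xb : ℝ) : Set ℝ := Ioo (xb - delta ν xb) (xb + delta ν xb)

/-- The interval `J_b' = (x_b - δ + Δ, x_b + δ - Δ)`. -/
def J' (ν xb : ℝ) : Set ℝ :=
  Ioo (xb - delta ν xb + Delta ν xb) (xb + delta ν xb - Delta ν xb)

/-- Smooth cut-offs around the turning point, with `‖ξ^{(j)}‖_∞ ≤ K Δ^{-j}` for `j = 1, 2`. -/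
structure IsCutoff (K ν xb : ℝ) (ξ : ℝ → ℝ) : Prop where
  smooth : ContDiff ℝ ∞ ξ
  compact : HasCompactSupport ξ
  support : tsupport ξ ⊆ Ioi 0
  range : ∀ x, 0 ≤ ξ x ∧ ξ x ≤ 1
  eq_one : ∀ x ∈ J' ν xb, ξ x = 1
  eq_zero : ∀ x ∉ J ν xb, ξ x = 0
  deriv_le : ∀ j ∈ Finset.Icc 1 2, ∀ x, |iteratedDeriv j ξ x| ≤ K * (Delta ν xb ^ j)⁻¹

/-- The window for `a = Re λ`, with implied constants `c₁, c₂, c₃`. -/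
def InWindow (c₁ c₂ c₃ ν ε₁ : ℝ) (V : ℝ → ℂ) (xb a b : ℝ) : Prop :=
  ∀ x ∈ J ν xb,
    b ^ (2 / 3 : ℝ) * xb ^ (2 * ν / 3) ≤ c₁ * |a| ∧
    |a| ≤ c₂ * (a - (V x).re) ∧
    a - (V x).re ≤ c₃ * (b ^ 2 * xb ^ (-4 * ν - 4 * ε₁ - 2))

/-- The functions `ψ'_k` of the JWKB expansion, with the index shifted by one:
`dpsi lam V j = ψ'_{j-1}`. Thus `ψ'_{-1} = i λ^{-1/2} (λ - V)^{1/2}` (principal branch) and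
`ψ'_{k+1} = (2 ψ'_{-1})⁻¹ (ψ''_k - ∑_{α+β=k; α,β≥0} ψ'_α ψ'_β)`, where `k = j - 1`, `α = i` and
`β = j - 1 - i`. -/
def dpsi (lam : ℂ) (V : ℝ → ℂ) : ℕ → ℝ → ℂ
  | 0 => fun x => Complex.I * lam ^ (-(1 / 2) : ℂ) * (lam - V x) ^ (1 / 2 : ℂ)
  | j + 1 => fun x =>
      1 / (2 * dpsi lam V 0 x) *
        (_root_.deriv (dpsi lam V j) x -
          ∑ i : Fin j, dpsi lam V (i.1 + 1) x * dpsi lam V (j - i.1) x)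
  termination_by j => j
  decreasing_by all_goals omega

/-- `g(x) = exp(-∑_{k=-1}^{n-1} λ^{-k/2} ∫_{x_b}^x ψ'_k(t) dt)`; here `k = j - 1`. -/
def g (lam : ℂ) (V : ℝ → ℂ) (n : ℕ) (xb : ℝ) (x : ℝ) : ℂ :=
  Complex.exp (-∑ j ∈ Finset.range (n + 1),
    lam ^ (-(((j : ℂ) - 1) / 2)) * ∫ t in xb..x, dpsi lam V j t)

/-- The pseudomode `f = ξ g`. -/
def pseudomode (lam : ℂ) (V : ℝ → ℂ) (n : ℕ) (xb : ℝ) (ξ : ℝ → ℝ) (x : ℝ) : ℂ :=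
  (ξ x : ℂ) * g lam V n xb x

/-- The graph of the maximal Schrödinger operator `H_V = -d²/dx² + V` in `L²((0,∞))`:
`f` and `h` are in `L²` and `h = -f'' + V f` weakly, that is, `f'' = V f - h`. -/
def IsSchrodinger (V f h : ℝ → ℂ) : Prop :=
  MemLp f 2 (volume.restrict (Ioi 0)) ∧ MemLp h 2 (volume.restrict (Ioi 0)) ∧
    HasWeakDeriv 2 f (fun x => V x * f x - h x)

/-- The norm of `L²((0,∞))`. -/
def l2norm (u : ℝ → ℂ) : ℝ := (eLpNorm u 2 (volume.restrict (Ioi 0))).toReal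

/-- The quantity inside the `O`-symbol. -/
def rate (N : ℕ) (ν ε₁ c : ℝ) (V : ℝ → ℂ) (xb a b : ℝ) : ℝ :=
  Real.exp (-c * xb ^ (ν + 1 + 2 * ε₁)) +
  xb ^ ((N : ℝ) * ν) * (⨆ x : J ν xb, (b + |(V x).re|) / (a - (V x).re) ^ ((N : ℝ) / 2)) +
  ∑ k ∈ Finset.range (N - 1), ∑ l ∈ Finset.Icc 2 (N + k),
    xb ^ (((N : ℝ) + k) * ν) *
      (⨆ x : J ν xb, (b + |(V x).re|) ^ l / (a - (V x).re) ^ (((N : ℝ) - 2 + k) / 2 + l))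

end

end Pseudomode

namespace Pseudomode

/-! ### Absolutely continuous complex-valued functions -/

theorem ac_ofReal {f : ℝ → ℝ} {a b : ℝ} (hf : AbsolutelyContinuousOnInterval f a b) :
    AbsolutelyContinuousOnInterval (fun x => (f x : ℂ)) a b := by
  unfold AbsolutelyContinuousOnInterval at hf ⊢
  simpa [Complex.dist_eq, ← Complex.ofReal_sub, Real.dist_eq] using hf

theorem ac_congr {X : Type*} [PseudoMetricSpace X] {f g : ℝ → X} {a b : ℝ}
    (hf : AbsolutelyContinuousOnInterval f a b) (h : ∀ x ∈ uIcc a b, f x = g x) :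
    AbsolutelyContinuousOnInterval g a b := by
  unfold AbsolutelyContinuousOnInterval at hf ⊢
  refine hf.congr' ?_
  rw [Filter.EventuallyEq, Filter.eventually_inf_principal]
  refine Filter.Eventually.of_forall fun E hE => Finset.sum_congr rfl fun i hi => ?_
  rw [h _ (hE.1 i hi).1, h _ (hE.1 i hi).2]

theorem ac_primitive {f : ℝ → ℂ} {a b c : ℝ} (hf : IntervalIntegrable f volume a b)
    (hc : c ∈ uIcc a b) : AbsolutelyContinuousOnInterval (fun x => ∫ t in c..x, f t) a b := by
  have hre : IntervalIntegrable (fun x => (f x).re) volume a b :=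
    ⟨hf.1.re, hf.2.re⟩
  have him : IntervalIntegrable (fun x => (f x).im) volume a b :=
    ⟨hf.1.im, hf.2.im⟩
  have h1 := ac_ofReal (hre.absolutelyContinuousOnInterval_intervalIntegral hc)
  have h2 := ac_ofReal (him.absolutelyContinuousOnInterval_intervalIntegral hc)
  have h3 := h1.fun_add (h2.const_smul Complex.I)
  have key : ∀ x ∈ uIcc a b, (∫ t in c..x, f t)
      = ((∫ t in c..x, (f t).re : ℝ) : ℂ) + Complex.I • ((∫ t in c..x, (f t).im : ℝ) : ℂ) := by
    intro x hx
    have hfx : IntervalIntegrable f volume c x := hf.mono_set (uIcc_subset_uIcc hc hx)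
    have hr : IntervalIntegrable (fun x => ((f x).re : ℂ)) volume c x :=
      ⟨hfx.1.re.ofReal, hfx.2.re.ofReal⟩
    have hi : IntervalIntegrable (fun x => ((f x).im : ℂ)) volume c x :=
      ⟨hfx.1.im.ofReal, hfx.2.im.ofReal⟩
    rw [← intervalIntegral.integral_ofReal, ← intervalIntegral.integral_ofReal,
      smul_eq_mul, ← intervalIntegral.integral_const_mul, ← intervalIntegral.integral_add hr (hi.const_mul Complex.I)]
    refine intervalIntegral.integral_congr fun t _ => ?_
    simp only [mul_comm Complex.I, Complex.re_add_im]
  exact ac_congr h3 fun x hx => (key x hx).symm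

/-- The difference of `G` and the primitive of `G'` is absolutely continuous with derivative zero
almost everywhere, hence constant. -/
theorem ac_integral_eq_sub {G G' : ℝ → ℂ} {a b : ℝ} (hG : AbsolutelyContinuousOnInterval G a b)
    (hG' : IntervalIntegrable G' volume a b)
    (hd : ∀ᵐ x, x ∈ uIcc a b → HasDerivAt G (G' x) x) :
    ∫ x in a..b, G' x = G b - G a := by
  have h1 := ac_primitive hG' (c := a) (by simp)
  let g (x : ℝ) := G x - ∫ (t : ℝ) in a..x, G' t
  have g_ac : AbsolutelyContinuousOnInterval g a b := hG.sub h1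
  have g_ae : ∀ᵐ x, x ∈ uIcc a b → HasDerivAt g 0 x := by
    filter_upwards [hd, hG'.ae_hasDerivAt_integral] with x hx₁ hx₂ hx₃
    convert! (hx₁ hx₃).sub (hx₂ hx₃ a (by simp))
    abel
  obtain ⟨C, hC⟩ := g_ac.const_of_ae_hasDerivAt_zero g_ae
  have e1 : G a = g a := by simp [g]
  have e2 := hC a (by simp)
  have e3 := hC b (by simp)
  have e4 : g b = G b - ∫ (t : ℝ) in a..b, G' t := rfl
  rw [e3, ← e2, ← e1] at e4
  rw [e4]; ring

/-! ### Test functions and the lemma of du Bois-Reymond -/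

theorem IsTestFunction.deriv {φ : ℝ → ℂ} (h : IsTestFunction φ) :
    IsTestFunction (_root_.deriv φ) := by
  refine ⟨((contDiff_infty_iff_deriv).1 h.1).2, h.2.1.deriv, ?_⟩
  exact (closure_minimal (support_deriv_subset) (isClosed_tsupport φ)).trans h.2.2

/-- The point `1` is forced into the interval because it is the base point of all primitives below.
-/
theorem exists_Ioo_of_isCompact {K : Set ℝ} (hK : IsCompact K) (h0 : K ⊆ Ioi 0) :
    ∃ α β : ℝ, 0 < α ∧ α < 1 ∧ 1 < β ∧ K ⊆ Ioo α β := by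
  obtain ⟨β, hβ⟩ := hK.bddAbove
  rcases K.eq_empty_or_nonempty with rfl | hne
  · exact ⟨1/2, 2, by norm_num, by norm_num, by norm_num, empty_subset _⟩
  obtain ⟨m, hm, hmin⟩ := hK.exists_isLeast hne
  have hm0 : 0 < m := h0 hm
  refine ⟨min m 1 / 2, max β 1 + 1, by positivity, ?_, ?_, fun x hx => ⟨?_, ?_⟩⟩
  · have := min_le_right m 1; linarith
  · have := le_max_right β 1; linarith
  · have := min_le_left m 1; have := hmin hx; linarith
  · have := le_max_left β 1; have := hβ hx; linarith

theorem setIntegral_Ioi_eq_interval {k : ℝ → ℂ} {α β : ℝ} (hα : 0 < α) (hαβ : α ≤ β)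
    (hk : ∀ x, x ∉ Ioo α β → k x = 0) : ∫ x in Ioi 0, k x = ∫ x in α..β, k x := by
  rw [intervalIntegral.integral_of_le hαβ]
  refine (setIntegral_eq_of_subset_of_forall_sdiff_eq_zero measurableSet_Ioi ?_ ?_).symm.symm
  · intro x hx; exact hα.trans hx.1
  · intro x hx; exact hk x fun h => hx.2 ⟨h.1, h.2.le⟩

theorem intervalIntegrable_of_locallyIntegrableOn {w : ℝ → ℂ} (hw : LocallyIntegrableOn w (Ioi 0))
    {a b : ℝ} (ha : 0 < a) (hb : 0 < b) : IntervalIntegrable w volume a b := by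
  rw [intervalIntegrable_iff]
  refine (hw.integrableOn_compact_subset ?_ isCompact_uIcc).mono_set uIoc_subset_uIcc
  intro x hx
  exact (lt_min ha hb).trans_le hx.1

theorem integral_primitive_mul_deriv {w φ : ℝ → ℂ} (hw : LocallyIntegrableOn w (Ioi 0))
    (hφ : IsTestFunction φ) :
    ∫ x in Ioi 0, (∫ t in (1:ℝ)..x, w t) * deriv φ x = -∫ x in Ioi 0, w x * φ x := by
  obtain ⟨α, β, hα, hα1, hβ, hK⟩ := exists_Ioo_of_isCompact hφ.2.1 hφ.2.2
  have h0 : ∀ x, x ∉ Ioo α β → φ x = 0 := fun x hx => image_eq_zero_of_notMem_tsupport fun h => hx (hK h)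
  have h0' : ∀ x, x ∉ Ioo α β → deriv φ x = 0 := fun x hx => by
    by_contra h
    exact hx (hK (support_deriv_subset h))
  have hαβ : α ≤ β := by linarith
  rw [setIntegral_Ioi_eq_interval hα hαβ (fun x hx => by rw [h0' x hx, mul_zero]),
    setIntegral_Ioi_eq_interval hα hαβ (fun x hx => by rw [h0 x hx, mul_zero])]
  have hwi : IntervalIntegrable w volume α β :=
    intervalIntegrable_of_locallyIntegrableOn hw hα (by linarith)
  have h1 : (1:ℝ) ∈ uIcc α β := by rw [uIcc_of_le hαβ]; exact ⟨hα1.le, hβ.le⟩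
  have hW := ac_primitive hwi h1
  have hφc : ContDiff ℝ 1 φ := hφ.1.of_le (by norm_cast)
  have hφac : AbsolutelyContinuousOnInterval φ α β := hφc.contDiffOn.absolutelyContinuousOnInterval
  have hd : ∀ᵐ x, x ∈ uIcc α β → HasDerivAt (fun x => (∫ t in (1:ℝ)..x, w t) • φ x)
      ((∫ t in (1:ℝ)..x, w t) * deriv φ x + w x * φ x) x := by
    filter_upwards [hwi.ae_hasDerivAt_integral] with x hx hx'
    have := (hx hx' 1 h1).mul (hφc.differentiable (by norm_num) x).hasDerivAt
    convert! this using 1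
    ring
  have hi1 : IntervalIntegrable (fun x => (∫ t in (1:ℝ)..x, w t) * deriv φ x) volume α β :=
    (hW.continuousOn.mul (hφc.continuous_deriv (by norm_num)).continuousOn).intervalIntegrable
  have hi2 : IntervalIntegrable (fun x => w x * φ x) volume α β :=
    hwi.mul_continuousOn hφc.continuous.continuousOn
  have := ac_integral_eq_sub (hW.fun_smul hφac) (hi1.add hi2) hd
  rw [h0 α (fun h => lt_irrefl _ h.1), h0 β (fun h => lt_irrefl _ h.2)] at this
  simp only [smul_zero, sub_zero] at this
  rw [intervalIntegral.integral_add hi1 hi2] at this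
  exact eq_neg_of_add_eq_zero_left this

/-- The vanishing mean makes the primitive zero to the right of `β` as well, so its support stays
compact in `(0,∞)`. -/
theorem isTestFunction_primitive {g : ℝ → ℝ} (hg : ContDiff ℝ ∞ g) {α β : ℝ} (hα : 0 < α)
    (hK : ∀ x, x ∉ Ioo α β → g x = 0) (hint : ∫ x in α..β, g x = 0) :
    IsTestFunction (fun x => ((∫ t in α..x, g t : ℝ) : ℂ)) ∧
      ∀ x, deriv (fun x => ((∫ t in α..x, g t : ℝ) : ℂ)) x = g x := by
  have hd : ∀ x, HasDerivAt (fun x => ∫ t in α..x, g t) (g x) x := fun x =>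
    hg.continuous.integral_hasStrictDerivAt α x |>.hasDerivAt
  have hdc : ∀ x, HasDerivAt (fun x => ((∫ t in α..x, g t : ℝ) : ℂ)) (g x) x := fun x =>
    (hd x).ofReal_comp
  have hsm : ContDiff ℝ ∞ (fun x => ∫ t in α..x, g t) := by
    rw [contDiff_infty_iff_deriv]
    refine ⟨fun x => (hd x).differentiableAt, ?_⟩
    rwa [show deriv (fun x => ∫ t in α..x, g t) = g from funext fun x => (hd x).deriv]
  have hsupp : tsupport (fun x => ((∫ t in α..x, g t : ℝ) : ℂ)) ⊆ Icc α β := by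
    refine closure_minimal ?_ isClosed_Icc
    intro x hx
    by_contra hcon
    apply hx
    simp only [Complex.ofReal_eq_zero]
    rcases lt_or_ge x α with h | h
    · rw [intervalIntegral.integral_congr (g := fun _ => (0:ℝ)), intervalIntegral.integral_zero]
      intro t ht
      rw [uIcc_of_ge h.le] at ht
      exact hK t fun h' => not_lt.2 ht.2 h'.1
    · have hb : β < x := by
        by_contra h'
        exact hcon ⟨h, not_lt.1 h'⟩
      rw [← intervalIntegral.integral_add_adjacent_intervals
        (hg.continuous.intervalIntegrable α β) (hg.continuous.intervalIntegrable β x), hint,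
        zero_add, intervalIntegral.integral_congr (g := fun _ => (0:ℝ)),
        intervalIntegral.integral_zero]
      intro t ht
      rw [uIcc_of_le hb.le] at ht
      exact hK t fun h' => not_lt.2 ht.1 h'.2
  refine ⟨⟨Complex.ofRealCLM.contDiff.comp hsm, ?_, ?_⟩, fun x => (hdc x).deriv⟩
  · exact isCompact_Icc.of_isClosed_subset (isClosed_tsupport _) hsupp
  · exact hsupp.trans fun x hx => hα.trans_le hx.1

/-- A test function becomes the derivative of a test function once a multiple of a fixed bump `φ₀`
of integral one is subtracted to cancel its mean. Hence `∫ v g = (∫ v φ₀)(∫ g)`, and `v - ∫ v φ₀`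
integrates to zero against every `g`. Real `g` suffice for the final vanishing criterion. -/
theorem ae_eq_const_of_integral_mul_deriv_eq_zero {v : ℝ → ℂ} (hv : LocallyIntegrableOn v (Ioi 0))
    (h : ∀ φ, IsTestFunction φ → ∫ x in Ioi 0, v x * deriv φ x = 0) :
    ∃ c : ℂ, ∀ᵐ x, x ∈ Ioi (0:ℝ) → v x = c := by
  let B : ContDiffBump (1:ℝ) := ⟨1/4, 1/2, by norm_num, by norm_num⟩
  let φ₀ : ℝ → ℝ := B.normed volume
  have hφ₀ : ContDiff ℝ ∞ φ₀ := B.contDiff_normed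
  have hφ₀s : ∀ x, x ∉ Icc (1/2 : ℝ) (3/2) → φ₀ x = 0 := by
    intro x hx
    apply image_eq_zero_of_notMem_tsupport
    rw [B.tsupport_normed_eq, Real.closedBall_eq_Icc]
    convert hx using 3 <;> norm_num [B]
  have hφ₀c : HasCompactSupport φ₀ := B.hasCompactSupport_normed
  refine ⟨∫ x in Ioi 0, v x * φ₀ x, ?_⟩
  set c : ℂ := ∫ x in Ioi 0, v x * φ₀ x
  have hvc : LocallyIntegrableOn (fun x => v x - c) (Ioi 0) :=
    hv.sub (continuousOn_const.locallyIntegrableOn measurableSet_Ioi)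
  have hmulint : ∀ (u : ℝ → ℂ), LocallyIntegrableOn u (Ioi 0) → ∀ k : ℝ → ℝ, Continuous k →
      ∀ α β : ℝ, 0 < α → α ≤ β → (∀ x, x ∉ Ioo α β → k x = 0) →
      IntegrableOn (fun x => u x * k x) (Ioi 0) := by
    intro u hu k hk α β hα hαβ hk0
    have h1 : IntegrableOn u (Icc α β) :=
      hu.integrableOn_compact_subset (fun x hx => hα.trans_le hx.1) isCompact_Icc
    have h2 : IntegrableOn (fun x => u x * k x) (Icc α β) :=
      h1.mul_continuousOn (Complex.continuous_ofReal.comp hk).continuousOn isCompact_Icc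
    refine (h2.integrable_of_forall_notMem_eq_zero ?_).integrableOn
    intro x hx
    rw [hk0 x fun h => hx ⟨h.1.le, h.2.le⟩]; simp
  have key := isOpen_Ioi.ae_eq_zero_of_integral_contDiff_smul_eq_zero hvc (μ := volume) ?_
  · filter_upwards [key] with x hx hx0
    exact sub_eq_zero.1 (hx hx0)
  intro g hg hgc hgs
  obtain ⟨α', β', hα', hα1', hβ', hK'⟩ := exists_Ioo_of_isCompact
    (hgc.isCompact.union (isCompact_Icc (a := (1/2:ℝ)) (b := 3/2)))
    (union_subset hgs fun x hx => by have := hx.1; simp only [mem_Ioi]; linarith)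
  have hαβ : α' ≤ β' := by linarith
  have hg0 : ∀ x, x ∉ Ioo α' β' → g x = 0 := fun x hx =>
    image_eq_zero_of_notMem_tsupport fun h => hx (hK' (Or.inl h))
  have hφ0 : ∀ x, x ∉ Ioo α' β' → φ₀ x = 0 := fun x hx => hφ₀s x fun h => hx (hK' (Or.inr h))
  set I : ℝ := ∫ x in α'..β', g x
  have hI1 : ∫ x in α'..β', φ₀ x = 1 := by
    rw [← B.integral_normed (μ := volume), intervalIntegral.integral_of_le hαβ]
    refine setIntegral_eq_integral_of_forall_compl_eq_zero fun x hx => hφ0 x fun h => hx ⟨h.1, h.2.le⟩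
  have hgi : ∀ x, x ∉ Ioo α' β' → g x - I * φ₀ x = 0 := fun x hx => by
    rw [hg0 x hx, hφ0 x hx]; simp
  obtain ⟨ht, htd⟩ := isTestFunction_primitive (hg.sub (contDiff_const.mul hφ₀)) hα' hgi (by
    rw [intervalIntegral.integral_sub (f := g) (g := fun x => I * φ₀ x)
      (hg.continuous.intervalIntegrable _ _)
      ((continuous_const.mul hφ₀.continuous).intervalIntegrable _ _),
      intervalIntegral.integral_const_mul, hI1]
    simp [I])
  have h1 := h _ ht
  simp only [htd] at h1
  have hs1 : ∫ x, g x • (v x - c) = ∫ x in Ioi 0, g x • (v x - c) := by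
    refine (setIntegral_eq_integral_of_forall_compl_eq_zero fun x hx => ?_).symm
    rw [hg0 x fun h => hx (hα'.trans h.1), zero_smul]
  have i1 := hmulint v hv g hg.continuous α' β' hα' hαβ hg0
  have i2 := hmulint v hv φ₀ hφ₀.continuous α' β' hα' hαβ hφ0
  have i3 := hmulint (fun _ => c) (continuousOn_const.locallyIntegrableOn measurableSet_Ioi)
    g hg.continuous α' β' hα' hαβ hg0
  have hIc : ∫ x in Ioi 0, (g x : ℂ) = I := by
    rw [setIntegral_Ioi_eq_interval hα' hαβ (fun x hx => by rw [hg0 x hx]; simp),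
      intervalIntegral.integral_ofReal]
  have e1 : ∫ x in Ioi 0, v x * ((g x - I * φ₀ x : ℝ) : ℂ)
      = (∫ x in Ioi 0, v x * g x) - I * c := by
    rw [← integral_const_mul, ← integral_sub i1 (i2.const_mul _)]
    congr 1; ext x; push_cast; ring
  have e2 : ∫ x in Ioi 0, g x • (v x - c) = (∫ x in Ioi 0, v x * g x) - c * I := by
    rw [← hIc, ← integral_const_mul, ← integral_sub i1 i3]
    congr 1; ext x; rw [Complex.real_smul]; ring
  rw [hs1, e2, mul_comm c, ← e1]
  exact h1

theorem HasWeakDeriv.step {m : ℕ} {V u w : ℝ → ℂ} (hu : HasWeakDeriv m V u)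
    (hw : HasWeakDeriv (m + 1) V w) {φ : ℝ → ℂ} (hφ : IsTestFunction φ) :
    ∫ x in Ioi 0, u x * _root_.deriv φ x = -∫ x in Ioi 0, w x * φ x := by
  have h1 := hu.2.2 _ hφ.deriv
  have h2 := hw.2.2 _ hφ
  rw [iteratedDeriv_succ'] at h2
  rw [h1, pow_succ, mul_assoc] at h2
  have := mul_left_cancel₀ (pow_ne_zero m (by norm_num : (-1:ℂ) ≠ 0)) h2
  simpa using this

/-- `u` and the primitive of `w` have the same weak derivative `w`, so du Bois-Reymond applies to
their difference. -/
theorem HasWeakDeriv.ae_eq_primitive {m : ℕ} {V u w : ℝ → ℂ} (hu : HasWeakDeriv m V u)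
    (hw : HasWeakDeriv (m + 1) V w) :
    ∃ c : ℂ, ∀ᵐ x, x ∈ Ioi (0:ℝ) → u x = c + ∫ t in (1:ℝ)..x, w t := by
  have hW : ContinuousOn (fun x => ∫ t in (1:ℝ)..x, w t) (Ioi 0) := by
    intro x hx
    have hx0 : 0 < x := hx
    have hi := intervalIntegrable_of_locallyIntegrableOn hw.2.1 (a := min x 1 / 2)
      (b := max x 1 + 1) (by positivity) (by positivity)
    have hle : min x 1 / 2 ≤ max x 1 + 1 := by
      have := min_le_left x 1; have := le_max_left x 1; linarith [lt_min hx0 one_pos]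
    have := (ac_primitive hi (c := 1) (by
      rw [uIcc_of_le hle]
      constructor
      · linarith [min_le_right x 1]
      · linarith [le_max_right x 1])).continuousOn
    rw [uIcc_of_le hle] at this
    refine (this.continuousAt (Icc_mem_nhds ?_ ?_)).continuousWithinAt
    · linarith [min_le_left x 1, lt_min hx0 one_pos]
    · linarith [le_max_left x 1]
  have hWi := hW.locallyIntegrableOn (μ := volume) measurableSet_Ioi
  obtain ⟨c, hc⟩ := ae_eq_const_of_integral_mul_deriv_eq_zero (hu.2.1.sub hWi) (fun φ hφ => by
    obtain ⟨α, β, hα, hα1, hβ, hK⟩ := exists_Ioo_of_isCompact hφ.deriv.2.1 hφ.deriv.2.2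
    have hmulint : ∀ (u : ℝ → ℂ), LocallyIntegrableOn u (Ioi 0) →
        IntegrableOn (fun x => u x * deriv φ x) (Ioi 0) := by
      intro u hu
      have h1 : IntegrableOn u (Icc α β) :=
        hu.integrableOn_compact_subset (fun x hx => hα.trans_le hx.1) isCompact_Icc
      have h2 : IntegrableOn (fun x => u x * deriv φ x) (Icc α β) :=
        h1.mul_continuousOn hφ.deriv.1.continuous.continuousOn isCompact_Icc
      refine (h2.integrable_of_forall_notMem_eq_zero ?_).integrableOn
      intro x hx
      rw [image_eq_zero_of_notMem_tsupport (f := deriv φ) fun h => hx ⟨(hK h).1.le, (hK h).2.le⟩,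
        mul_zero]
    have e : ∀ x, (u - fun x => ∫ t in (1:ℝ)..x, w t) x * deriv φ x
        = u x * deriv φ x - (∫ t in (1:ℝ)..x, w t) * deriv φ x := fun x => by
      simp [sub_mul]
    simp only [e]
    rw [integral_sub (hmulint u hu.2.1) (hmulint _ hWi), hu.step hw hφ,
      integral_primitive_mul_deriv hw.2.1 hφ, sub_self])
  refine ⟨c, ?_⟩
  filter_upwards [hc] with x hx hx0
  rw [← hx hx0]; simp

/-! ### Classical regularity of the potential -/

/-- `D m` is the derivative of order `m` of `V` on `(0,∞)`: classical for `m < N`, and almost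
everywhere for `m = N`, the function `D (N - 1)` being locally absolutely continuous. -/
structure IsJet (N : ℕ) (V : ℝ → ℂ) (D : ℕ → ℝ → ℂ) : Prop where
  zero : ∀ x > 0, D 0 x = V x
  hasDerivAt : ∀ m, m + 1 < N → ∀ x > 0, HasDerivAt (D m) (D (m + 1) x) x
  ae_hasDerivAt : ∀ m < N, ∀ᵐ x, 0 < x → HasDerivAt (D m) (D (m + 1) x) x
  ac : ∀ m < N, ∀ a b, 0 < a → 0 < b → AbsolutelyContinuousOnInterval (D m) a b
  continuousAt : ∀ m < N, ∀ x > 0, ContinuousAt (D m) x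
  weak : ∀ m ≤ N, HasWeakDeriv m V (D m)

theorem HasWeakDeriv.congr_ae {m : ℕ} {V u w : ℝ → ℂ} (hu : HasWeakDeriv m V u)
    (h : ∀ᵐ x, x ∈ Ioi (0:ℝ) → u x = w x) : HasWeakDeriv m V w := by
  have h' : u =ᵐ[volume.restrict (Ioi 0)] w := (ae_restrict_iff' measurableSet_Ioi).2 h
  refine ⟨hu.1, ?_, fun φ hφ => ?_⟩
  · rw [locallyIntegrableOn_iff isOpen_Ioi.isLocallyClosed]
    intro k hk hkc
    have := (locallyIntegrableOn_iff isOpen_Ioi.isLocallyClosed).1 hu.2.1 k hk hkc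
    refine this.congr ?_
    exact ae_restrict_of_ae_restrict_of_subset hk h'
  · rw [hu.2.2 φ hφ]
    congr 1
    refine integral_congr_ae ?_
    filter_upwards [h'] with x hx
    rw [hx]

theorem continuousAt_of_ac {f : ℝ → ℂ}
    (h : ∀ a b, 0 < a → 0 < b → AbsolutelyContinuousOnInterval f a b) {x : ℝ} (hx : 0 < x) :
    ContinuousAt f x := by
  have := (h (x / 2) (x + 1) (by positivity) (by positivity)).continuousOn
  rw [uIcc_of_le (by linarith)] at this
  exact this.continuousAt (Icc_mem_nhds (by linarith) (by linarith))

theorem ac_primitive_of_locallyIntegrableOn {w : ℝ → ℂ} (hw : LocallyIntegrableOn w (Ioi 0))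
    {a b : ℝ} (ha : 0 < a) (hb : 0 < b) :
    AbsolutelyContinuousOnInterval (fun x => ∫ t in (1:ℝ)..x, w t) a b := by
  have h := ac_primitive (c := 1) (intervalIntegrable_of_locallyIntegrableOn hw
    (a := min a (min b 1)) (b := max a (max b 1)) (by positivity) (by positivity)) ?_
  · refine h.mono (uIcc_subset_uIcc ?_ ?_) <;>
      rw [uIcc_of_le ((min_le_left _ _).trans (le_max_left _ _))]
    · exact ⟨min_le_left _ _, le_max_left _ _⟩
    · exact ⟨(min_le_right _ _).trans (min_le_left _ _),
        (le_max_left _ _).trans (le_max_right _ _)⟩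
  · rw [uIcc_of_le ((min_le_left _ _).trans (le_max_left _ _))]
    exact ⟨(min_le_right _ _).trans (min_le_right _ _),
      (le_max_right _ _).trans (le_max_right _ _)⟩

theorem ae_hasDerivAt_primitive {w : ℝ → ℂ} (hw : LocallyIntegrableOn w (Ioi 0)) :
    ∀ᵐ x, 0 < x → HasDerivAt (fun x => ∫ t in (1:ℝ)..x, w t) (w x) x := by
  have h : ∀ n : ℕ, ∀ᵐ x, x ∈ uIcc ((1:ℝ) / (n + 1)) (n + 1) →
      ∀ c ∈ uIcc ((1:ℝ) / (n + 1)) (n + 1), HasDerivAt (fun x => ∫ t in c..x, w t) (w x) x :=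
    fun n => (intervalIntegrable_of_locallyIntegrableOn hw (by positivity)
      (by positivity)).ae_hasDerivAt_integral
  filter_upwards [ae_all_iff.2 h] with x hx hx0
  obtain ⟨n, hn⟩ := exists_nat_gt (max x (1 / x))
  have hn1 : x < n := (le_max_left _ _).trans_lt hn
  have hn2 : 1 / x < n := (le_max_right _ _).trans_lt hn
  have hnn : (0:ℝ) ≤ n := n.cast_nonneg
  have hle : (1:ℝ) / (n + 1) ≤ n + 1 := by
    rw [div_le_iff₀ (by positivity)]; nlinarith
  refine hx n ?_ 1 ?_
  · rw [uIcc_of_le hle]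
    refine ⟨?_, by linarith⟩
    rw [div_le_iff₀ (by positivity)]
    rw [div_lt_iff₀ hx0] at hn2
    nlinarith
  · rw [uIcc_of_le hle]
    refine ⟨?_, by linarith⟩
    rw [div_le_iff₀ (by positivity)]; linarith

theorem primitive_congr_ae {u w : ℝ → ℂ} (h : ∀ᵐ x, x ∈ Ioi (0:ℝ) → u x = w x) {x : ℝ}
    (hx : 0 < x) : ∫ t in (1:ℝ)..x, u t = ∫ t in (1:ℝ)..x, w t := by
  refine intervalIntegral.integral_congr_ae ?_
  filter_upwards [h] with t ht ht'
  exact ht ((lt_min one_pos hx).trans ht'.1)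

/-- Each weak derivative of order `m < N` agrees almost everywhere with a primitive of the next one.
Taking that primitive as `D m` gives absolute continuity, and classical differentiability as soon as
`D (m + 1)` is itself continuous, that is for `m + 1 < N`. -/
theorem exists_isJet {N : ℕ} (hN : 1 < N) {V : ℝ → ℂ} (hV : MemSobolevLocInfty N V)
    (hc : ContinuousOn V (Ioi 0)) : ∃ D, IsJet N V D := by
  have hVl : LocallyIntegrableOn V (Ioi 0) := hc.locallyIntegrableOn measurableSet_Ioi
  have hw : ∃ w : ℕ → ℝ → ℂ, w 0 = V ∧ ∀ m ≤ N, HasWeakDeriv m V (w m) := by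
    choose! w hw using hV
    refine ⟨fun m => if m = 0 then V else w m, by simp, fun m hm => ?_⟩
    rcases Nat.eq_zero_or_pos m with rfl | h
    · simp only [if_true]
      exact ⟨hVl, hVl, fun φ _ => by simp⟩
    · simp only [h.ne', if_false]
      exact (hw m hm).1
  obtain ⟨w, hw0, hw⟩ := hw
  have hcst : ∀ m, ∃ c : ℂ, m < N → ∀ᵐ x, x ∈ Ioi (0:ℝ) → w m x = c + ∫ t in (1:ℝ)..x, w (m+1) t := by
    intro m
    by_cases hm : m < N
    · obtain ⟨c, h⟩ := (hw m hm.le).ae_eq_primitive (hw (m+1) hm)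
      exact ⟨c, fun _ => h⟩
    · exact ⟨0, fun h => absurd h hm⟩
  choose c hc' using hcst
  -- At the top order there is no further derivative to integrate, so the weak derivative itself is
  -- kept.
  let D : ℕ → ℝ → ℂ := fun m => if m < N then fun x => c m + ∫ t in (1:ℝ)..x, w (m+1) t else w m
  have hDw : ∀ m ≤ N, ∀ᵐ x, x ∈ Ioi (0:ℝ) → w m x = D m x := by
    intro m hm
    by_cases h : m < N
    · simp only [D, h, if_true]; exact hc' m h
    · simp [D, h]
  have hweak : ∀ m ≤ N, HasWeakDeriv m V (D m) := fun m hm => (hw m hm).congr_ae (hDw m hm)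
  have hDeq : ∀ m < N, ∀ x > 0, D m x = c m + ∫ t in (1:ℝ)..x, D (m+1) t := by
    intro m hm x hx
    rw [← primitive_congr_ae (hDw (m+1) hm) hx]
    simp [D, hm]
  have hac : ∀ m < N, ∀ a b, 0 < a → 0 < b → AbsolutelyContinuousOnInterval (D m) a b := by
    intro m hm a b ha hb
    have hcc : AbsolutelyContinuousOnInterval (fun _ : ℝ => c m) a b :=
      (contDiff_const.contDiffOn).absolutelyContinuousOnInterval
    refine ac_congr (hcc.fun_add
      (ac_primitive_of_locallyIntegrableOn (hweak (m+1) hm).2.1 ha hb)) fun x hx => ?_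
    exact (hDeq m hm x ((lt_min ha hb).trans_le hx.1)).symm
  have hcont : ∀ m < N, ∀ x > 0, ContinuousAt (D m) x := fun m hm x hx =>
    continuousAt_of_ac (hac m hm) hx
  have hev : ∀ m < N, ∀ x > 0, ∀ d, HasDerivAt (fun x => ∫ t in (1:ℝ)..x, D (m+1) t) d x →
      HasDerivAt (D m) d x := by
    intro m hm x hx d hd
    refine (hd.const_add (c m)).congr_of_eventuallyEq ?_
    filter_upwards [lt_mem_nhds hx] with y hy
    exact hDeq m hm y hy
  refine ⟨D, fun x hx => ?_, fun m hm x hx => ?_, fun m hm => ?_, hac, hcont, hweak⟩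
  -- `V` and `D 0` agree almost everywhere and both are continuous, hence they agree at every point
  -- of `(0,∞)`.
  · have h1 : V =ᵐ[volume.restrict (Ioi 0)] D 0 := by
      rw [Filter.EventuallyEq, ae_restrict_iff' measurableSet_Ioi, ← hw0]
      exact hDw 0 (by omega)
    have h2 := MeasureTheory.Measure.eqOn_open_of_ae_eq h1 isOpen_Ioi hc
      (fun x hx => (hcont 0 (by omega) x hx).continuousWithinAt)
    exact (h2 hx).symm
  · refine hev m (by omega) x hx _ ?_
    refine intervalIntegral.integral_hasDerivAt_right
      (intervalIntegrable_of_locallyIntegrableOn (hweak (m+1) hm.le).2.1 one_pos hx) ?_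
      (hcont (m+1) hm x hx)
    exact ContinuousOn.stronglyMeasurableAtFilter isOpen_Ioi
      (fun y hy => (hcont (m+1) hm y hy).continuousWithinAt) x hx
  · filter_upwards [ae_hasDerivAt_primitive (hweak (m+1) hm).2.1] with x hx hx0
    exact hev m hm x hx0 _ (hx hx0)

/-- Needed for the uniqueness of the turning point: a large value `b` of `Im V` cannot be taken at
small `x`. The essential bound on the weak derivative of order zero becomes a pointwise bound
because a violation by the continuous `V` would persist on an open set. -/
theorem bounded_near_zero {N : ℕ} {V : ℝ → ℂ} (hV : MemSobolevLocInfty N V)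
    (hc : ContinuousOn V (Ioi 0)) (R : ℝ) : ∃ B : ℝ, ∀ x ∈ Ioo 0 R, ‖V x‖ ≤ B := by
  rcases le_or_gt R 0 with hR | hR
  · exact ⟨0, fun x hx => absurd (hx.1.trans hx.2) (not_lt.2 hR)⟩
  obtain ⟨w, hw, hb⟩ := hV 0 (Nat.zero_le _)
  have hVl : LocallyIntegrableOn V (Ioi 0) := hc.locallyIntegrableOn measurableSet_Ioi
  have hVw : ∀ᵐ x, x ∈ Ioi (0:ℝ) → (w x - V x) = 0 := by
    refine isOpen_Ioi.ae_eq_zero_of_integral_contDiff_smul_eq_zero (hw.2.1.sub hVl) ?_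
    intro g hg hgc hgs
    have ht : IsTestFunction (fun x => (g x : ℂ)) := by
      refine ⟨Complex.ofRealCLM.contDiff.comp hg, ?_, ?_⟩
      · exact hgc.comp_left (g := fun x : ℝ => (x : ℂ)) (by simp)
      · refine (closure_mono ?_).trans hgs
        intro x hx
        simp only [Function.mem_support] at hx ⊢
        exact_mod_cast hx
    obtain ⟨α, β, hα, hα1, hβ, hK⟩ := exists_Ioo_of_isCompact hgc hgs
    have hmulint : ∀ (u : ℝ → ℂ), LocallyIntegrableOn u (Ioi 0) →
        IntegrableOn (fun x => u x * g x) (Ioi 0) := by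
      intro u hu
      have h1 : IntegrableOn u (Icc α β) :=
        hu.integrableOn_compact_subset (fun x hx => hα.trans_le hx.1) isCompact_Icc
      have h2 : IntegrableOn (fun x => u x * g x) (Icc α β) :=
        h1.mul_continuousOn (Complex.continuous_ofReal.comp hg.continuous).continuousOn
          isCompact_Icc
      refine (h2.integrable_of_forall_notMem_eq_zero ?_).integrableOn
      intro x hx
      rw [image_eq_zero_of_notMem_tsupport (f := g) fun h => hx ⟨(hK h).1.le, (hK h).2.le⟩]
      simp
    have e := hw.2.2 _ ht
    simp only [iteratedDeriv_zero, pow_zero, one_mul] at e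
    rw [← setIntegral_eq_integral_of_forall_compl_eq_zero (s := Ioi 0)]
    · have e' : ∀ x, g x • ((w - V) x) = w x * g x - V x * g x := fun x => by
        rw [Complex.real_smul, Pi.sub_apply]; ring
      change ∫ x in Ioi 0, g x • ((w - V) x) = 0
      simp only [e']
      rw [integral_sub (hmulint w hw.2.1) (hmulint V hVl), e, sub_self]
    · intro x hx
      rw [image_eq_zero_of_notMem_tsupport (f := g) fun h => hx (hgs h), zero_smul]
  have hbR := hb R hR
  refine ⟨(eLpNorm w ⊤ (volume.restrict (Ioo 0 R))).toReal, ?_⟩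
  have h1 : ∀ᵐ x ∂(volume.restrict (Ioo 0 R)),
      ‖V x‖ ≤ (eLpNorm w ⊤ (volume.restrict (Ioo 0 R))).toReal := by
    have h2 := ae_le_eLpNormEssSup (f := w) (μ := volume.restrict (Ioo 0 R))
    have h3 : ∀ᵐ x ∂(volume.restrict (Ioo 0 R)), x ∈ Ioi (0:ℝ) → (w x - V x) = 0 :=
      ae_restrict_of_ae hVw
    filter_upwards [h2, h3, ae_restrict_mem measurableSet_Ioo] with x hx hx' hxm
    rw [← sub_eq_zero.1 (hx' hxm.1), ← toReal_enorm]
    refine ENNReal.toReal_mono hbR.2.ne ?_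
    rw [eLpNorm_exponent_top]
    exact hx
  by_contra! hcon
  obtain ⟨x, hx, hx'⟩ := hcon
  have hcx : ContinuousAt V x := hc.continuousAt (Ioi_mem_nhds hx.1)
  have hev : ∀ᶠ y in 𝓝 x, y ∈ Ioo 0 R ∧
      (eLpNorm w ⊤ (volume.restrict (Ioo 0 R))).toReal < ‖V y‖ :=
    Filter.Eventually.and (Ioo_mem_nhds hx.1 hx.2) (hcx.norm.eventually (lt_mem_nhds hx'))
  rw [ae_restrict_iff' measurableSet_Ioo] at h1
  obtain ⟨s, hs, hso, hxs⟩ := mem_nhds_iff.1 hev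
  have h0 : volume s = 0 := by
    refine measure_mono_null ?_ (ae_iff.1 h1)
    intro y hy
    exact fun h => not_lt.2 (h (hs hy).1) (hs hy).2
  exact (hso.measure_pos volume ⟨x, hxs⟩).ne' h0

/-! ### Behaviour of the potential at infinity -/

theorem le_bracket {x : ℝ} : x ≤ bracket x := by
  unfold bracket
  exact Real.le_sqrt_of_sq_le (by linarith)

theorem bracket_le {x : ℝ} (hx : 1 ≤ x) : bracket x ≤ 2 * x := by
  unfold bracket
  rw [Real.sqrt_le_left (by linarith)]
  nlinarith

/-- From `x ≤ ⟨x⟩ ≤ 2x` for `x ≥ 1`; the sign of `s` decides which of the two inequalities is used.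
-/
theorem bracket_rpow_le {x : ℝ} (hx : 1 ≤ x) (s : ℝ) : bracket x ^ s ≤ 2 ^ |s| * x ^ s := by
  have hx0 : 0 < x := by linarith
  have hb : 0 < bracket x := hx0.trans_le le_bracket
  rcases le_or_gt 0 s with hs | hs
  · rw [abs_of_nonneg hs, ← Real.mul_rpow (by norm_num) hx0.le]
    exact Real.rpow_le_rpow hb.le (bracket_le hx) hs
  · calc bracket x ^ s ≤ x ^ s := Real.rpow_le_rpow_of_nonpos hx0 le_bracket hs.le
      _ = 1 * x ^ s := (one_mul _).symm
      _ ≤ 2 ^ |s| * x ^ s := by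
        gcongr
        exact Real.one_le_rpow (by norm_num) (abs_nonneg s)

theorem le_bracket_rpow {x : ℝ} (hx : 1 ≤ x) (s : ℝ) : x ^ s ≤ 2 ^ |s| * bracket x ^ s := by
  have hx0 : 0 < x := by linarith
  have hb : 0 < bracket x := hx0.trans_le le_bracket
  have h := bracket_rpow_le hx (-s)
  rw [Real.rpow_neg hb.le, Real.rpow_neg hx0.le, abs_neg, ← div_eq_mul_inv,
    inv_le_comm₀ (by positivity) (by positivity), inv_div, div_le_iff₀ (by positivity)] at h
  linarith

theorem exists_of_eventually_atTop_inf_ae {p : ℝ → Prop}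
    (h : ∀ᶠ x in atTop ⊓ ae volume, p x) : ∃ X, ∀ᵐ x : ℝ, X ≤ x → p x := by
  obtain ⟨s, hs, t, ht, hst⟩ := Filter.mem_inf_iff.1 h
  obtain ⟨X, hX⟩ := Filter.mem_atTop_sets.1 hs
  refine ⟨X, ?_⟩
  filter_upwards [ht] with x hx hXx
  have : x ∈ s ∩ t := ⟨hX x hXx, hx⟩
  rw [← hst] at this
  exact this

/-- A strict violation at one point spreads to a neighbourhood, which has positive measure. This is
how the almost-everywhere bounds become pointwise for the continuous derivatives. -/
theorem le_of_ae_le {f g : ℝ → ℝ} {X : ℝ} (hf : ∀ x > X, ContinuousAt f x)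
    (hg : ∀ x > X, ContinuousAt g x) (h : ∀ᵐ x, X ≤ x → f x ≤ g x) : ∀ x > X, f x ≤ g x := by
  by_contra! hcon
  obtain ⟨x, hx, hlt⟩ := hcon
  have hev : ∀ᶠ y in 𝓝 x, X < y ∧ g y < f y :=
    (lt_mem_nhds hx).and ((hg x hx).eventually_lt (hf x hx) hlt)
  obtain ⟨s, hs, hso, hxs⟩ := mem_nhds_iff.1 hev
  have h0 : volume s = 0 := by
    refine measure_mono_null ?_ (ae_iff.1 h)
    intro y hy
    exact fun h => not_lt.2 (h (hs hy).1.le) (hs hy).2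
  exact (hso.measure_pos volume ⟨x, hxs⟩).ne' h0

/-- Pointwise form, on a half-line `[X, ∞)`, of the hypotheses on the potential. -/
structure TailBound (N : ℕ) (ν ε : ℝ) (V : ℝ → ℂ) (D : ℕ → ℝ → ℂ) (X C c : ℝ) : Prop where
  one_le : 1 ≤ X
  one_le_const : 1 ≤ C
  const_pos : 0 < c
  im_pos : ∀ x ≥ X, 1 ≤ (V x).im
  im_lower : ∀ x ≥ X, c * ((V x).im * x ^ ν) ≤ (D 1 x).im
  im_upper : ∀ x ≥ X, |(D 1 x).im| ≤ C * ((V x).im * x ^ ν)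
  deriv_le : ∀ m, 1 ≤ m → m < N → ∀ x ≥ X, ‖D m x‖ ≤ C * (‖V x‖ * (x ^ ν) ^ m)
  ae_deriv_le : ∀ᵐ x, X ≤ x → ‖D N x‖ ≤ C * (‖V x‖ * (x ^ ν) ^ N)
  growth : ∀ x ≥ X, x ^ (4 * ν + 2 * ε + 2) ≤ C * (V x).im

theorem TailBound.mono {N : ℕ} {ν ε : ℝ} {V : ℝ → ℂ} {D : ℕ → ℝ → ℂ} {X C c X' : ℝ}
    (h : TailBound N ν ε V D X C c) (hX : X ≤ X') : TailBound N ν ε V D X' C c where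
  one_le := h.one_le.trans hX
  one_le_const := h.one_le_const
  const_pos := h.const_pos
  im_pos x hx := h.im_pos x (hX.trans hx)
  im_lower x hx := h.im_lower x (hX.trans hx)
  im_upper x hx := h.im_upper x (hX.trans hx)
  deriv_le m h1 h2 x hx := h.deriv_le m h1 h2 x (hX.trans hx)
  ae_deriv_le := by filter_upwards [h.ae_deriv_le] with x hx hx'; exact hx (hX.trans hx')
  growth x hx := h.growth x (hX.trans hx)

theorem IsJet.hasDerivAt_potential {N : ℕ} {V : ℝ → ℂ} {D : ℕ → ℝ → ℂ} (hD : IsJet N V D)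
    (hN : 1 < N) {x : ℝ} (hx : 0 < x) : HasDerivAt V (D 1 x) x := by
  refine (hD.hasDerivAt 0 hN x hx).congr_of_eventuallyEq ?_
  filter_upwards [lt_mem_nhds hx] with y hy
  exact (hD.zero y hy).symm

theorem hasDerivAt_im {f : ℝ → ℂ} {f' : ℂ} {x : ℝ} (h : HasDerivAt f f' x) :
    HasDerivAt (fun x => (f x).im) f'.im x :=
  (Complex.imCLM.hasFDerivAt.comp_hasDerivAt x h)

theorem hasDerivAt_re {f : ℝ → ℂ} {f' : ℂ} {x : ℝ} (h : HasDerivAt f f' x) :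
    HasDerivAt (fun x => (f x).re) f'.re x :=
  (Complex.reCLM.hasFDerivAt.comp_hasDerivAt x h)

theorem exists_ae_bound {ν : ℝ} {w : ℝ → ℂ} {u : ℝ → ℝ} {m : ℕ}
    (h : (fun x => w x) =O[atTop ⊓ ae volume] fun x => ‖u x‖ * bracket x ^ ((m : ℝ) * ν)) :
    ∃ X ≥ 1, ∃ C ≥ 0, ∀ᵐ x, X ≤ x → ‖w x‖ ≤ C * (‖u x‖ * (x ^ ν) ^ m) := by
  obtain ⟨C, hC, h⟩ := h.exists_nonneg
  obtain ⟨X, hX⟩ := exists_of_eventually_atTop_inf_ae h.bound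
  refine ⟨max X 1, le_max_right _ _, C * 2 ^ |(m:ℝ) * ν|, by positivity, ?_⟩
  filter_upwards [hX] with x hx hXx
  have hx1 : 1 ≤ x := (le_max_right _ _).trans hXx
  have hx0 : 0 < x := by linarith
  have hb : 0 < bracket x := hx0.trans_le le_bracket
  refine (hx ((le_max_left _ _).trans hXx)).trans ?_
  have h1 := bracket_rpow_le hx1 ((m:ℝ) * ν)
  have e : x ^ ((m:ℝ) * ν) = (x ^ ν) ^ m := by
    rw [mul_comm, Real.rpow_mul_natCast hx0.le]
  rw [norm_mul, norm_norm,
    Real.norm_of_nonneg (show 0 ≤ bracket x ^ ((m:ℝ) * ν) by positivity)]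
  rw [e] at h1
  calc C * (‖u x‖ * bracket x ^ ((m:ℝ) * ν))
      ≤ C * (‖u x‖ * (2 ^ |(m:ℝ) * ν| * (x ^ ν) ^ m)) := by gcongr
    _ = _ := by ring

theorem Admissible.exists_tailBound {N : ℕ} (hN : 1 < N) {ν ε : ℝ} {V : ℝ → ℂ}
    (hV : Admissible N ν ε V) {D : ℕ → ℝ → ℂ} (hD : IsJet N V D) :
    ∃ X C c, TailBound N ν ε V D X C c := by
  have hVc : ∀ x > 0, ContinuousAt V x := fun x hx => (hD.hasDerivAt_potential hN hx).continuousAt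
  have hder : ∀ m, ∃ X ≥ 1, ∃ C ≥ 0, 1 ≤ m → m ≤ N →
      ∀ᵐ x, X ≤ x → ‖D m x‖ ≤ C * (‖V x‖ * (x ^ ν) ^ m) := by
    intro m
    by_cases hm : 1 ≤ m ∧ m ≤ N
    · obtain ⟨X, hX, C, hC, h⟩ := exists_ae_bound (u := fun x => ‖V x‖)
        (by simpa using hV.deriv m (Finset.mem_Icc.2 hm) (D m) (hD.weak m hm.2))
      exact ⟨X, hX, C, hC, fun _ _ => by simpa using h⟩
    · exact ⟨1, le_rfl, 0, le_rfl, fun h1 h2 => absurd ⟨h1, h2⟩ hm⟩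
  choose Xd hXd Cd hCd hder using hder
  have him : ∃ X ≥ 1, ∃ C ≥ 0, ∀ᵐ x, X ≤ x → |(D 1 x).im| ≤ C * (|(V x).im| * x ^ ν) := by
    have h := hV.im_deriv 1 (Finset.mem_Icc.2 ⟨le_rfl, hN.le⟩) (D 1) (hD.weak 1 hN.le)
    have h' : (fun x => (((D 1 x).im : ℝ) : ℂ)) =O[atTop ⊓ ae volume]
        fun x => ‖(V x).im‖ * bracket x ^ (((1 : ℕ) : ℝ) * ν) := by
      rw [← isBigO_norm_left] at h ⊢
      simpa using h
    obtain ⟨X, hX, C, hC, h⟩ := exists_ae_bound (u := fun x => (V x).im) h'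
    exact ⟨X, hX, C, hC, by simpa using h⟩
  obtain ⟨Xi, hXi, Ci, hCi, him⟩ := him
  obtain ⟨cl, hcl, hl⟩ := hV.im_deriv_lower (D 1) (hD.weak 1 hN.le)
  obtain ⟨Xl, hl⟩ := exists_of_eventually_atTop_inf_ae hl
  obtain ⟨Xp, hp⟩ := Filter.eventually_atTop.1 (hV.tendsto_im.eventually_ge_atTop 1)
  obtain ⟨Cg, hCg, hg⟩ := hV.re_bound.exists_nonneg
  obtain ⟨Xg, hg⟩ := Filter.eventually_atTop.1 hg.bound
  -- The sums serve as common thresholds and constants: all summands are nonnegative, so each one is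
  -- below the sum.
  set X₁ : ℝ := ∑ m ∈ Finset.range (N + 1), Xd m with hX₁
  set C₁ : ℝ := ∑ m ∈ Finset.range (N + 1), Cd m with hC₁
  have hXm : ∀ m ≤ N, Xd m ≤ X₁ := fun m hm =>
    Finset.single_le_sum (f := Xd) (fun i _ => by linarith [hXd i]) (Finset.mem_range.2 (by omega))
  have hCm : ∀ m ≤ N, Cd m ≤ C₁ := fun m hm =>
    Finset.single_le_sum (f := Cd) (fun i _ => hCd i) (Finset.mem_range.2 (by omega))
  have hC₁0 : 0 ≤ C₁ := Finset.sum_nonneg fun i _ => hCd i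
  have hX₁1 : 1 ≤ X₁ := (hXd 0).trans (hXm 0 (Nat.zero_le _))
  set X : ℝ := X₁ + Xi + |Xl| + |Xp| + |Xg| + 1
  have aXl := le_abs_self Xl
  have aXp := le_abs_self Xp
  have aXg := le_abs_self Xg
  have nXl := abs_nonneg Xl
  have nXp := abs_nonneg Xp
  have nXg := abs_nonneg Xg
  set Cg' : ℝ := 2 ^ |4 * (ν + ε) + 2| * 2 ^ |4 * ν + 2| * Cg
  have hCg' : 0 ≤ Cg' := by positivity
  set C : ℝ := C₁ + Ci + (Cg' + 1) + 1
  have hpow : ∀ x > 0, ∀ s : ℝ, ContinuousAt (fun x : ℝ => x ^ s) x := fun x hx s =>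
    Real.continuousAt_rpow_const x s (Or.inl hx.ne')
  have hD1c : ∀ x > 0, ContinuousAt (fun x => (D 1 x).im) x := fun x hx =>
    Complex.continuous_im.continuousAt.comp (hD.continuousAt 1 hN x hx)
  have hVim : ∀ x > 0, ContinuousAt (fun x => (V x).im) x := fun x hx =>
    Complex.continuous_im.continuousAt.comp (hVc x hx)
  have himpos : ∀ x ≥ X, 1 ≤ (V x).im := fun x hx => hp x (by simp only [X] at hx; linarith)
  refine ⟨X, C, cl * (2 ^ |ν|)⁻¹, by simp only [X]; linarith, by simp only [C]; linarith,
    by positivity, himpos, ?_, ?_, ?_, ?_, ?_⟩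
  · have hmain : ∀ x > |Xl| + |Xp| + 1, cl * (2 ^ |ν|)⁻¹ * ((V x).im * x ^ ν) ≤ (D 1 x).im := by
      refine le_of_ae_le (fun x hx => ?_) (fun x hx => hD1c x (by linarith)) ?_
      · have hx0 : 0 < x := by linarith
        exact continuousAt_const.mul ((hVim x hx0).mul (hpow x hx0 ν))
      · filter_upwards [hl] with x hx hXx
        have hx1 : 1 ≤ x := by linarith
        refine le_trans ?_ (hx (by linarith))
        have hb := le_bracket_rpow hx1 ν
        have h1 : 1 ≤ (V x).im := hp x (by linarith)
        have hx2 : (2 ^ |ν|)⁻¹ * x ^ ν ≤ bracket x ^ ν := by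
          rw [inv_mul_le_iff₀ (by positivity)]; exact hb
        calc cl * (2 ^ |ν|)⁻¹ * ((V x).im * x ^ ν) = cl * ((V x).im * ((2 ^ |ν|)⁻¹ * x ^ ν)) := by ring
          _ ≤ _ := by gcongr
    exact fun x hx => hmain x (by simp only [X] at hx; linarith)
  · have hmain : ∀ x > Xi + |Xp|, |(D 1 x).im| ≤ C * ((V x).im * x ^ ν) := by
      refine le_of_ae_le (fun x hx => ?_) (fun x hx => ?_) ?_
      · exact (hD1c x (by linarith)).abs
      · have hx0 : 0 < x := by linarith
        exact continuousAt_const.mul ((hVim x hx0).mul (hpow x hx0 ν))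
      · filter_upwards [him] with x hx hXx
        have hx1 : 1 ≤ x := by linarith
        have h1 : 1 ≤ (V x).im := hp x (by linarith)
        refine (hx (by linarith)).trans ?_
        rw [abs_of_nonneg (by linarith)]
        gcongr
        simp only [C]; linarith
    exact fun x hx => hmain x (by simp only [X] at hx; linarith)
  · intro m h1 h2
    have hmain : ∀ x > X₁, ‖D m x‖ ≤ C * (‖V x‖ * (x ^ ν) ^ m) := by
      refine le_of_ae_le (fun x hx => ?_) (fun x hx => ?_) ?_
      · exact (hD.continuousAt m h2 x (by linarith)).norm
      · have hx0 : 0 < x := by linarith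
        exact continuousAt_const.mul ((hVc x hx0).norm.mul ((hpow x hx0 ν).pow m))
      · filter_upwards [hder m h1 h2.le] with x hx hXx
        have hx1 : 1 ≤ x := by linarith
        refine (hx ((hXm m h2.le).trans hXx)).trans ?_
        gcongr
        have := hCm m h2.le
        simp only [C]; linarith
    exact fun x hx => hmain x (by simp only [X] at hx; linarith)
  · filter_upwards [hder N hN.le le_rfl] with x hx hXx
    have hx1 : 1 ≤ x := by simp only [X] at hXx; linarith
    refine (hx ((hXm N le_rfl).trans (by simp only [X] at hXx; linarith))).trans ?_
    gcongr
    have := hCm N le_rfl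
    simp only [C]; linarith
  · intro x hx
    have hx1 : 1 ≤ x := by simp only [X] at hx; linarith
    have hx0 : 0 < x := by linarith
    have hb : 0 < bracket x := hx0.trans_le le_bracket
    have h1 := hg x (by simp only [X] at hx; linarith)
    rw [Real.norm_of_nonneg (by positivity), Real.norm_of_nonneg (by positivity), sq_abs] at h1
    -- The growth bound is a square root: with `|Re V|` dropped, the left side of the hypothesis is
    -- comparable to `(x ^ (4ν + 2ε + 2))²`.
    have h2 : bracket x ^ (4 * (ν + ε) + 2) * bracket x ^ (4 * ν + 2) ≤ Cg * (V x).im ^ 2 := by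
      refine le_trans ?_ h1
      gcongr
      linarith [abs_nonneg (V x).re]
    have h3 : x ^ (4 * (ν + ε) + 2) * x ^ (4 * ν + 2) ≤ Cg' * (V x).im ^ 2 := by
      calc x ^ (4 * (ν + ε) + 2) * x ^ (4 * ν + 2)
          ≤ (2 ^ |4 * (ν + ε) + 2| * bracket x ^ (4 * (ν + ε) + 2)) *
            (2 ^ |4 * ν + 2| * bracket x ^ (4 * ν + 2)) := by
            gcongr
            · exact le_bracket_rpow hx1 _
            · exact le_bracket_rpow hx1 _
        _ = 2 ^ |4 * (ν + ε) + 2| * 2 ^ |4 * ν + 2| *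
            (bracket x ^ (4 * (ν + ε) + 2) * bracket x ^ (4 * ν + 2)) := by ring
        _ ≤ 2 ^ |4 * (ν + ε) + 2| * 2 ^ |4 * ν + 2| * (Cg * (V x).im ^ 2) := by gcongr
        _ = _ := by simp only [Cg']; ring
    have h4 : x ^ (4 * (ν + ε) + 2) * x ^ (4 * ν + 2) = (x ^ (4 * ν + 2 * ε + 2)) ^ 2 := by
      rw [← Real.rpow_add hx0, ← Real.rpow_mul_natCast hx0.le]
      congr 1; push_cast; ring
    rw [h4] at h3
    have hv := himpos x hx
    have h5 : (x ^ (4 * ν + 2 * ε + 2)) ^ 2 ≤ ((Cg' + 1) * (V x).im) ^ 2 := by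
      rw [mul_pow]
      refine h3.trans ?_
      gcongr
      nlinarith
    have h6 := (pow_le_pow_iff_left₀ (by positivity) (by positivity) (by norm_num)).1 h5
    refine h6.trans ?_
    gcongr
    simp only [C]; linarith

section Tail

variable {N : ℕ} {ν ε : ℝ} {V : ℝ → ℂ} {D : ℕ → ℝ → ℂ} {X C c : ℝ}

theorem TailBound.hasDerivAt_log_im (h : TailBound N ν ε V D X C c) (hD : IsJet N V D)
    (hN : 1 < N) {x : ℝ} (hx : X ≤ x) :
    HasDerivAt (fun x => Real.log (V x).im) ((D 1 x).im / (V x).im) x := by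
  have hx0 : 0 < x := by linarith [h.one_le]
  exact (hasDerivAt_im (hD.hasDerivAt_potential hN hx0)).log (by linarith [h.im_pos x hx])

/-- The logarithmic derivative of `Im V` is at most `C x ^ ν ≤ k'`, so `log Im V - k` is
nonincreasing. -/
theorem TailBound.log_im_le (h : TailBound N ν ε V D X C c) (hD : IsJet N V D)
    (hN : 1 < N) {k k' : ℝ → ℝ} (hk : ∀ x ≥ X, HasDerivAt k (k' x) x)
    (hk' : ∀ x ≥ X, C * x ^ ν ≤ k' x) {x : ℝ} (hx : X ≤ x) :
    Real.log (V x).im ≤ Real.log (V X).im - k X + k x := by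
  have hanti : AntitoneOn (fun x => Real.log (V x).im - k x) (Ici X) := by
    have hd : ∀ x ≥ X, HasDerivAt (fun x => Real.log (V x).im - k x)
        ((D 1 x).im / (V x).im - k' x) x := fun x hx => (h.hasDerivAt_log_im hD hN hx).sub (hk x hx)
    refine antitoneOn_of_deriv_nonpos (convex_Ici X) (fun x hx => (hd x hx).continuousAt.continuousWithinAt)
      (fun x hx => ?_) (fun x hx => ?_)
    · rw [interior_Ici] at hx
      exact (hd x (le_of_lt hx)).differentiableAt.differentiableWithinAt
    · rw [interior_Ici] at hx
      have hx' : X ≤ x := le_of_lt hx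
      rw [(hd x hx').deriv]
      have h1 := h.im_pos x hx'
      have h2 := (le_abs_self _).trans (h.im_upper x hx')
      have h3 : (D 1 x).im / (V x).im ≤ C * x ^ ν := by
        rw [div_le_iff₀ (by linarith)]; linarith
      linarith [hk' x hx']
  have := hanti self_mem_Ici hx hx
  simp only at this
  linarith

/-- For `ν < -1` the comparison function `C x ^ (ν + 1) / (ν + 1)` is bounded above by zero, so `log
Im V` would stay bounded, contrary to `Im V → ∞`. -/
theorem Admissible.neg_one_le (hV : Admissible N ν ε V) (h : TailBound N ν ε V D X C c)
    (hD : IsJet N V D) (hN : 1 < N) : -1 ≤ ν := by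
  by_contra! hν
  have hν1 : ν + 1 < 0 := by linarith
  have hk : ∀ x ≥ X, HasDerivAt (fun x => C * (x ^ (ν + 1) / (ν + 1))) (C * x ^ ν) x := by
    intro x hx
    have hx0 : 0 < x := by linarith [h.one_le]
    have := ((Real.hasDerivAt_rpow_const (p := ν + 1) (Or.inl hx0.ne')).div_const (ν + 1)).const_mul C
    convert! this using 1
    have hne : ν + 1 ≠ 0 := hν1.ne
    rw [add_sub_cancel_right]
    field_simp
  obtain ⟨x, hx, hX⟩ := ((((Real.tendsto_log_atTop.comp hV.tendsto_im).eventually_gt_atTop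
    (Real.log (V X).im - C * (X ^ (ν + 1) / (ν + 1)))).and (eventually_ge_atTop X))).exists
  have h1 := h.log_im_le hD hN hk (fun x _ => le_rfl) hX
  have hx0 : 0 < x := by linarith [h.one_le]
  have h2 : C * (x ^ (ν + 1) / (ν + 1)) ≤ 0 := by
    refine mul_nonpos_of_nonneg_of_nonpos (by linarith [h.one_le_const]) ?_
    exact div_nonpos_of_nonneg_of_nonpos (by positivity) hν1.le
  simp only [Function.comp_apply] at hx
  linarith

/-- The comparison function `C x ^ (ν + 1) log x` also covers the borderline `ν = -1`: its
derivative contains `C x ^ ν`, and the other term is nonnegative for `x ≥ 1`. The factor `log x` is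
then absorbed by `x ^ ε`. -/
theorem TailBound.log_im_isLittleO (h : TailBound N ν ε V D X C c) (hD : IsJet N V D) (hN : 1 < N)
    (hν : -1 ≤ ν) (hε : 0 < ε) {η : ℝ} (hη : 0 < η) :
    ∃ X₁, ∀ x ≥ X₁, Real.log (V x).im ≤ η * x ^ (ν + 1 + ε) := by
  have hC : 0 < C := by linarith [h.one_le_const]
  have hk : ∀ x ≥ X, HasDerivAt (fun x => C * (x ^ (ν + 1) * Real.log x))
      (C * (((ν + 1) * x ^ (ν + 1 - 1)) * Real.log x + x ^ (ν + 1) * x⁻¹)) x := by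
    intro x hx
    have hx0 : 0 < x := by linarith [h.one_le]
    exact ((Real.hasDerivAt_rpow_const (p := ν + 1) (Or.inl hx0.ne')).mul
      (Real.hasDerivAt_log hx0.ne')).const_mul C
  have hk' : ∀ x ≥ X, C * x ^ ν ≤
      C * (((ν + 1) * x ^ (ν + 1 - 1)) * Real.log x + x ^ (ν + 1) * x⁻¹) := by
    intro x hx
    have hx1 : 1 ≤ x := h.one_le.trans hx
    have hx0 : 0 < x := by linarith
    gcongr
    have e : x ^ (ν + 1) * x⁻¹ = x ^ ν := by
      rw [Real.rpow_add_one hx0.ne']; field_simp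
    rw [e]
    have := Real.log_nonneg hx1
    have : 0 ≤ (ν + 1) * x ^ (ν + 1 - 1) * Real.log x := by
      have : 0 ≤ ν + 1 := by linarith
      positivity
    linarith
  set A : ℝ := Real.log (V X).im - C * (X ^ (ν + 1) * Real.log X)
  have ho := (isLittleO_log_rpow_atTop hε).bound (show (0:ℝ) < η / (2 * C) by positivity)
  have hT : Tendsto (fun x : ℝ => η / 2 * x ^ (ν + 1 + ε)) atTop atTop :=
    (tendsto_rpow_atTop (by linarith)).const_mul_atTop (by positivity)
  obtain ⟨X₁, hX₁⟩ := Filter.eventually_atTop.1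
    ((ho.and (hT.eventually_ge_atTop A)).and (eventually_ge_atTop X))
  refine ⟨X₁, fun x hx => ?_⟩
  obtain ⟨⟨h1, h2⟩, h3⟩ := hX₁ x hx
  have hx1 : 1 ≤ x := h.one_le.trans h3
  have hx0 : 0 < x := by linarith
  have h4 := h.log_im_le hD hN hk hk' h3
  rw [Real.norm_of_nonneg (Real.log_nonneg hx1), Real.norm_of_nonneg (by positivity)] at h1
  have h5 : C * (x ^ (ν + 1) * Real.log x) ≤ η / 2 * x ^ (ν + 1 + ε) := by
    calc C * (x ^ (ν + 1) * Real.log x) ≤ C * (x ^ (ν + 1) * (η / (2 * C) * x ^ ε)) := by gcongr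
      _ = η / 2 * x ^ (ν + 1 + ε) := by rw [Real.rpow_add hx0 (ν + 1) ε]; field_simp
  linarith

theorem TailBound.strictMonoOn_im (h : TailBound N ν ε V D X C c) (hD : IsJet N V D)
    (hN : 1 < N) : StrictMonoOn (fun x => (V x).im) (Ici X) := by
  have hd : ∀ x ≥ X, HasDerivAt (fun x => (V x).im) (D 1 x).im x := fun x hx =>
    hasDerivAt_im (hD.hasDerivAt_potential hN (by linarith [h.one_le]))
  refine strictMonoOn_of_deriv_pos (convex_Ici X)
    (fun x hx => (hd x hx).continuousAt.continuousWithinAt) fun x hx => ?_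
  rw [interior_Ici] at hx
  have hx' : X ≤ x := le_of_lt hx
  have hx0 : 0 < x := by linarith [h.one_le]
  rw [(hd x hx').deriv]
  refine lt_of_lt_of_le ?_ (h.im_lower x hx')
  have := h.const_pos
  have : 0 < (V x).im := by linarith [h.im_pos x hx']
  positivity

theorem Admissible.exists_turning_point (hV : Admissible N ν ε V) (h : TailBound N ν ε V D X C c)
    (hD : IsJet N V D) (hN : 1 < N) :
    ∃ b₀ > 0, ∀ b ≥ b₀, ∃ xb ≥ X, (V xb).im = b ∧ ∀ y > 0, (V y).im = b → y = xb := by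
  obtain ⟨B, hB⟩ := bounded_near_zero hV.sobolev hV.continuousOn X
  -- This `b₀` exceeds both `Im V` at `X` and the bound `B` for `|V|` on `(0, X)`: the value `b` is
  -- attained beyond `X` and nowhere before it, and strict monotonicity leaves a single point.
  refine ⟨|B| + (V X).im + 1, by linarith [abs_nonneg B, h.im_pos X le_rfl], fun b hb => ?_⟩
  have hcont : ContinuousOn (fun x => (V x).im) (Ici X) := fun x hx =>
    (Complex.continuous_im.continuousAt.comp
      (hD.hasDerivAt_potential hN (show 0 < x by linarith [h.one_le, mem_Ici.1 hx])).continuousAt).continuousWithinAt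
  obtain ⟨Y, hY, hXY⟩ := ((hV.tendsto_im.eventually_ge_atTop b).and (eventually_ge_atTop X)).exists
  obtain ⟨xb, hxb, hb'⟩ := intermediate_value_Icc hXY (hcont.mono Icc_subset_Ici_self)
    (show b ∈ Icc (V X).im (V Y).im from ⟨by linarith [abs_nonneg B], hY⟩)
  refine ⟨xb, hxb.1, hb', fun y hy hyb => ?_⟩
  have hyX : X ≤ y := by
    by_contra! hlt
    have h1 := hB y ⟨hy, hlt⟩
    have h2 := (Complex.abs_im_le_norm (V y)).trans h1
    have h3 := le_abs_self (V y).im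
    linarith [le_abs_self B, h.im_pos X le_rfl]
  exact (h.strictMonoOn_im hD hN).injOn hyX hxb.1 (hyb.trans hb'.symm)

end Tail

/-! ### Algebra of the JWKB expansion

With `u_m = V^{(m)} / (λ - V)` and `t = (λ - V)^{-1/2}` one has `u_m' = u_{m+1} + u_m u_1` and
`t' = t u_1 / 2`; the functions `λ^{-k/2} ψ'_k` with `k ≥ 0` are `t^k` times a polynomial in
`u_1, …, u_{k+1}`. -/

section

open MvPolynomial (X C eval)

noncomputable section

/-- The derivation of `ℂ[u_0, u_1, …]` with `u_m ↦ u_{m+1} + u_m u_1`. -/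
def jetDeriv : Derivation ℂ (MvPolynomial ℕ ℂ) (MvPolynomial ℕ ℂ) :=
  MvPolynomial.mkDerivation ℂ fun m => X (m + 1) + X m * X 1

/-- The polynomials `Q_k` with `λ^{-k/2} ψ'_k = t^k Q_k(u)`. -/
def wkbPoly : ℕ → MvPolynomial ℕ ℂ
  | 0 => C (-1 / 4) * X 1
  | k + 1 => C (1 / (2 * Complex.I)) *
      (jetDeriv (wkbPoly k) + C ((k : ℂ) / 2) * (X 1 * wkbPoly k) -
        ∑ i : Fin (k + 1), wkbPoly i.1 * wkbPoly (k - i.1))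
  termination_by k => k
  decreasing_by all_goals omega

/-- The polynomials `R_k` with `(t^k Q_k(u))' = t^k R_k(u)`. -/
def wkbPolyDeriv (k : ℕ) : MvPolynomial ℕ ℂ :=
  jetDeriv (wkbPoly k) + C ((k : ℂ) / 2) * (X 1 * wkbPoly k)

theorem wkbPoly_zero : wkbPoly 0 = C (-1 / 4) * X 1 := by
  rw [wkbPoly]

theorem wkbPoly_succ (k : ℕ) : wkbPoly (k + 1) = C (1 / (2 * Complex.I)) *
    (wkbPolyDeriv k - ∑ p ∈ Finset.HasAntidiagonal.antidiagonal k, wkbPoly p.1 * wkbPoly p.2) := by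
  rw [wkbPoly, wkbPolyDeriv, Finset.Nat.sum_antidiagonal_eq_sum_range_succ_mk,
    Fin.sum_univ_eq_sum_range (fun i => wkbPoly i * wkbPoly (k - i))]

/-- Polynomials without constant term, homogeneous of weight `p` where `u_m` has weight `m`. -/
inductive Graded : ℕ → MvPolynomial ℕ ℂ → Prop
  | var (m : ℕ) (hm : 1 ≤ m) : Graded m (X m)
  | zero (p : ℕ) : Graded p 0
  | add {p : ℕ} {P Q : MvPolynomial ℕ ℂ} : Graded p P → Graded p Q → Graded p (P + Q)
  | smul {p : ℕ} {P : MvPolynomial ℕ ℂ} (c : ℂ) : Graded p P → Graded p (C c * P)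
  | mul {p q : ℕ} {P Q : MvPolynomial ℕ ℂ} : Graded p P → Graded q Q → Graded (p + q) (P * Q)

theorem Graded.sub {p : ℕ} {P Q : MvPolynomial ℕ ℂ} (hP : Graded p P) (hQ : Graded p Q) :
    Graded p (P - Q) := by
  have : P - Q = P + C (-1) * Q := by
    rw [MvPolynomial.C_neg, MvPolynomial.C_1]; ring
  rw [this]
  exact hP.add (hQ.smul _)

theorem Graded.sum {ι : Type*} {p : ℕ} (s : Finset ι) (f : ι → MvPolynomial ℕ ℂ)
    (h : ∀ i ∈ s, Graded p (f i)) : Graded p (∑ i ∈ s, f i) := by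
  classical
  induction s using Finset.induction_on with
  | empty => simpa using Graded.zero p
  | insert a s ha ih =>
    rw [Finset.sum_insert ha]
    exact (h a (Finset.mem_insert_self a s)).add
      (ih fun i hi => h i (Finset.mem_insert_of_mem hi))

theorem Graded.cast {p q : ℕ} {P : MvPolynomial ℕ ℂ} (h : Graded p P) (e : p = q) : Graded q P :=
  e ▸ h

/-- Both `u_{m+1}` and `u_m u_1` have weight `m + 1`, so the derivation raises weights by one; the
Leibniz rule propagates this to products. -/
theorem Graded.jetDeriv {p : ℕ} {P : MvPolynomial ℕ ℂ} (h : Graded p P) :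
    Graded (p + 1) (jetDeriv P) := by
  induction h with
  | var m hm =>
    rw [Pseudomode.jetDeriv, MvPolynomial.mkDerivation_X]
    exact (Graded.var (m + 1) (by omega)).add ((Graded.var m hm).mul (Graded.var 1 le_rfl))
  | zero p => rw [map_zero]; exact Graded.zero _
  | add _ _ h1 h2 => rw [map_add]; exact h1.add h2
  | smul c _ h =>
    rw [MvPolynomial.C_mul', Derivation.map_smul, ← MvPolynomial.C_mul']
    exact h.smul c
  | mul hP hQ h1 h2 =>
    rw [Derivation.leibniz, smul_eq_mul, smul_eq_mul]
    exact ((hP.mul h2).cast (by omega)).add ((hQ.mul h1).cast (by omega))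

theorem graded_wkbPolyDeriv_of {k : ℕ} (h : Graded (k + 1) (wkbPoly k)) :
    Graded (k + 2) (wkbPolyDeriv k) :=
  h.jetDeriv.add ((((Graded.var 1 le_rfl).mul h).cast (by omega)).smul _)

theorem graded_wkbPoly (k : ℕ) : Graded (k + 1) (wkbPoly k) := by
  induction k using Nat.strong_induction_on with
  | _ k ih =>
    rcases k with _ | k
    · rw [wkbPoly_zero]; exact (Graded.var 1 le_rfl).smul _
    · rw [wkbPoly_succ]
      refine ((graded_wkbPolyDeriv_of (ih k (by omega))).sub ?_).smul _
      refine Graded.sum _ _ fun p hp => ?_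
      rw [Finset.HasAntidiagonal.mem_antidiagonal] at hp
      exact ((ih p.1 (by omega)).mul (ih p.2 (by omega))).cast (by omega)

theorem graded_wkbPolyDeriv (k : ℕ) : Graded (k + 2) (wkbPolyDeriv k) :=
  graded_wkbPolyDeriv_of (graded_wkbPoly k)

/-- Only variables of index between `1` and `p` can occur in weight `p`, which limits the
derivatives of `V` that must exist. -/
theorem Graded.hasDerivAt {p : ℕ} {P : MvPolynomial ℕ ℂ} (h : Graded p P) {u : ℕ → ℝ → ℂ} {x : ℝ}
    (hu : ∀ m, 1 ≤ m → m ≤ p → HasDerivAt (u m) (u (m + 1) x + u m x * u 1 x) x) :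
    HasDerivAt (fun y => eval (fun m => u m y) P) (eval (fun m => u m x) (Pseudomode.jetDeriv P))
      x := by
  induction h with
  | var m hm =>
    rw [Pseudomode.jetDeriv, MvPolynomial.mkDerivation_X]
    simpa using hu m hm le_rfl
  | zero p => simpa using hasDerivAt_const x (0 : ℂ)
  | add _ _ h1 h2 => simpa using! (h1 hu).add (h2 hu)
  | smul c _ h =>
    rw [MvPolynomial.C_mul', Derivation.map_smul]
    simpa using! (h hu).const_mul c
  | mul hP hQ h1 h2 =>
    rw [Derivation.leibniz]
    have := (h1 fun m hm hm' => hu m hm (by omega)).mul (h2 fun m hm hm' => hu m hm (by omega))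
    simp only [map_mul, map_add, smul_eq_mul]
    convert! this using 1
    ring

theorem Graded.ac {p : ℕ} {P : MvPolynomial ℕ ℂ} (h : Graded p P) {u : ℕ → ℝ → ℂ} {a b : ℝ}
    (hu : ∀ m, 1 ≤ m → m ≤ p → AbsolutelyContinuousOnInterval (u m) a b) :
    AbsolutelyContinuousOnInterval (fun y => eval (fun m => u m y) P) a b := by
  have hconst : ∀ c : ℂ, AbsolutelyContinuousOnInterval (fun _ : ℝ => c) a b := fun c =>
    (contDiff_const.contDiffOn).absolutelyContinuousOnInterval
  induction h with
  | var m hm => simpa using hu m hm le_rfl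
  | zero p => simpa using hconst 0
  | add _ _ h1 h2 => simpa using! (h1 hu).fun_add (h2 hu)
  | smul c _ h => simpa using! (h hu).const_smul c
  | mul hP hQ h1 h2 =>
    simpa using! (h1 fun m hm hm' => hu m hm (by omega)).fun_smul
      (h2 fun m hm hm' => hu m hm (by omega))

/-! ### Size of graded polynomials -/

theorem sum_pow_mul_sum_pow_le {ρ : ℝ} (hρ : 0 ≤ ρ) (p q : ℕ) :
    (∑ l ∈ Finset.Icc 1 p, ρ ^ l) * (∑ l ∈ Finset.Icc 1 q, ρ ^ l)
      ≤ (p * q : ℝ) * ∑ l ∈ Finset.Icc 2 (p + q), ρ ^ l := by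
  rw [Finset.sum_mul_sum]
  calc ∑ i ∈ Finset.Icc 1 p, ∑ j ∈ Finset.Icc 1 q, ρ ^ i * ρ ^ j
      ≤ ∑ i ∈ Finset.Icc 1 p, ∑ j ∈ Finset.Icc 1 q, ∑ l ∈ Finset.Icc 2 (p + q), ρ ^ l := by
        refine Finset.sum_le_sum fun i hi => Finset.sum_le_sum fun j hj => ?_
        rw [← pow_add]
        rw [Finset.mem_Icc] at hi hj
        exact Finset.single_le_sum (f := fun l => ρ ^ l) (fun l _ => by positivity)
          (Finset.mem_Icc.2 ⟨by omega, by omega⟩)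
    _ = _ := by simp; ring

theorem sum_pow_mono {ρ : ℝ} (hρ : 0 ≤ ρ) {p q p' q' : ℕ} (h1 : p' ≤ p) (h2 : q ≤ q') :
    ∑ l ∈ Finset.Icc p q, ρ ^ l ≤ ∑ l ∈ Finset.Icc p' q', ρ ^ l :=
  Finset.sum_le_sum_of_subset_of_nonneg (Finset.Icc_subset_Icc h1 h2) fun _ _ _ => by positivity

/-- Each variable `u_m` contributes `κ ^ m ρ`, so the powers of `κ` add up to the weight, while the
power of `ρ` counts the degree. The degree is at least one since there is no constant term, and at
most `p` since every variable has weight at least one. -/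
theorem Graded.exists_bound {p : ℕ} {P : MvPolynomial ℕ ℂ} (h : Graded p P) (A : ℝ) :
    ∃ K ≥ 0, ∀ (u : ℕ → ℂ) (κ ρ : ℝ), 0 ≤ κ → 0 ≤ ρ →
      (∀ m, 1 ≤ m → m ≤ p → ‖u m‖ ≤ A * (κ ^ m * ρ)) →
      ‖eval u P‖ ≤ K * (κ ^ p * ∑ l ∈ Finset.Icc 1 p, ρ ^ l) := by
  induction h with
  | var m hm =>
    refine ⟨|A|, abs_nonneg A, fun u κ ρ hκ hρ hu => ?_⟩
    rw [MvPolynomial.eval_X]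
    refine (hu m hm le_rfl).trans ?_
    have h1 : ρ ≤ ∑ l ∈ Finset.Icc 1 m, ρ ^ l := by
      have := Finset.single_le_sum (s := Finset.Icc 1 m) (f := fun l => ρ ^ l)
        (fun l _ => by positivity) (Finset.mem_Icc.2 ⟨le_rfl, hm⟩)
      simpa using this
    gcongr
    exact le_abs_self A
  | zero p => exact ⟨0, le_rfl, fun u κ ρ _ _ _ => by simp⟩
  | add _ _ h1 h2 =>
    obtain ⟨K1, hK1, h1⟩ := h1
    obtain ⟨K2, hK2, h2⟩ := h2
    refine ⟨K1 + K2, by positivity, fun u κ ρ hκ hρ hu => ?_⟩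
    rw [map_add, add_mul]
    exact (norm_add_le _ _).trans (add_le_add (h1 u κ ρ hκ hρ hu) (h2 u κ ρ hκ hρ hu))
  | smul c _ h =>
    obtain ⟨K, hK, h⟩ := h
    refine ⟨‖c‖ * K, by positivity, fun u κ ρ hκ hρ hu => ?_⟩
    rw [map_mul, MvPolynomial.eval_C, norm_mul, mul_assoc]
    exact mul_le_mul_of_nonneg_left (h u κ ρ hκ hρ hu) (norm_nonneg _)
  | @mul p q _ _ _ _ h1 h2 =>
    obtain ⟨K1, hK1, h1⟩ := h1
    obtain ⟨K2, hK2, h2⟩ := h2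
    refine ⟨K1 * K2 * (p * q), by positivity, fun u κ ρ hκ hρ hu => ?_⟩
    have b1 := h1 u κ ρ hκ hρ fun m hm hm' => hu m hm (by omega)
    have b2 := h2 u κ ρ hκ hρ fun m hm hm' => hu m hm (by omega)
    rw [map_mul, norm_mul]
    have hs1 : 0 ≤ ∑ l ∈ Finset.Icc 1 p, ρ ^ l := Finset.sum_nonneg fun _ _ => by positivity
    have hs2 : 0 ≤ ∑ l ∈ Finset.Icc 1 q, ρ ^ l := Finset.sum_nonneg fun _ _ => by positivity
    calc _ ≤ (K1 * (κ ^ p * ∑ l ∈ Finset.Icc 1 p, ρ ^ l)) *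
          (K2 * (κ ^ q * ∑ l ∈ Finset.Icc 1 q, ρ ^ l)) :=
          mul_le_mul b1 b2 (norm_nonneg _) (by positivity)
      _ = K1 * K2 * κ ^ (p + q) *
          ((∑ l ∈ Finset.Icc 1 p, ρ ^ l) * ∑ l ∈ Finset.Icc 1 q, ρ ^ l) := by
          rw [pow_add]; ring
      _ ≤ K1 * K2 * κ ^ (p + q) * ((p * q : ℝ) * ∑ l ∈ Finset.Icc 1 (p + q), ρ ^ l) := by
          refine mul_le_mul_of_nonneg_left ?_ (by positivity)
          refine (sum_pow_mul_sum_pow_le hρ p q).trans ?_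
          exact mul_le_mul_of_nonneg_left (sum_pow_mono hρ (by norm_num) le_rfl) (by positivity)
      _ = _ := by ring

/-! ### The functions of the expansion -/

/-- The principal square root `(λ - V)^{1/2}`. -/
def sqrtAt (lam : ℂ) (V : ℝ → ℂ) (x : ℝ) : ℂ := (lam - V x) ^ (1 / 2 : ℂ)

/-- The functions `u_m = V^{(m)} / (λ - V)`. -/
def jetAt (lam : ℂ) (V : ℝ → ℂ) (D : ℕ → ℝ → ℂ) (m : ℕ) (x : ℝ) : ℂ := D m x / (lam - V x)

/-- The functions `λ^{-k/2} ψ'_k` for `k ≥ 0`. -/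
def wkb (lam : ℂ) (V : ℝ → ℂ) (D : ℕ → ℝ → ℂ) (k : ℕ) (x : ℝ) : ℂ :=
  (sqrtAt lam V x)⁻¹ ^ k * eval (fun m => jetAt lam V D m x) (wkbPoly k)

/-- The derivative of `wkb`. -/
def wkbDeriv (lam : ℂ) (V : ℝ → ℂ) (D : ℕ → ℝ → ℂ) (k : ℕ) (x : ℝ) : ℂ :=
  (sqrtAt lam V x)⁻¹ ^ k * eval (fun m => jetAt lam V D m x) (wkbPolyDeriv k)

/-- The derivative of the total phase, `∑_{k=-1}^{n} λ^{-k/2} ψ'_k`. -/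
def phase (lam : ℂ) (V : ℝ → ℂ) (D : ℕ → ℝ → ℂ) (n : ℕ) (x : ℝ) : ℂ :=
  Complex.I * sqrtAt lam V x + ∑ k ∈ Finset.range (n + 1), wkb lam V D k x

/-- The derivative of `phase`. -/
def phaseDeriv (lam : ℂ) (V : ℝ → ℂ) (D : ℕ → ℝ → ℂ) (n : ℕ) (x : ℝ) : ℂ :=
  Complex.I * (-(sqrtAt lam V x * jetAt lam V D 1 x) / 2) +
    ∑ k ∈ Finset.range (n + 1), wkbDeriv lam V D k x

/-- The remainder of the expansion. -/
def remainder (lam : ℂ) (V : ℝ → ℂ) (D : ℕ → ℝ → ℂ) (n : ℕ) (x : ℝ) : ℂ :=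
  wkbDeriv lam V D n x -
    ∑ p ∈ (Finset.range (n + 1) ×ˢ Finset.range (n + 1)).filter (fun p => n ≤ p.1 + p.2),
      wkb lam V D p.1 x * wkb lam V D p.2 x

section Pointwise

variable {lam : ℂ} {V : ℝ → ℂ} {D : ℕ → ℝ → ℂ} {x : ℝ}

theorem sqrtAt_sq (x : ℝ) : sqrtAt lam V x ^ 2 = lam - V x := by
  rw [sqrtAt, ← Complex.cpow_mul_nat]
  simp

theorem sqrtAt_ne_zero (h : 0 < (lam - V x).re) : sqrtAt lam V x ≠ 0 := by
  intro h0
  have := sqrtAt_sq (lam := lam) (V := V) x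
  rw [h0] at this
  rw [← this] at h
  simp at h

theorem hasDerivAt_sqrtAt (h : 0 < (lam - V x).re) (hV : HasDerivAt V (D 1 x) x) :
    HasDerivAt (sqrtAt lam V) (-(sqrtAt lam V x * jetAt lam V D 1 x) / 2) x := by
  have h1 : HasDerivAt (fun y => lam - V y) (-D 1 x) x := hV.const_sub lam
  have h2 : HasDerivAt (fun z : ℂ => z ^ (1 / 2 : ℂ)) ((1 / 2 : ℂ) * (lam - V x) ^ ((1 / 2 : ℂ) - 1) * 1)
      (lam - V x) := (hasDerivAt_id _).cpow_const (Or.inl h)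
  have h3 := h2.comp x h1
  have hne : lam - V x ≠ 0 := fun h0 => by rw [h0] at h; simp at h
  convert! h3 using 1
  rw [Complex.cpow_sub _ _ hne, Complex.cpow_one, sqrtAt, jetAt]
  ring

theorem hasDerivAt_jetAt (h : 0 < (lam - V x).re) (hV : HasDerivAt V (D 1 x) x) {m : ℕ}
    (hm : HasDerivAt (D m) (D (m + 1) x) x) :
    HasDerivAt (jetAt lam V D m)
      (jetAt lam V D (m + 1) x + jetAt lam V D m x * jetAt lam V D 1 x) x := by
  have hne : lam - V x ≠ 0 := fun h0 => by rw [h0] at h; simp at h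
  have h1 := hm.div (hV.const_sub lam) hne
  convert! h1 using 1
  simp only [jetAt]
  field_simp
  ring

/-- The term with `k / 2` in `wkbPolyDeriv` comes from `(t^k)' = (k/2) t^k u_1`. -/
theorem hasDerivAt_wkb (h : 0 < (lam - V x).re) (hV : HasDerivAt V (D 1 x) x) {k : ℕ}
    (hD : ∀ m, 1 ≤ m → m ≤ k + 1 → HasDerivAt (D m) (D (m + 1) x) x) :
    HasDerivAt (wkb lam V D k) (wkbDeriv lam V D k x) x := by
  have h1 := ((hasDerivAt_sqrtAt h hV).inv (sqrtAt_ne_zero h)).pow k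
  have h2 := (graded_wkbPoly k).hasDerivAt (u := jetAt lam V D) (x := x)
    fun m hm hm' => hasDerivAt_jetAt h hV (hD m hm hm')
  have h3 := h1.mul h2
  have hne := sqrtAt_ne_zero h
  convert! h3 using 1
  simp only [wkbDeriv, wkbPolyDeriv, map_add, map_mul, MvPolynomial.eval_C, MvPolynomial.eval_X,
    Pi.pow_apply, Pi.inv_apply]
  rcases k with _ | k
  · simp
  · simp only [Nat.add_sub_cancel, pow_succ]
    field_simp
    push_cast
    ring

theorem hasDerivAt_phase (h : 0 < (lam - V x).re) (hV : HasDerivAt V (D 1 x) x) {n : ℕ}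
    (hD : ∀ m, 1 ≤ m → m ≤ n + 1 → HasDerivAt (D m) (D (m + 1) x) x) :
    HasDerivAt (phase lam V D n) (phaseDeriv lam V D n x) x := by
  refine ((hasDerivAt_sqrtAt h hV).const_mul Complex.I).add ?_
  refine HasDerivAt.fun_sum fun k hk => hasDerivAt_wkb h hV fun m hm hm' => hD m hm ?_
  rw [Finset.mem_range] at hk
  omega

theorem wkb_zero_eq : wkb lam V D 0 x = -jetAt lam V D 1 x / 4 := by
  simp [wkb, wkbPoly_zero]; ring

theorem two_I_sqrtAt_mul_wkb_succ (h : 0 < (lam - V x).re) (k : ℕ) :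
    2 * Complex.I * sqrtAt lam V x * wkb lam V D (k + 1) x =
      wkbDeriv lam V D k x - ∑ p ∈ Finset.HasAntidiagonal.antidiagonal k, wkb lam V D p.1 x * wkb lam V D p.2 x := by
  have hne := sqrtAt_ne_zero h
  have hs : ∑ p ∈ Finset.HasAntidiagonal.antidiagonal k, wkb lam V D p.1 x * wkb lam V D p.2 x =
      (sqrtAt lam V x)⁻¹ ^ k * ∑ p ∈ Finset.HasAntidiagonal.antidiagonal k,
        eval (fun m => jetAt lam V D m x) (wkbPoly p.1) *
          eval (fun m => jetAt lam V D m x) (wkbPoly p.2) := by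
    rw [Finset.mul_sum]
    refine Finset.sum_congr rfl fun p hp => ?_
    rw [← Finset.HasAntidiagonal.mem_antidiagonal.1 hp, wkb, wkb, pow_add]
    ring
  rw [hs, wkb, wkbPoly_succ, wkbDeriv]
  simp only [map_mul, map_sub, map_sum, MvPolynomial.eval_C, pow_succ]
  field_simp

/-- With `s` the square root and `W` the sum of the remaining terms, `Φ² = -s² + 2isW + W²` and `V -
λ = -s²`, so only `-2isW - W²` survives. The zeroth term of `2isW` cancels `(is)'`, and the
recursion turns the others into the derivatives and antidiagonal sums of orders below `n`. What
remains is the last derivative and the part of `W²` with `p + q ≥ n`. -/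
theorem phaseDeriv_sub_sq (h : 0 < (lam - V x).re) (n : ℕ) :
    phaseDeriv lam V D n x - phase lam V D n x ^ 2 + (V x - lam) = remainder lam V D n x := by
  set s := sqrtAt lam V x with hs
  have hsq : V x - lam = -s ^ 2 := by rw [hs, sqrtAt_sq]; ring
  have hI : Complex.I ^ 2 = -1 := Complex.I_sq
  set W := ∑ k ∈ Finset.range (n + 1), wkb lam V D k x with hW
  have hsum : 2 * Complex.I * s * W = -Complex.I * s * jetAt lam V D 1 x / 2 +
      ∑ k ∈ Finset.range n, (wkbDeriv lam V D k x -
        ∑ p ∈ Finset.HasAntidiagonal.antidiagonal k, wkb lam V D p.1 x * wkb lam V D p.2 x) := by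
    rw [hW, Finset.sum_range_succ', mul_add, Finset.mul_sum, wkb_zero_eq, add_comm]
    congr 1
    · ring
    · exact Finset.sum_congr rfl fun k _ => two_I_sqrtAt_mul_wkb_succ h k
  have hW2 : W ^ 2 = (∑ k ∈ Finset.range n, ∑ p ∈ Finset.HasAntidiagonal.antidiagonal k,
        wkb lam V D p.1 x * wkb lam V D p.2 x) +
      ∑ p ∈ (Finset.range (n + 1) ×ˢ Finset.range (n + 1)).filter (fun p => n ≤ p.1 + p.2),
      wkb lam V D p.1 x * wkb lam V D p.2 x := by
    rw [sq, hW, Finset.sum_mul_sum, ← Finset.sum_product',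
      ← Finset.sum_filter_add_sum_filter_not _ (fun p : ℕ × ℕ => ¬ n ≤ p.1 + p.2)]
    simp only [not_not]
    congr 1
    -- Below `n` the square of index pairs contains each antidiagonal completely, so grouping by `p
    -- + q` reproduces exactly the sums of the recursion.
    rw [← Finset.sum_fiberwise_of_maps_to (t := Finset.range n) (g := fun p : ℕ × ℕ => p.1 + p.2)]
    · refine Finset.sum_congr rfl fun k hk => Finset.sum_congr ?_ fun _ _ => rfl
      ext p
      simp only [Finset.mem_filter, Finset.mem_product, Finset.mem_range,
        Finset.HasAntidiagonal.mem_antidiagonal] at *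
      omega
    · intro p hp
      simp only [Finset.mem_filter, Finset.mem_product, Finset.mem_range] at *
      omega
  rw [Finset.sum_sub_distrib] at hsum
  rw [remainder, phaseDeriv, phase, ← hW, ← hs, Finset.sum_range_succ, hsq]
  linear_combination (-1 : ℂ) * hsum - hW2 - s ^ 2 * hI

end Pointwise

end

end

open MvPolynomial (eval)

/-! ### Absolute continuity of the phase and the formula for `ψ'_k` -/

theorem ac_of_hasDerivAt {f f' : ℝ → ℂ} {a b : ℝ} (hf : ∀ x ∈ uIcc a b, HasDerivAt f (f' x) x)
    (hf' : ContinuousOn f' (uIcc a b)) : AbsolutelyContinuousOnInterval f a b := by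
  obtain ⟨C, hC⟩ := isCompact_uIcc.exists_bound_of_continuousOn hf'
  refine LipschitzOnWith.absolutelyContinuousOnInterval (K := Real.toNNReal C) ?_
  refine (convex_uIcc a b).lipschitzOnWith_of_nnnorm_hasDerivWithin_le
    (fun x hx => (hf x hx).hasDerivWithinAt) fun x hx => ?_
  rw [← NNReal.coe_le_coe, coe_nnnorm]
  exact (hC x hx).trans (Real.le_coe_toNNReal C)

section AC

variable {N : ℕ} {lam : ℂ} {V : ℝ → ℂ} {D : ℕ → ℝ → ℂ} {a b : ℝ}

theorem IsJet.ac_jetAt (hD : IsJet N V D) (hN : 1 < N)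
    (hU : ∀ x ∈ uIcc a b, 0 < x ∧ 0 < (lam - V x).re) {m : ℕ} (hm : m < N) :
    AbsolutelyContinuousOnInterval (jetAt lam V D m) a b := by
  have hne : ∀ x ∈ uIcc a b, lam - V x ≠ 0 := fun x hx h0 => by
    have := (hU x hx).2; rw [h0] at this; simp at this
  have h1 : AbsolutelyContinuousOnInterval (fun x => (lam - V x)⁻¹) a b := by
    refine ac_of_hasDerivAt (f' := fun x => -(-D 1 x) / (lam - V x) ^ 2) (fun x hx => ?_) ?_
    · exact ((hD.hasDerivAt_potential hN (hU x hx).1).const_sub lam).inv (hne x hx)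
    · intro x hx
      have hV := (hD.hasDerivAt_potential hN (hU x hx).1).continuousAt
      have h1 := hD.continuousAt 1 hN x (hU x hx).1
      exact (h1.neg.neg.div ((continuousAt_const.sub hV).pow 2)
        (pow_ne_zero 2 (hne x hx))).continuousWithinAt
  have h2 := (hD.ac m hm a b (hU a left_mem_uIcc).1 (hU b right_mem_uIcc).1).fun_smul h1
  exact ac_congr h2 fun x _ => by simp [jetAt, div_eq_mul_inv]

theorem IsJet.ac_sqrtAt (hD : IsJet N V D) (hN : 1 < N)
    (hU : ∀ x ∈ uIcc a b, 0 < x ∧ 0 < (lam - V x).re) :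
    AbsolutelyContinuousOnInterval (sqrtAt lam V) a b := by
  have hd : ∀ x ∈ uIcc a b, HasDerivAt (sqrtAt lam V) (-(sqrtAt lam V x * jetAt lam V D 1 x) / 2) x :=
    fun x hx => hasDerivAt_sqrtAt (hU x hx).2 (hD.hasDerivAt_potential hN (hU x hx).1)
  refine ac_of_hasDerivAt hd ?_
  have h1 : ContinuousOn (sqrtAt lam V) (uIcc a b) := fun x hx =>
    (hd x hx).continuousAt.continuousWithinAt
  exact (h1.mul (hD.ac_jetAt hN hU hN).continuousOn).neg.div_const 2

theorem IsJet.ac_sqrtAt_inv_pow (hD : IsJet N V D) (hN : 1 < N)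
    (hU : ∀ x ∈ uIcc a b, 0 < x ∧ 0 < (lam - V x).re) (k : ℕ) :
    AbsolutelyContinuousOnInterval (fun x => (sqrtAt lam V x)⁻¹ ^ k) a b := by
  have hc := (hD.ac_sqrtAt hN hU).continuousOn
  have hd : ∀ x ∈ uIcc a b, HasDerivAt (fun x => (sqrtAt lam V x)⁻¹)
      (-(-(sqrtAt lam V x * jetAt lam V D 1 x) / 2) / sqrtAt lam V x ^ 2) x :=
    fun x hx => (hasDerivAt_sqrtAt (hU x hx).2 (hD.hasDerivAt_potential hN (hU x hx).1)).inv
      (sqrtAt_ne_zero (hU x hx).2)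
  have h1 : AbsolutelyContinuousOnInterval (fun x => (sqrtAt lam V x)⁻¹) a b := by
    refine ac_of_hasDerivAt hd ?_
    exact ((hc.mul (hD.ac_jetAt hN hU hN).continuousOn).neg.div_const 2).neg.div (hc.pow 2)
      fun x hx => pow_ne_zero 2 (sqrtAt_ne_zero (hU x hx).2)
  induction k with
  | zero =>
    simp only [pow_zero]
    exact (contDiff_const.contDiffOn).absolutelyContinuousOnInterval
  | succ k ih =>
    simp only [pow_succ]
    exact ih.fun_smul h1

theorem IsJet.ac_wkb (hD : IsJet N V D) (hN : 1 < N)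
    (hU : ∀ x ∈ uIcc a b, 0 < x ∧ 0 < (lam - V x).re) {k : ℕ} (hk : k + 1 < N) :
    AbsolutelyContinuousOnInterval (wkb lam V D k) a b :=
  (hD.ac_sqrtAt_inv_pow hN hU k).fun_smul
    ((graded_wkbPoly k).ac fun _ _ hm => hD.ac_jetAt hN hU (by omega))

theorem ac_sum {ι : Type*} (s : Finset ι) (f : ι → ℝ → ℂ)
    (h : ∀ i ∈ s, AbsolutelyContinuousOnInterval (f i) a b) :
    AbsolutelyContinuousOnInterval (fun x => ∑ i ∈ s, f i x) a b := by
  classical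
  induction s using Finset.induction_on with
  | empty =>
    simp only [Finset.sum_empty]
    exact (contDiff_const.contDiffOn).absolutelyContinuousOnInterval
  | insert i s hi ih =>
    simp only [Finset.sum_insert hi]
    exact (h i (Finset.mem_insert_self i s)).fun_add
      (ih fun j hj => h j (Finset.mem_insert_of_mem hj))

theorem IsJet.ac_phase (hD : IsJet N V D) (hN : 1 < N)
    (hU : ∀ x ∈ uIcc a b, 0 < x ∧ 0 < (lam - V x).re) {n : ℕ} (hn : n + 1 < N) :
    AbsolutelyContinuousOnInterval (phase lam V D n) a b := by
  refine ((hD.ac_sqrtAt hN hU).const_smul Complex.I).fun_add (ac_sum _ _ fun k hk => ?_)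
  rw [Finset.mem_range] at hk
  exact hD.ac_wkb hN hU (by omega)

theorem IsJet.eventually_good (hD : IsJet N V D) (hN : 1 < N) {x : ℝ} (hx : 0 < x)
    (h : 0 < (lam - V x).re) : ∀ᶠ y in 𝓝 x, 0 < y ∧ 0 < (lam - V y).re := by
  have hV := (hD.hasDerivAt_potential hN hx).continuousAt
  have h1 : ContinuousAt (fun y => (lam - V y).re) x :=
    Complex.continuous_re.continuousAt.comp (continuousAt_const.sub hV)
  exact (lt_mem_nhds hx).and (h1.eventually (lt_mem_nhds h))

theorem dpsi_zero_eq (x : ℝ) :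
    dpsi lam V 0 x = Complex.I * (lam ^ (1 / 2 : ℂ))⁻¹ * sqrtAt lam V x := by
  rw [dpsi, Complex.cpow_neg, sqrtAt]

/-- Strong induction along the recursion, with `λ^{1/2}` carrying all the dependence on the
normalisation. The condition `k + 1 < N` keeps every `deriv` taken so far a classical derivative
rather than its default value. -/
theorem IsJet.dpsi_succ_eq (hD : IsJet N V D) (hN : 1 < N) (hlam : lam ≠ 0) (k : ℕ)
    (hk : k + 1 < N) : ∀ x > 0, 0 < (lam - V x).re →
    dpsi lam V (k + 1) x = (lam ^ (1 / 2 : ℂ)) ^ k * wkb lam V D k x := by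
  have hμ : lam ^ (1 / 2 : ℂ) ≠ 0 := by
    rw [Ne, Complex.cpow_eq_zero_iff]; tauto
  induction k using Nat.strong_induction_on with
  | _ k ih =>
    intro x hx h
    have hs := sqrtAt_ne_zero h
    have hV := hD.hasDerivAt_potential hN hx
    rcases k with _ | k
    · have hd : deriv (dpsi lam V 0) x =
          Complex.I * (lam ^ (1 / 2 : ℂ))⁻¹ * (-(sqrtAt lam V x * jetAt lam V D 1 x) / 2) := by
        rw [show dpsi lam V 0 = fun x => Complex.I * (lam ^ (1 / 2 : ℂ))⁻¹ * sqrtAt lam V x from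
          funext dpsi_zero_eq]
        exact ((hasDerivAt_sqrtAt h hV).const_mul _).deriv
      rw [dpsi]
      beta_reduce
      rw [hd, dpsi_zero_eq, wkb_zero_eq]
      simp only [Finset.univ_eq_empty, Finset.sum_empty, sub_zero, pow_zero]
      field_simp
      ring
    · have hd : deriv (dpsi lam V (k + 1)) x =
          (lam ^ (1 / 2 : ℂ)) ^ k * wkbDeriv lam V D k x := by
        -- Differentiating the inductive identity requires it near `x`; the right half-plane
        -- condition is open by continuity of `V`.
        have he : dpsi lam V (k + 1) =ᶠ[𝓝 x] fun y => (lam ^ (1 / 2 : ℂ)) ^ k * wkb lam V D k y := by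
          filter_upwards [hD.eventually_good hN hx h] with y hy
          exact ih k (by omega) (by omega) y hy.1 hy.2
        rw [he.deriv_eq]
        exact ((hasDerivAt_wkb h hV fun m _ hm => hD.hasDerivAt m (by omega) x hx).const_mul _).deriv
      have hsum : ∑ i : Fin (k + 1), dpsi lam V (i.1 + 1) x * dpsi lam V (k + 1 - i.1) x =
          (lam ^ (1 / 2 : ℂ)) ^ k * ∑ p ∈ Finset.HasAntidiagonal.antidiagonal k,
            wkb lam V D p.1 x * wkb lam V D p.2 x := by
        rw [Finset.Nat.sum_antidiagonal_eq_sum_range_succ_mk, Finset.mul_sum,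
          Fin.sum_univ_eq_sum_range (fun i => dpsi lam V (i + 1) x * dpsi lam V (k + 1 - i) x)]
        refine Finset.sum_congr rfl fun i hi => ?_
        rw [Finset.mem_range] at hi
        rw [show k + 1 - i = (k - i) + 1 by omega, ih i (by omega) (by omega) x hx h,
          ih (k - i) (by omega) (by omega) x hx h,
          show (lam ^ (1 / 2 : ℂ)) ^ k = (lam ^ (1 / 2 : ℂ)) ^ i * (lam ^ (1 / 2 : ℂ)) ^ (k - i) by
            rw [← pow_add]; congr 1; omega]
        ring
      have hkey := two_I_sqrtAt_mul_wkb_succ (D := D) h k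
      rw [dpsi]
      beta_reduce
      rw [hd, hsum, dpsi_zero_eq, ← mul_sub, ← hkey, pow_succ]
      field_simp

theorem IsJet.sum_dpsi_eq_phase (hD : IsJet N V D) (hN : 1 < N) (hlam : lam ≠ 0) {x : ℝ}
    (hx : 0 < x) (h : 0 < (lam - V x).re) :
    ∑ j ∈ Finset.range (N - 1 + 1), lam ^ (-(((j : ℂ) - 1) / 2)) * dpsi lam V j x =
      phase lam V D (N - 2) x := by
  have hμ : lam ^ (1 / 2 : ℂ) ≠ 0 := by
    rw [Ne, Complex.cpow_eq_zero_iff]; tauto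
  -- The term `j = 0` is the eikonal one; the other `N - 1` terms are `k = 0, …, N - 2`. Since
  -- `λ^{k/2} = (λ^{1/2})^k` for principal powers, the factors of `λ` cancel.
  rw [Finset.sum_range_succ', phase, show N - 2 + 1 = N - 1 by omega, add_comm]
  congr 1
  · rw [dpsi_zero_eq, show (-((((0 : ℕ) : ℂ) - 1) / 2)) = (1 / 2 : ℂ) by push_cast; ring]
    field_simp
  · refine Finset.sum_congr rfl fun k hk => ?_
    rw [Finset.mem_range] at hk
    rw [hD.dpsi_succ_eq hN hlam k (by omega) x hx h,
      show (-((((k + 1 : ℕ) : ℂ) - 1) / 2)) = -((1 / 2 : ℂ) * (k : ℂ)) by push_cast; ring,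
      Complex.cpow_neg, Complex.cpow_mul_nat]
    field_simp

theorem IsJet.continuousOn_dpsi (hD : IsJet N V D) (hN : 1 < N) (hlam : lam ≠ 0)
    (hU : ∀ x ∈ uIcc a b, 0 < x ∧ 0 < (lam - V x).re) {j : ℕ} (hj : j < N) :
    ContinuousOn (dpsi lam V j) (uIcc a b) := by
  rcases j with _ | k
  · rw [show dpsi lam V 0 = fun x => Complex.I * (lam ^ (1 / 2 : ℂ))⁻¹ * sqrtAt lam V x from
      funext dpsi_zero_eq]
    exact continuousOn_const.mul (hD.ac_sqrtAt hN hU).continuousOn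
  · refine (continuousOn_const (c := (lam ^ (1 / 2 : ℂ)) ^ k)).mul
      (hD.ac_wkb hN hU hj).continuousOn |>.congr fun x hx => ?_
    exact hD.dpsi_succ_eq hN hlam k hj x (hU x hx).1 (hU x hx).2

theorem IsJet.hasDerivAt_g (hD : IsJet N V D) (hN : 1 < N) (hlam : lam ≠ 0)
    (hU : ∀ x ∈ Icc a b, 0 < x ∧ 0 < (lam - V x).re) {xb x : ℝ} (hxb : xb ∈ Ioo a b)
    (hx : x ∈ Ioo a b) :
    HasDerivAt (g lam V (N - 1) xb) (-(phase lam V D (N - 2) x * g lam V (N - 1) xb x)) x := by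
  have hab : a ≤ b := (hx.1.trans hx.2).le
  have hU' : ∀ x ∈ uIcc a b, 0 < x ∧ 0 < (lam - V x).re := by rwa [uIcc_of_le hab]
  have hd : ∀ j ∈ Finset.range (N - 1 + 1), HasDerivAt (fun x => lam ^ (-(((j : ℂ) - 1) / 2)) *
      ∫ t in xb..x, dpsi lam V j t) (lam ^ (-(((j : ℂ) - 1) / 2)) * dpsi lam V j x) x := by
    intro j hj
    rw [Finset.mem_range] at hj
    have hc := hD.continuousOn_dpsi hN hlam hU' (j := j) (by omega)
    rw [uIcc_of_le hab] at hc
    have hs : uIcc xb x ⊆ Icc a b := by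
      rw [← uIcc_of_le hab]
      refine uIcc_subset_uIcc ?_ ?_ <;> rw [uIcc_of_le hab]
      · exact ⟨hxb.1.le, hxb.2.le⟩
      · exact ⟨hx.1.le, hx.2.le⟩
    refine (intervalIntegral.integral_hasDerivAt_right ?_ ?_ ?_).const_mul _
    · exact (hc.mono hs).intervalIntegrable
    · exact ContinuousOn.stronglyMeasurableAtFilter isOpen_Ioo (hc.mono Ioo_subset_Icc_self) x hx
    · exact hc.continuousAt (Icc_mem_nhds hx.1 hx.2)
  have h1 := (HasDerivAt.fun_sum hd).neg.cexp
  rw [hD.sum_dpsi_eq_phase hN hlam (hU x ⟨hx.1.le, hx.2.le⟩).1 (hU x ⟨hx.1.le, hx.2.le⟩).2] at h1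
  convert! h1 using 1
  rw [g]
  simp only [Pi.neg_apply]
  ring

theorem g_self (n : ℕ) (xb : ℝ) : g lam V n xb xb = 1 := by
  simp [g]

theorem g_ne_zero (n : ℕ) (xb x : ℝ) : g lam V n xb x ≠ 0 := Complex.exp_ne_zero _

end AC

/-! ### Weak second derivatives and norms of cut-off functions -/

/-- Integrate `(f φ' - F φ)' = f φ'' - F' φ` over `[α, β]`; the left side is absolutely continuous
and vanishes at both ends. `F` need be differentiable only almost everywhere. -/
theorem hasWeakDeriv_two {f F F' : ℝ → ℂ} {α β : ℝ} (hα : 0 < α) (hαβ : α ≤ β)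
    (hf0 : ∀ x, x ∉ Ioo α β → f x = 0) (hF0 : ∀ x, x ∉ Ioo α β → F x = 0)
    (hF'0 : ∀ x, x ∉ Ioo α β → F' x = 0)
    (hf : ∀ x ∈ Icc α β, HasDerivAt f (F x) x)
    (hF : AbsolutelyContinuousOnInterval F α β)
    (hFd : ∀ᵐ x, x ∈ Icc α β → HasDerivAt F (F' x) x)
    (hi : Integrable F') : HasWeakDeriv 2 f F' := by
  have hu : uIcc α β = Icc α β := uIcc_of_le hαβ
  have hfc : ContinuousOn f (Icc α β) := fun x hx => (hf x hx).continuousAt.continuousWithinAt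
  have hfi : Integrable f := by
    refine (hfc.integrableOn_Icc).integrable_of_forall_notMem_eq_zero fun x hx => hf0 x fun h => ?_
    exact hx ⟨h.1.le, h.2.le⟩
  have hFc : ContinuousOn F (Icc α β) := hu ▸ hF.continuousOn
  refine ⟨hfi.locallyIntegrable.locallyIntegrableOn _, hi.locallyIntegrable.locallyIntegrableOn _,
    fun φ hφ => ?_⟩
  have h0 : (0:WithTop ℕ∞) < 2 := by norm_num
  have hφ1 : ContDiff ℝ 1 φ := hφ.1.of_le (by norm_cast)
  have hφ2 : ContDiff ℝ 1 (deriv φ) := hφ.deriv.1.of_le (by norm_cast)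
  have e2 : iteratedDeriv 2 φ = deriv (deriv φ) := by
    rw [iteratedDeriv_succ, iteratedDeriv_one]
  rw [e2, setIntegral_Ioi_eq_interval hα hαβ (fun x hx => by rw [hf0 x hx, zero_mul]),
    setIntegral_Ioi_eq_interval hα hαβ (fun x hx => by rw [hF'0 x hx, zero_mul])]
  have hfac : AbsolutelyContinuousOnInterval f α β :=
    ac_of_hasDerivAt (f' := F) (hu ▸ hf) (hu ▸ hFc)
  have hG := (hfac.fun_smul (hφ2.contDiffOn.absolutelyContinuousOnInterval (a := α) (b := β))).fun_sub
    (hF.fun_smul (hφ1.contDiffOn.absolutelyContinuousOnInterval (a := α) (b := β)))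
  have i1 : IntervalIntegrable (fun x => f x * deriv (deriv φ) x) volume α β :=
    (hu ▸ hfc.mul (hφ2.continuous_deriv le_rfl).continuousOn : ContinuousOn _ (uIcc α β)).intervalIntegrable
  have i2 : IntervalIntegrable (fun x => F' x * φ x) volume α β :=
    (hi.intervalIntegrable).mul_continuousOn hφ1.continuous.continuousOn
  have := ac_integral_eq_sub hG (i1.sub i2) (by
    filter_upwards [hFd] with x hx hx'
    rw [hu] at hx'
    have d1 := (hf x hx').mul (hφ2.differentiable one_ne_zero x).hasDerivAt
    have d2 := (hx hx').mul (hφ1.differentiable one_ne_zero x).hasDerivAt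
    convert! d1.sub d2 using 1
    ring)
  rw [hf0 α (fun h => lt_irrefl _ h.1), hf0 β (fun h => lt_irrefl _ h.2),
    hF0 α (fun h => lt_irrefl _ h.1), hF0 β (fun h => lt_irrefl _ h.2)] at this
  simp only [zero_smul, sub_zero] at this
  rw [intervalIntegral.integral_sub i1 i2, sub_eq_zero] at this
  rw [this]; norm_num

/-- Measurability comes from `deriv F`, which is measurable for any `F` and agrees with `F'` almost
everywhere on the interval. -/
theorem integrable_of_ae_hasDerivAt {F F' : ℝ → ℂ} {α β B : ℝ}
    (hF'0 : ∀ x, x ∉ Icc α β → F' x = 0)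
    (hFd : ∀ᵐ x, x ∈ Icc α β → HasDerivAt F (F' x) x) (hB : ∀ᵐ x, ‖F' x‖ ≤ B) :
    Integrable F' := by
  have hm : AEStronglyMeasurable F' := by
    have h1 : AEStronglyMeasurable ((Icc α β).indicator (deriv F)) :=
      ((measurable_deriv F).indicator measurableSet_Icc).aestronglyMeasurable
    refine h1.congr ?_
    filter_upwards [hFd] with x hx
    by_cases h : x ∈ Icc α β
    · rw [indicator_of_mem h, (hx h).deriv]
    · rw [indicator_of_notMem h, hF'0 x h]
  have h2 : IntegrableOn F' (Icc α β) :=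
    IntegrableOn.of_bound (by simp) hm.restrict B (ae_restrict_of_ae hB)
  exact h2.integrable_of_forall_notMem_eq_zero hF'0

theorem le_l2norm {f : ℝ → ℂ} {yl yr L : ℝ} (h0 : 0 ≤ yl) (hy : yl ≤ yr) (hL : 0 ≤ L)
    (hm : MemLp f 2 (volume.restrict (Ioi 0))) (h : ∀ x ∈ Ioo yl yr, L ≤ ‖f x‖) :
    L * Real.sqrt (yr - yl) ≤ l2norm f := by
  have h1 : eLpNorm ((Ioo yl yr).indicator fun _ => L) 2 (volume.restrict (Ioi 0))
      ≤ eLpNorm f 2 (volume.restrict (Ioi 0)) := by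
    refine eLpNorm_mono_real (g := fun x => ‖f x‖) (fun x => ?_) |>.trans (eLpNorm_norm f).le
    by_cases hx : x ∈ Ioo yl yr
    · rw [indicator_of_mem hx, Real.norm_of_nonneg hL]; exact h x hx
    · rw [indicator_of_notMem hx]; simp
  rw [eLpNorm_indicator_const measurableSet_Ioo (by norm_num) (by norm_num),
    Measure.restrict_apply measurableSet_Ioo, 
    inter_eq_left.2 (show Ioo yl yr ⊆ Ioi 0 from fun x hx => h0.trans_lt hx.1),
    Real.volume_Ioo] at h1
  have h2 := ENNReal.toReal_mono hm.2.ne h1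
  refine le_trans (le_of_eq ?_) h2
  rw [ENNReal.toReal_mul, toReal_enorm, Real.norm_of_nonneg hL, ← ENNReal.toReal_rpow,
    ENNReal.toReal_ofReal (by linarith), Real.sqrt_eq_rpow]
  norm_num

theorem l2norm_le {e f : ℝ → ℂ} {xl xr R S : ℝ} (hx : xl ≤ xr) (hR : 0 ≤ R)
    (hS : 0 ≤ S) (hf : MemLp f 2 (volume.restrict (Ioi 0)))
    (hem : AEStronglyMeasurable e (volume.restrict (Ioi 0)))
    (h : ∀ᵐ x, ‖e x‖ ≤ R * ‖f x‖ + (Ioo xl xr).indicator (fun _ => S) x) :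
    MemLp e 2 (volume.restrict (Ioi 0)) ∧ l2norm e ≤ R * l2norm f + S * Real.sqrt (xr - xl) := by
  have h1 : eLpNorm e 2 (volume.restrict (Ioi 0)) ≤
      ENNReal.ofReal R * eLpNorm f 2 (volume.restrict (Ioi 0)) +
        ENNReal.ofReal S * ENNReal.ofReal (Real.sqrt (xr - xl)) := by
    have hm1 : AEStronglyMeasurable (fun x => R * ‖f x‖) (volume.restrict (Ioi 0)) :=
      hf.1.norm.const_mul R
    have hm2 : AEStronglyMeasurable ((Ioo xl xr).indicator fun _ => S) (volume.restrict (Ioi 0)) :=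
      aestronglyMeasurable_const.indicator measurableSet_Ioo
    refine (eLpNorm_mono_ae_real (ae_restrict_of_ae h)).trans ?_
    refine (eLpNorm_add_le hm1 hm2 (by norm_num)).trans ?_
    refine add_le_add ?_ ?_
    · have : (fun x => R * ‖f x‖) = R • fun x => ‖f x‖ := by ext; simp
      rw [this, eLpNorm_const_smul, eLpNorm_norm, Real.enorm_of_nonneg hR]
    · refine (eLpNorm_mono_measure _ Measure.restrict_le_self).trans ?_
      rw [eLpNorm_indicator_const measurableSet_Ioo (by norm_num) (by norm_num), Real.volume_Ioo,
        Real.enorm_of_nonneg hS, ENNReal.ofReal_rpow_of_nonneg (by linarith) (by norm_num),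
        Real.sqrt_eq_rpow]
      norm_num
  have hfin : ENNReal.ofReal R * eLpNorm f 2 (volume.restrict (Ioi 0)) +
        ENNReal.ofReal S * ENNReal.ofReal (Real.sqrt (xr - xl)) ≠ ⊤ :=
    ENNReal.add_ne_top.2 ⟨ENNReal.mul_ne_top ENNReal.ofReal_ne_top hf.2.ne,
      ENNReal.mul_ne_top ENNReal.ofReal_ne_top ENNReal.ofReal_ne_top⟩
  refine ⟨⟨hem, h1.trans_lt hfin.lt_top⟩, ?_⟩
  have h2 := ENNReal.toReal_mono hfin h1
  rw [ENNReal.toReal_add (ENNReal.mul_ne_top ENNReal.ofReal_ne_top hf.2.ne)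
    (ENNReal.mul_ne_top ENNReal.ofReal_ne_top ENNReal.ofReal_ne_top), ENNReal.toReal_mul,
    ENNReal.toReal_mul, ENNReal.toReal_ofReal hR, ENNReal.toReal_ofReal hS,
    ENNReal.toReal_ofReal (Real.sqrt_nonneg _)] at h2
  exact h2

/-- Reduction of the quasimode estimate to pointwise bounds. -/
theorem IsJet.quasimode {N : ℕ} {lam : ℂ} {V : ℝ → ℂ} {D : ℕ → ℝ → ℂ} (hD : IsJet N V D)
    (hN : 1 < N) (hlam : lam ≠ 0) {xl xr xb : ℝ} (h0 : 0 < xl) (hxb : xb ∈ Ioo xl xr)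
    (hU : ∀ x ∈ Icc xl xr, 0 < (lam - V x).re) {ξ : ℝ → ℝ} (hξ : ContDiff ℝ ∞ ξ)
    (hξ0 : ∀ x, x ∉ Ioo xl xr → ξ x = 0) {R S L yl yr : ℝ} (hR : 0 ≤ R) (hS : 0 ≤ S)
    (hr : ∀ᵐ x, x ∈ Ioo xl xr → ‖remainder lam V D (N - 2) x‖ ≤ R)
    (hs : ∀ x ∈ Ioo xl xr, ‖(2 * ((deriv ξ x : ℝ) : ℂ) * phase lam V D (N - 2) x -
      ((deriv (deriv ξ) x : ℝ) : ℂ)) * g lam V (N - 1) xb x‖ ≤ S)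
    (hL : 0 < L) (hy0 : 0 ≤ yl) (hy : yl < yr)
    (hl : ∀ x ∈ Ioo yl yr, L ≤ ‖pseudomode lam V (N - 1) xb ξ x‖) :
    0 < l2norm (pseudomode lam V (N - 1) xb ξ) ∧
    ∃ h, IsSchrodinger V (pseudomode lam V (N - 1) xb ξ) h ∧
      l2norm (fun x => h x - lam * pseudomode lam V (N - 1) xb ξ x) /
        l2norm (pseudomode lam V (N - 1) xb ξ) ≤
        R + S * Real.sqrt (xr - xl) / (L * Real.sqrt (yr - yl)) := by
  set f := pseudomode lam V (N - 1) xb ξ with hf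
  set G := g lam V (N - 1) xb with hG
  set Φ := phase lam V D (N - 2) with hΦ
  set Φ' := phaseDeriv lam V D (N - 2) with hΦ'
  have hxlr : xl < xr := hxb.1.trans hxb.2
  -- Positivity of `Re(λ - V)` on the closed interval extends slightly beyond it. On the larger
  -- interval `g` is differentiable, and the support of `f` lies in its interior.
  obtain ⟨a, b, ha0, ha, hb, hab⟩ : ∃ a b, 0 < a ∧ a < xl ∧ xr < b ∧
      ∀ x ∈ Icc a b, 0 < x ∧ 0 < (lam - V x).re := by
    have h1 := hD.eventually_good hN h0 (hU xl ⟨le_rfl, hxlr.le⟩)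
    have h2 := hD.eventually_good hN (h0.trans hxlr) (hU xr ⟨hxlr.le, le_rfl⟩)
    obtain ⟨r, hr0, h1⟩ := Metric.eventually_nhds_iff.1 h1
    obtain ⟨r', hr0', h2⟩ := Metric.eventually_nhds_iff.1 h2
    have hm : 0 < min r xl := lt_min hr0 h0
    refine ⟨xl - min r xl / 2, xr + r' / 2, ?_, by linarith, by linarith, fun x hx => ?_⟩
    · linarith [min_le_right r xl]
    · rcases lt_or_ge x xl with h | h
      · refine h1 ?_
        rw [Real.dist_eq, abs_lt]
        constructor <;> linarith [hx.1, min_le_left r xl]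
      · rcases lt_or_ge xr x with h' | h'
        · refine h2 ?_
          rw [Real.dist_eq, abs_lt]
          constructor <;> linarith [hx.2]
        · exact ⟨h0.trans_le h, hU x ⟨h, h'⟩⟩
  set α := (a + xl) / 2 with hα
  set β := (b + xr) / 2 with hβ
  have hαβ : α ≤ β := by simp only [hα, hβ]; linarith
  have hsubab : Icc α β ⊆ Ioo a b := fun x hx => by
    simp only [hα, hβ] at hx
    exact ⟨by linarith [hx.1], by linarith [hx.2]⟩
  have hsub : Icc xl xr ⊆ Ioo α β := fun x hx => by
    simp only [hα, hβ]
    exact ⟨by linarith [hx.1], by linarith [hx.2]⟩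
  have hu : uIcc α β = Icc α β := uIcc_of_le hαβ
  have hgood : ∀ x ∈ uIcc α β, 0 < x ∧ 0 < (lam - V x).re := fun x hx =>
    hab x (Ioo_subset_Icc_self (hsubab (hu ▸ hx)))
  have hg : ∀ x ∈ Icc α β, HasDerivAt G (-(Φ x * G x)) x := fun x hx =>
    hD.hasDerivAt_g hN hlam hab ⟨by linarith [hxb.1], by linarith [hxb.2]⟩ (hsubab hx)
  have hξ1 : ∀ x, HasDerivAt (fun x => (ξ x : ℂ)) ((deriv ξ x : ℝ) : ℂ) x := fun x =>
    ((hξ.differentiable (by simp)) x).hasDerivAt.ofReal_comp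
  have hξ' : ContDiff ℝ ∞ (deriv ξ) := (contDiff_infty_iff_deriv.1 hξ).2
  have hξ2 : ∀ x, HasDerivAt (fun x => ((deriv ξ x : ℝ) : ℂ)) ((deriv (deriv ξ) x : ℝ) : ℂ) x := fun x =>
    ((hξ'.differentiable (by simp)) x).hasDerivAt.ofReal_comp
  have htsupp : tsupport ξ ⊆ Icc xl xr := by
    refine closure_minimal (fun x hx => ?_) isClosed_Icc
    by_contra h
    exact hx (hξ0 x fun h' => h ⟨h'.1.le, h'.2.le⟩)
  have hdξ0 : ∀ x, x ∉ Icc xl xr → deriv ξ x = 0 := fun x hx => by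
    by_contra h
    exact hx (htsupp (support_deriv_subset h))
  have hddξ0 : ∀ x, x ∉ Icc xl xr → deriv (deriv ξ) x = 0 := fun x hx => by
    by_contra h
    exact hx (htsupp ((closure_minimal support_deriv_subset (isClosed_tsupport ξ))
      (support_deriv_subset h)))
  have hξ0' : ∀ x, x ∉ Icc xl xr → ξ x = 0 := fun x hx => hξ0 x fun h => hx ⟨h.1.le, h.2.le⟩
  -- `F` and `F'` are the first and second derivatives of `f = ξ G`, computed from `G' = -Φ G`.
  let F : ℝ → ℂ := fun x => (((deriv ξ x : ℝ) : ℂ) - ξ x * Φ x) * G x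
  let F' : ℝ → ℂ := fun x => (((deriv (deriv ξ) x : ℝ) : ℂ) - 2 * ((deriv ξ x : ℝ) : ℂ) * Φ x - ξ x * Φ' x
    + ξ x * Φ x ^ 2) * G x
  have hf0 : ∀ x, x ∉ Icc xl xr → f x = 0 := fun x hx => by simp [hf, pseudomode, hξ0' x hx]
  have hF0 : ∀ x, x ∉ Icc xl xr → F x = 0 := fun x hx => by simp [F, hξ0' x hx, hdξ0 x hx]
  have hF'0 : ∀ x, x ∉ Icc xl xr → F' x = 0 := fun x hx => by
    simp [F', hξ0' x hx, hdξ0 x hx, hddξ0 x hx]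
  have hfd : ∀ x ∈ Icc α β, HasDerivAt f (F x) x := by
    intro x hx
    have := (hξ1 x).mul (hg x hx)
    convert! this using 1
    simp only [F]; ring
  have hfc : Continuous f := by
    rw [continuous_iff_continuousAt]
    intro x
    by_cases hx : x ∈ Icc xl xr
    · exact (hfd x (Ioo_subset_Icc_self (hsub hx))).continuousAt
    · have : f =ᶠ[𝓝 x] fun _ => 0 := by
        filter_upwards [isClosed_Icc.isOpen_compl.mem_nhds hx] with y hy using hf0 y hy
      exact continuousAt_const.congr this.symm
  have hfm : MemLp f 2 (volume.restrict (Ioi 0)) := by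
    have : HasCompactSupport f := by
      refine HasCompactSupport.intro isCompact_Icc hf0
    exact (hfc.memLp_of_hasCompactSupport this).restrict _
  have hGac : AbsolutelyContinuousOnInterval G α β := by
    refine ac_of_hasDerivAt (f' := fun x => -(Φ x * G x)) (hu ▸ hg) ?_
    refine ((hD.ac_phase hN hgood (by omega)).continuousOn.mul ?_).neg
    rw [hu]
    exact fun x hx => (hg x hx).continuousAt.continuousWithinAt
  have hξac : AbsolutelyContinuousOnInterval (fun x => (ξ x : ℂ)) α β :=
    ac_ofReal ((hξ.of_le (by norm_cast)).contDiffOn.absolutelyContinuousOnInterval)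
  have hξ'ac : AbsolutelyContinuousOnInterval (fun x => ((deriv ξ x : ℝ) : ℂ)) α β :=
    ac_ofReal ((hξ'.of_le (by norm_cast)).contDiffOn.absolutelyContinuousOnInterval)
  have hΦac : AbsolutelyContinuousOnInterval Φ α β := hD.ac_phase hN hgood (by omega)
  have hFac : AbsolutelyContinuousOnInterval F α β :=
    (hξ'ac.fun_sub (hξac.fun_smul hΦac)).fun_smul hGac
  have hDae : ∀ᵐ x, ∀ m ∈ Finset.range N, 0 < x → HasDerivAt (D m) (D (m + 1) x) x := by
    rw [ae_all_iff]
    intro m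
    by_cases hm : m < N
    · filter_upwards [hD.ae_hasDerivAt m hm] with x hx _ using hx
    · exact .of_forall fun x h => absurd (Finset.mem_range.1 h) hm
  have hFd : ∀ᵐ x, x ∈ Icc α β → HasDerivAt F (F' x) x := by
    filter_upwards [hDae] with x hx hxα
    have hgx := hgood x (hu ▸ hxα)
    have hΦd : HasDerivAt Φ (Φ' x) x := by
      refine hasDerivAt_phase hgx.2 (hD.hasDerivAt_potential hN hgx.1) fun m _ hm => ?_
      exact hx m (Finset.mem_range.2 (by omega)) hgx.1
    have := ((hξ2 x).sub ((hξ1 x).mul hΦd)).mul (hg x hxα)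
    convert! this using 1
    simp only [F', Pi.mul_apply, Pi.sub_apply]; ring
  -- The basic splitting: the remainder times `f`, plus the commutator of the operator with the
  -- cut-off.
  have hpt : ∀ x ∈ Icc xl xr, V x * f x - F' x - lam * f x =
      remainder lam V D (N - 2) x * f x + (2 * ((deriv ξ x : ℝ) : ℂ) * Φ x -
        ((deriv (deriv ξ) x : ℝ) : ℂ)) * G x := by
    intro x hx
    rw [← phaseDeriv_sub_sq (hU x hx)]
    simp only [hf, pseudomode, F', ← hΦ', ← hΦ, ← hG]
    ring
  have hend : ∀ᵐ x : ℝ, x ≠ xl ∧ x ≠ xr := by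
    have h1 : ∀ᵐ x : ℝ, x ≠ xl := by simp [ae_iff, measure_singleton]
    have h2 : ∀ᵐ x : ℝ, x ≠ xr := by simp [ae_iff, measure_singleton]
    exact h1.and h2
  have herr : ∀ᵐ x, ‖V x * f x - F' x - lam * f x‖ ≤
      R * ‖f x‖ + (Ioo xl xr).indicator (fun _ => S) x := by
    filter_upwards [hr, hend] with x hx hxe
    by_cases h : x ∈ Ioo xl xr
    · rw [hpt x ⟨h.1.le, h.2.le⟩, indicator_of_mem h]
      refine (norm_add_le _ _).trans (add_le_add ?_ (hs x h))
      rw [norm_mul]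
      gcongr
      exact hx h
    · have h' : x ∉ Icc xl xr := fun h' =>
        h ⟨lt_of_le_of_ne h'.1 hxe.1.symm, lt_of_le_of_ne h'.2 hxe.2⟩
      rw [indicator_of_notMem h, hf0 x h', hF'0 x h']
      simp
  have hVc : ContinuousOn V (Ioi 0) := fun x hx =>
    (hD.hasDerivAt_potential hN hx).continuousAt.continuousWithinAt
  -- Boundedness of `F'` is read off backwards: it equals `(V - λ) f`, which is continuous, minus
  -- the error just bounded almost everywhere.
  have hF'i : Integrable F' := by
    have hVf : ContinuousOn (fun x => V x * f x - lam * f x) (Icc xl xr) :=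
      ((hVc.mono fun x hx => h0.trans_le hx.1).mul hfc.continuousOn).sub
        (continuousOn_const.mul hfc.continuousOn)
    obtain ⟨B, hB⟩ := isCompact_Icc.exists_bound_of_continuousOn hVf
    obtain ⟨B', hB'⟩ := isCompact_Icc.exists_bound_of_continuousOn (s := Icc xl xr)
      (hfc.continuousOn)
    refine integrable_of_ae_hasDerivAt (α := α) (β := β) (B := |B| + R * |B'| + S)
      (fun x hx => hF'0 x fun h => hx (Ioo_subset_Icc_self (hsub h))) hFd ?_
    filter_upwards [herr] with x hx
    by_cases h : x ∈ Icc xl xr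
    · have h1 : F' x = (V x * f x - lam * f x) - (V x * f x - F' x - lam * f x) := by ring
      rw [h1]
      refine (norm_sub_le _ _).trans ?_
      have h2 := (hB x h).trans (le_abs_self B)
      have h3 := (hB' x h).trans (le_abs_self B')
      have h4 : (Ioo xl xr).indicator (fun _ => S) x ≤ S := indicator_le_self' (fun _ _ => hS) x
      have h5 : R * ‖f x‖ ≤ R * |B'| := by gcongr
      linarith
    · rw [hF'0 x h, norm_zero]; positivity
  have hw : HasWeakDeriv 2 f F' := by
    refine hasWeakDeriv_two (α := α) (β := β) (by simp only [hα]; linarith) hαβ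
      (fun x hx => hf0 x fun h => hx (hsub h)) (fun x hx => hF0 x fun h => hx (hsub h))
      (fun x hx => hF'0 x fun h => hx (hsub h)) hfd hFac hFd hF'i
  have hem : AEStronglyMeasurable (fun x => V x * f x - F' x - lam * f x)
      (volume.restrict (Ioi 0)) :=
    (((hVc.aestronglyMeasurable measurableSet_Ioi).mul hfc.aestronglyMeasurable).sub
      hF'i.aestronglyMeasurable.restrict).sub (hfc.aestronglyMeasurable.const_mul lam)
  obtain ⟨hem2, hle⟩ := l2norm_le hxlr.le hR hS hfm hem herr
  have hlow := le_l2norm hy0 hy.le hL.le hfm hl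
  have hpos : 0 < L * Real.sqrt (yr - yl) := by
    have : 0 < yr - yl := by linarith
    positivity
  refine ⟨hpos.trans_le hlow, fun x => V x * f x - F' x, ⟨hfm, ?_, ?_⟩, ?_⟩
  · have : (fun x => V x * f x - F' x) =
        fun x => (V x * f x - F' x - lam * f x) + lam * f x := by ext x; ring
    rw [this]
    exact hem2.add (hfm.const_mul lam)
  · have : (fun x => V x * f x - (V x * f x - F' x)) = F' := by ext x; ring
    rw [this]
    exact hw
  · have hfp : 0 < l2norm f := hpos.trans_le hlow
    rw [div_le_iff₀ hfp]
    refine hle.trans ?_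
    rw [add_mul]
    refine add_le_add le_rfl ?_
    rw [div_mul_eq_mul_div, le_div_iff₀ hpos]
    gcongr

/-! ### Uniform bounds near the turning point -/

/-- The logarithm of `p` is Lipschitz with constant `M`. -/
theorem le_exp_mul_of_abs_deriv_le {p p' : ℝ → ℝ} {I : Set ℝ} (hI : Convex ℝ I) {M m : ℝ}
    (hp : ∀ x ∈ I, 0 < p x) (hd : ∀ x ∈ I, HasDerivAt p (p' x) x)
    (hb : ∀ x ∈ I, |p' x| ≤ M * p x) {x y : ℝ} (hx : x ∈ I) (hy : y ∈ I)
    (hm : M * |x - y| ≤ m) : p x ≤ Real.exp m * p y := by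
  have h1 : ‖Real.log (p x) - Real.log (p y)‖ ≤ M * ‖x - y‖ := by
    refine hI.norm_image_sub_le_of_norm_hasDerivWithin_le (f := fun x => Real.log (p x))
      (f' := fun x => p' x / p x)
      (fun z hz => ((hd z hz).log (hp z hz).ne').hasDerivWithinAt) (fun z hz => ?_) hy hx
    rw [Real.norm_eq_abs, abs_div, abs_of_pos (hp z hz), div_le_iff₀ (hp z hz)]
    exact hb z hz
  rw [Real.norm_eq_abs, Real.norm_eq_abs] at h1
  have h2 : Real.log (p x) ≤ m + Real.log (p y) := by linarith [(abs_le.1 h1).2]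
  have h3 := Real.exp_le_exp.2 h2
  rwa [Real.exp_add, Real.exp_log (hp x hx), Real.exp_log (hp y hy)] at h3

theorem mul_sub_sq_le_of_deriv_ge {p p' : ℝ → ℝ} {I : Set ℝ} (hI : Convex ℝ I) {m : ℝ}
    (hd : ∀ x ∈ I, HasDerivAt p (p' x) x) (hb : ∀ x ∈ I, m ≤ p' x) {x y : ℝ} (hx : x ∈ I)
    (hy : y ∈ I) : m * (x - y) ^ 2 ≤ (p x - p y) * (x - y) := by
  have hd' : ∀ x ∈ I, HasDerivAt (fun x => p x - m * x) (p' x - m) x := fun x hx => by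
    simpa using! (hd x hx).sub ((hasDerivAt_id x).const_mul m)
  have hmono : MonotoneOn (fun x => p x - m * x) I := by
    refine monotoneOn_of_deriv_nonneg hI (fun x hx => (hd' x hx).continuousAt.continuousWithinAt)
      (fun x hx => (hd' x (interior_subset hx)).differentiableAt.differentiableWithinAt)
      fun x hx => ?_
    rw [(hd' x (interior_subset hx)).deriv]
    linarith [hb x (interior_subset hx)]
  rcases le_total x y with h | h
  · have := hmono hx hy h
    simp only at this
    nlinarith
  · have := hmono hy hx h
    simp only at this
    nlinarith

/-- Bounds on `J_b` with a constant `K` that does not depend on `b`; here `κ = x_b^ν` and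
`J_b = (x_b - 1/(2κ), x_b + 1/(2κ))`. -/
structure LocalBound (N : ℕ) (V : ℝ → ℂ) (D : ℕ → ℝ → ℂ) (K κ xb a b : ℝ) : Prop where
  one_le_const : 1 ≤ K
  kappa_pos : 0 < κ
  one_le : 1 ≤ b
  xb_pos : 0 < xb - 1 / (2 * κ)
  kappa_sq_le : κ ^ 2 ≤ K * b
  pos : ∀ x, κ * |x - xb| < 1 / 2 → 0 < a - (V x).re
  abs_re_le : ∀ x, κ * |x - xb| < 1 / 2 → |(V x).re| ≤ K * (a - (V x).re)
  deriv_le : ∀ m, 1 ≤ m → m < N → ∀ x, κ * |x - xb| < 1 / 2 →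
    ‖D m x‖ ≤ K * (κ ^ m * (b + |(V x).re|))
  ae_deriv_le : ∀ᵐ x, κ * |x - xb| < 1 / 2 → ‖D N x‖ ≤ K * (κ ^ N * (b + |(V x).re|))
  comparable : ∀ x y, κ * |x - xb| < 1 / 2 → κ * |y - xb| < 1 / 2 →
    a - (V x).re + b ≤ K * (a - (V y).re + b)
  im_lower : ∀ x, κ * |x - xb| < 1 / 2 → κ * b * (x - xb) ^ 2 ≤ K * (((V x).im - b) * (x - xb))
  im_upper : ∀ x, κ * |x - xb| < 1 / 2 → |(V x).im - b| ≤ K * (b * (κ * |x - xb|))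
  cube_lower : ∀ x, κ * |x - xb| < 1 / 2 → b ^ 2 * κ ^ 2 ≤ K * (a - (V x).re) ^ 3

theorem mem_J_iff {ν xb x : ℝ} (hxb : 0 < xb) : x ∈ J ν xb ↔ xb ^ ν * |x - xb| < 1 / 2 := by
  have hκ : 0 < xb ^ ν := by positivity
  have : delta ν xb = 1 / (2 * xb ^ ν) := by
    rw [delta, Real.rpow_neg hxb.le]; field_simp
  rw [J, this, mem_Ioo, ← sub_lt_iff_lt_add', sub_lt_comm, ← abs_sub_lt_iff, abs_sub_comm,
    lt_div_iff₀ (by positivity)]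
  constructor <;> intro h <;> nlinarith

set_option maxHeartbeats 1000000 in
-- Since `ν ≥ -1`, `κ x_b ≥ 1`, so `J_b` lies in `(x_b / 2, 2 x_b)` and `x ^ ν` is comparable to `κ`
-- there. The logarithmic derivatives of `Im V` and of `a - Re V + b` are `O(κ)`, and `J_b` has
-- length `1 / κ`; both functions therefore vary only by bounded factors.
theorem TailBound.exists_localBound {N : ℕ} {ν ε : ℝ} {V : ℝ → ℂ} {D : ℕ → ℝ → ℂ} {X C c : ℝ}
    (h : TailBound N ν ε V D X C c) (hD : IsJet N V D) (hN : 1 < N) (hν : -1 ≤ ν) (hε : 0 < ε)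
    {c₁ c₂ : ℝ} (hc₁ : 0 < c₁) (hc₂ : 0 < c₂) :
    ∃ K, ∀ (c₃ xb a b : ℝ), 2 * X ≤ xb → (V xb).im = b → InWindow c₁ c₂ c₃ ν ε V xb a b →
      LocalBound N V D K (xb ^ ν) xb a b := by
  obtain ⟨K₀, hK₀⟩ : ∃ t : ℝ, t = 2 ^ |ν| := ⟨_, rfl⟩
  have hK₀1 : 1 ≤ K₀ := hK₀ ▸ Real.one_le_rpow (by norm_num) (abs_nonneg ν)
  have hC1 := h.one_le_const
  have hc := h.const_pos
  obtain ⟨E, hE⟩ : ∃ t : ℝ, t = Real.exp (C * K₀) := ⟨_, rfl⟩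
  have hE1 : 1 ≤ E := hE ▸ Real.one_le_exp (by positivity)
  obtain ⟨C₄, hC₄⟩ : ∃ t : ℝ, t = C * K₀ * (E + (1 + c₂)) := ⟨_, rfl⟩
  have hCK : 1 ≤ C * K₀ := by nlinarith
  obtain ⟨C₅, hC₅⟩ : ∃ t : ℝ, t = C * K₀ ^ N * E := ⟨_, rfl⟩
  have hC₅1 : 1 ≤ C₅ := by
    have : 1 ≤ K₀ ^ N := one_le_pow₀ hK₀1
    have : 1 ≤ C * K₀ ^ N := by nlinarith
    rw [hC₅]; nlinarith
  -- One constant for all fields: each summand is the constant required by one or more of the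
  -- estimates below.
  obtain ⟨K, hK⟩ : ∃ t : ℝ, t = C + (1 + c₂) + C₅ + Real.exp C₄ + E * K₀ / c + C * K₀ * E + (c₁ * c₂) ^ 3 := ⟨_, rfl⟩
  have p1 : 0 < Real.exp C₄ := Real.exp_pos _
  have p2 : 0 < E * K₀ / c := by positivity
  have p3 : 0 < C * K₀ * E := by positivity
  have p4 : 0 < (c₁ * c₂) ^ 3 := by positivity
  refine ⟨K, fun c₃ xb a b hX hb hw => ?_⟩
  have hX1 := h.one_le
  have hxb1 : 1 ≤ xb := by linarith
  have hxb : 0 < xb := by linarith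
  obtain ⟨κ, hκdef⟩ : ∃ κ : ℝ, κ = xb ^ ν := ⟨_, rfl⟩
  rw [← hκdef]
  have hκ : 0 < κ := by rw [hκdef]; positivity
  have hκx : 1 ≤ κ * xb := by
    rw [hκdef, ← Real.rpow_add_one hxb.ne']
    exact Real.one_le_rpow hxb1 (by linarith)
  have hb1 : 1 ≤ b := hb ▸ h.im_pos xb (by linarith)
  have hmem : ∀ x, κ * |x - xb| < 1 / 2 ↔ x ∈ J ν xb := fun x => by
    rw [hκdef]; exact (mem_J_iff hxb).symm
  have hI : Convex ℝ (J ν xb) := convex_Ioo _ _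
  have hloc : ∀ x ∈ J ν xb, xb / 2 < x ∧ x < 2 * xb := by
    intro x hx
    rw [← hmem] at hx
    have : |x - xb| < xb / 2 := by
      by_contra! hcon
      nlinarith
    rw [abs_lt] at this
    constructor <;> linarith
  have hxX : ∀ x ∈ J ν xb, X ≤ x := fun x hx => by linarith [(hloc x hx).1]
  have hx0 : ∀ x ∈ J ν xb, 0 < x := fun x hx => by linarith [(hloc x hx).1]
  have hpow : ∀ x ∈ J ν xb, x ^ ν ≤ K₀ * κ ∧ κ ≤ K₀ * x ^ ν := by
    intro x hx
    obtain ⟨h1, h2⟩ := hloc x hx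
    have hx0 := hx0 x hx
    rw [hκdef, hK₀]
    rcases le_total 0 ν with hn | hn
    · rw [abs_of_nonneg hn, ← Real.mul_rpow (by norm_num) hxb.le,
        ← Real.mul_rpow (by norm_num) hx0.le]
      exact ⟨Real.rpow_le_rpow hx0.le h2.le hn, Real.rpow_le_rpow hxb.le (by linarith) hn⟩
    · rw [abs_of_nonpos hn, Real.rpow_neg (by norm_num), ← Real.inv_rpow (by norm_num),
        ← Real.mul_rpow (by norm_num) hxb.le, ← Real.mul_rpow (by norm_num) hx0.le]
      exact ⟨Real.rpow_le_rpow_of_nonpos (by positivity) (by linarith) hn,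
        Real.rpow_le_rpow_of_nonpos (by positivity) (by linarith) hn⟩
  have hxbJ : xb ∈ J ν xb := by rw [← hmem]; simp
  have hdim : ∀ x ∈ J ν xb, HasDerivAt (fun x => (V x).im) (D 1 x).im x := fun x hx =>
    hasDerivAt_im (hD.hasDerivAt_potential hN (hx0 x hx))
  have hdist : ∀ x ∈ J ν xb, ∀ y ∈ J ν xb, κ * |x - y| ≤ 1 := by
    intro x hx y hy
    rw [← hmem] at hx hy
    have : |x - y| ≤ |x - xb| + |y - xb| := by
      have := abs_sub_le x xb y
      rwa [abs_sub_comm xb y] at this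
    nlinarith
  have hub : ∀ x ∈ J ν xb, |(D 1 x).im| ≤ C * K₀ * κ * (V x).im := by
    intro x hx
    refine (h.im_upper x (hxX x hx)).trans ?_
    have h1 := h.im_pos x (hxX x hx)
    calc C * ((V x).im * x ^ ν) ≤ C * ((V x).im * (K₀ * κ)) := by
          gcongr
          exact (hpow x hx).1
      _ = _ := by ring
  have him : ∀ x ∈ J ν xb, ∀ y ∈ J ν xb, (V x).im ≤ E * (V y).im := by
    intro x hx y hy
    rw [hE]
    refine le_exp_mul_of_abs_deriv_le hI (M := C * K₀ * κ) (p := fun x => (V x).im)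
      (fun x hx => by linarith [h.im_pos x (hxX x hx)]) hdim hub hx hy ?_
    have := hdist x hx y hy
    calc C * K₀ * κ * |x - y| = C * K₀ * (κ * |x - y|) := by ring
      _ ≤ C * K₀ * 1 := by gcongr
      _ = _ := by ring
  -- The window forces `|a| > 0`, hence `a - Re V > 0`; the cube of its lower bound is the
  -- inequality used later as `cube_lower`.
  have hA : ∀ x ∈ J ν xb, 0 < a - (V x).re ∧ |a| ≤ c₂ * (a - (V x).re) ∧
      b ^ 2 * κ ^ 2 ≤ (c₁ * c₂) ^ 3 * (a - (V x).re) ^ 3 := by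
    intro x hx
    obtain ⟨h1, h2, _⟩ := hw x hx
    have h0 : 0 < b ^ (2 / 3 : ℝ) * xb ^ (2 * ν / 3) := by positivity
    have ha : 0 < |a| := by
      by_contra! hcon
      nlinarith
    have hpos : 0 < a - (V x).re := by
      by_contra! hcon
      nlinarith
    refine ⟨hpos, h2, ?_⟩
    clear hw hI hmem hdim hub him hK hE
    have h3 : b ^ (2 / 3 : ℝ) * xb ^ (2 * ν / 3) ≤ c₁ * c₂ * (a - (V x).re) := by
      refine h1.trans ?_
      rw [mul_assoc]; gcongr
    have h4 := pow_le_pow_left₀ h0.le h3 3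
    rw [mul_pow, mul_pow (c₁ * c₂)] at h4
    refine le_trans (le_of_eq ?_) h4
    rw [hκdef, ← Real.rpow_mul_natCast (show 0 ≤ b by linarith), ← Real.rpow_mul_natCast hxb.le,
      ← Real.rpow_mul_natCast hxb.le, show (2 / 3 : ℝ) * (3 : ℕ) = (2 : ℕ) by norm_num,
      Real.rpow_natCast]
    congr 2
    push_cast; ring
  have hre : ∀ x ∈ J ν xb, |(V x).re| ≤ (1 + c₂) * (a - (V x).re) := by
    intro x hx
    obtain ⟨h1, h2, _⟩ := hA x hx
    have : |(V x).re| ≤ |a| + |a - (V x).re| := by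
      have := abs_sub a (a - (V x).re)
      simpa using this
    rw [abs_of_pos h1] at this
    linarith
  have hVn : ∀ x ∈ J ν xb, ‖V x‖ ≤ E * (b + |(V x).re|) := by
    intro x hx
    have h1 := Complex.norm_le_abs_re_add_abs_im (V x)
    have h2 := him x hx xb hxbJ
    rw [hb] at h2
    rw [abs_of_pos (show 0 < (V x).im by linarith [h.im_pos x (hxX x hx)])] at h1
    have := abs_nonneg (V x).re
    nlinarith
  have hpowm : ∀ x ∈ J ν xb, ∀ m ≤ N, (x ^ ν) ^ m ≤ K₀ ^ N * κ ^ m := by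
    intro x hx m hm
    have h0 : 0 ≤ x ^ ν := by have := hx0 x hx; positivity
    calc (x ^ ν) ^ m ≤ (K₀ * κ) ^ m := pow_le_pow_left₀ h0 (hpow x hx).1 m
      _ = K₀ ^ m * κ ^ m := mul_pow _ _ _
      _ ≤ K₀ ^ N * κ ^ m := by
        gcongr
  have hDm : ∀ m ≤ N, ∀ x ∈ J ν xb, ‖D m x‖ ≤ C * (‖V x‖ * (x ^ ν) ^ m) →
      ‖D m x‖ ≤ C₅ * (κ ^ m * (b + |(V x).re|)) := by
    intro m hm x hx hle
    refine hle.trans ?_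
    have h0 : 0 ≤ x ^ ν := by have := hx0 x hx; positivity
    calc C * (‖V x‖ * (x ^ ν) ^ m)
        ≤ C * ((E * (b + |(V x).re|)) * (K₀ ^ N * κ ^ m)) := by
          gcongr
          · exact hVn x hx
          · exact hpowm x hx m hm
      _ = _ := by rw [hC₅]; ring
  have hKC₅ : C₅ ≤ K := by rw [hK]; linarith
  refine ⟨by rw [hK]; linarith, hκ, hb1, ?_, ?_, ?_, ?_, ?_, ?_, ?_, ?_, ?_, ?_⟩
  · rw [sub_pos, div_lt_iff₀ (by positivity)]
    linarith
  · have h1 := h.growth xb (by linarith)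
    rw [hb] at h1
    calc κ ^ 2 = xb ^ (2 * ν) := by
          rw [hκdef, ← Real.rpow_mul_natCast hxb.le]; congr 1; push_cast; ring
      _ ≤ xb ^ (4 * ν + 2 * ε + 2) := Real.rpow_le_rpow_of_exponent_le hxb1 (by linarith)
      _ ≤ C * b := h1
      _ ≤ K * b := by
        gcongr
        rw [hK]; linarith
  · intro x hx
    exact (hA x ((hmem x).1 hx)).1
  · intro x hx
    refine (hre x ((hmem x).1 hx)).trans ?_
    have := (hA x ((hmem x).1 hx)).1
    gcongr
    rw [hK]; linarith
  · intro m h1 h2 x hx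
    rw [hmem] at hx
    refine (hDm m h2.le x hx (h.deriv_le m h1 h2 x (hxX x hx))).trans ?_
    gcongr
  · filter_upwards [h.ae_deriv_le] with x hx hxJ
    rw [hmem] at hxJ
    refine (hDm N le_rfl x hxJ (hx (hxX x hxJ))).trans ?_
    gcongr
  · intro x y hx hy
    rw [hmem] at hx hy
    have hBp : ∀ x ∈ J ν xb, 0 < a - (V x).re + b := fun x hx => by linarith [(hA x hx).1]
    -- The summand `b` is essential: `|Re V'|` is controlled only by `κ |V|`, which is of order `κ
    -- (a - Re V + b)`, so `a - Re V` alone need not be slowly varying.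
    have key : a - (V x).re + b ≤ Real.exp C₄ * (a - (V y).re + b) := by
      refine le_exp_mul_of_abs_deriv_le (p := fun x => a - (V x).re + b)
        (p' := fun x => -(D 1 x).re) hI (M := C₄ * κ) hBp (fun x hx => ?_) (fun x hx => ?_) hx hy ?_
      · exact ((hasDerivAt_re (hD.hasDerivAt_potential hN (hx0 x hx))).const_sub a).add_const b
      · rw [abs_neg]
        have h1 := h.deriv_le 1 le_rfl hN x (hxX x hx)
        rw [pow_one] at h1
        have h2 : ‖V x‖ ≤ (E + (1 + c₂)) * (a - (V x).re + b) := by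
          have h3 := hVn x hx
          have h4 := Complex.norm_le_abs_re_add_abs_im (V x)
          have h5 := him x hx xb hxbJ
          rw [hb] at h5
          rw [abs_of_pos (show 0 < (V x).im by linarith [h.im_pos x (hxX x hx)])] at h4
          have h6 := hre x hx
          have h7 := (hA x hx).1
          have h8 : 0 ≤ E * (a - (V x).re) := by positivity
          have h9 : 0 ≤ (1 + c₂) * b := by positivity
          nlinarith
        have h0 : 0 ≤ x ^ ν := by have := hx0 x hx; positivity
        calc |(D 1 x).re| ≤ ‖D 1 x‖ := Complex.abs_re_le_norm _
          _ ≤ C * (‖V x‖ * x ^ ν) := h1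
          _ ≤ C * (((E + (1 + c₂)) * (a - (V x).re + b)) * (K₀ * κ)) := by
            have := hBp x hx
            gcongr
            exact (hpow x hx).1
          _ = _ := by rw [hC₄]; ring
      · have := hdist x hx y hy
        have hC₄0 : 0 ≤ C₄ := by rw [hC₄]; positivity
        calc C₄ * κ * |x - y| = C₄ * (κ * |x - y|) := by ring
          _ ≤ C₄ * 1 := by gcongr
          _ = _ := by ring
    refine key.trans ?_
    have := hBp y hy
    gcongr
    rw [hK]; linarith
  · intro x hx
    rw [hmem] at hx
    have hlow : ∀ y ∈ J ν xb, c * (b / E) * (κ / K₀) ≤ (D 1 y).im := by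
      intro y hy
      refine le_trans ?_ (h.im_lower y (hxX y hy))
      have h1 : b / E ≤ (V y).im := by
        rw [div_le_iff₀ (by positivity), mul_comm, ← hb]
        exact him xb hxbJ y hy
      have h2 : κ / K₀ ≤ y ^ ν := by
        rw [div_le_iff₀ (by positivity), mul_comm]
        exact (hpow y hy).2
      have h0 : 0 ≤ (V y).im := by linarith [h.im_pos y (hxX y hy)]
      rw [mul_assoc]
      gcongr
    have h1 := mul_sub_sq_le_of_deriv_ge hI hdim hlow hx hxbJ
    simp only [hb] at h1
    have h2 : κ * b * (x - xb) ^ 2 ≤ (E * K₀ / c) * (((V x).im - b) * (x - xb)) := by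
      calc κ * b * (x - xb) ^ 2 = (E * K₀ / c) * (c * (b / E) * (κ / K₀) * (x - xb) ^ 2) := by
            field_simp
        _ ≤ _ := by gcongr
    refine h2.trans ?_
    have h3 : 0 ≤ ((V x).im - b) * (x - xb) := le_trans (by positivity) h1
    gcongr
    rw [hK]; linarith
  · intro x hx
    rw [hmem] at hx
    have h1 : ‖(V x).im - (V xb).im‖ ≤ C * K₀ * κ * (E * b) * ‖x - xb‖ := by
      refine hI.norm_image_sub_le_of_norm_hasDerivWithin_le (f := fun x => (V x).im)
        (f' := fun x => (D 1 x).im)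
        (fun z hz => (hdim z hz).hasDerivWithinAt) (fun z hz => ?_) hxbJ hx
      refine (hub z hz).trans ?_
      have := him z hz xb hxbJ
      rw [hb] at this
      gcongr
    rw [hb, Real.norm_eq_abs, Real.norm_eq_abs] at h1
    calc |(V x).im - b| ≤ C * K₀ * E * (b * (κ * |x - xb|)) := by rw [← sub_nonneg] at h1 ⊢; linarith
      _ ≤ K * (b * (κ * |x - xb|)) := by
        gcongr
        rw [hK]; linarith
  · intro x hx
    rw [hmem] at hx
    obtain ⟨h1, _, h3⟩ := hA x hx
    refine h3.trans ?_
    gcongr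
    rw [hK]; linarith

/-! ### Bounds on the terms of the expansion -/

theorem exists_wkb_bound (K : ℝ) (k : ℕ) : ∃ K₁ ≥ 0, ∀ (lam : ℂ) (V : ℝ → ℂ) (D : ℕ → ℝ → ℂ)
    (x κ ρ T : ℝ), 0 ≤ κ → 0 ≤ ρ → ‖(sqrtAt lam V x)⁻¹‖ ≤ T →
    (∀ m, 1 ≤ m → m ≤ k + 1 → ‖jetAt lam V D m x‖ ≤ K * (κ ^ m * ρ)) →
    ‖wkb lam V D k x‖ ≤ K₁ * (T ^ k * (κ ^ (k + 1) * ∑ l ∈ Finset.Icc 1 (k + 1), ρ ^ l)) := by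
  obtain ⟨K₁, hK₁, h⟩ := (graded_wkbPoly k).exists_bound K
  refine ⟨K₁, hK₁, fun lam V D x κ ρ T hκ hρ hT hu => ?_⟩
  have h1 := h (fun m => jetAt lam V D m x) κ ρ hκ hρ hu
  have hT0 : 0 ≤ T := (norm_nonneg _).trans hT
  rw [wkb, norm_mul, norm_pow, mul_left_comm]
  exact mul_le_mul (pow_le_pow_left₀ (norm_nonneg _) hT k) h1 (norm_nonneg _) (by positivity)

theorem exists_wkbDeriv_bound (K : ℝ) (k : ℕ) : ∃ K₁ ≥ 0, ∀ (lam : ℂ) (V : ℝ → ℂ)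
    (D : ℕ → ℝ → ℂ) (x κ ρ T : ℝ), 0 ≤ κ → 0 ≤ ρ → ‖(sqrtAt lam V x)⁻¹‖ ≤ T →
    (∀ m, 1 ≤ m → m ≤ k + 2 → ‖jetAt lam V D m x‖ ≤ K * (κ ^ m * ρ)) →
    ‖wkbDeriv lam V D k x‖ ≤ K₁ * (T ^ k * (κ ^ (k + 2) * ∑ l ∈ Finset.Icc 1 (k + 2), ρ ^ l)) := by
  obtain ⟨K₁, hK₁, h⟩ := (graded_wkbPolyDeriv k).exists_bound K
  refine ⟨K₁, hK₁, fun lam V D x κ ρ T hκ hρ hT hu => ?_⟩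
  have h1 := h (fun m => jetAt lam V D m x) κ ρ hκ hρ hu
  have hT0 : 0 ≤ T := (norm_nonneg _).trans hT
  rw [wkbDeriv, norm_mul, norm_pow, mul_left_comm]
  exact mul_le_mul (pow_le_pow_left₀ (norm_nonneg _) hT k) h1 (norm_nonneg _) (by positivity)

/-- A contribution linear in `ρ` can come only from the last derivative. Products of two terms have
degree at least two in `ρ`, and `p + q = n + k` gives them the weight `n + 2 + k`. -/
theorem exists_remainder_bound (K : ℝ) (n : ℕ) : ∃ K₁ ≥ 0, ∀ (lam : ℂ) (V : ℝ → ℂ)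
    (D : ℕ → ℝ → ℂ) (x κ ρ T : ℝ), 0 ≤ κ → 0 ≤ ρ → ‖(sqrtAt lam V x)⁻¹‖ ≤ T →
    (∀ m, 1 ≤ m → m ≤ n + 2 → ‖jetAt lam V D m x‖ ≤ K * (κ ^ m * ρ)) →
    ‖remainder lam V D n x‖ ≤ K₁ * (κ ^ (n + 2) * (T ^ n * ρ) +
      ∑ k ∈ Finset.range (n + 1), ∑ l ∈ Finset.Icc 2 (n + 2 + k),
        κ ^ (n + 2 + k) * (T ^ (n + k) * ρ ^ l)) := by
  obtain ⟨K₁, hK₁, h₁⟩ := exists_wkbDeriv_bound K n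
  choose K₂ hK₂ h₂ using exists_wkb_bound K
  set P := (Finset.range (n + 1) ×ˢ Finset.range (n + 1)).filter (fun p => n ≤ p.1 + p.2) with hP
  set K₃ : ℝ := ∑ p ∈ P, K₂ p.1 * K₂ p.2 * (((p.1 + 1 : ℕ) : ℝ) * ((p.2 + 1 : ℕ) : ℝ)) with hK₃
  have hK₃0 : 0 ≤ K₃ := Finset.sum_nonneg fun p _ => by
    have := hK₂ p.1; have := hK₂ p.2; positivity
  refine ⟨K₁ + K₃, by positivity, fun lam V D x κ ρ T hκ hρ hT hu => ?_⟩
  have hT0 : 0 ≤ T := (norm_nonneg _).trans hT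
  set S : ℝ := ∑ k ∈ Finset.range (n + 1), ∑ l ∈ Finset.Icc 2 (n + 2 + k),
        κ ^ (n + 2 + k) * (T ^ (n + k) * ρ ^ l) with hS
  have hS0 : 0 ≤ S := Finset.sum_nonneg fun k _ => Finset.sum_nonneg fun l _ => by positivity
  have hSk : ∀ k ≤ n, κ ^ (n + 2 + k) * (T ^ (n + k) * ∑ l ∈ Finset.Icc 2 (n + 2 + k), ρ ^ l) ≤ S := by
    intro k hk
    have h := Finset.single_le_sum (f := fun k => ∑ l ∈ Finset.Icc 2 (n + 2 + k),
        κ ^ (n + 2 + k) * (T ^ (n + k) * ρ ^ l)) (s := Finset.range (n + 1))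
        (fun k _ => Finset.sum_nonneg fun l _ => by positivity)
        (Finset.mem_range.2 (Nat.lt_succ_of_le hk))
    refine le_trans (le_of_eq ?_) h
    simp only [Finset.mul_sum]
  set Z : ℝ := κ ^ (n + 2) * (T ^ n * ρ) with hZ
  have hZ0 : 0 ≤ Z := by positivity
  have b1 : ‖wkbDeriv lam V D n x‖ ≤ K₁ * (Z + S) := by
    refine (h₁ lam V D x κ ρ T hκ hρ hT hu).trans (mul_le_mul_of_nonneg_left ?_ hK₁)
    rw [show Finset.Icc 1 (n + 2) = insert 1 (Finset.Icc 2 (n + 2)) by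
      ext l; simp only [Finset.mem_insert, Finset.mem_Icc]; omega,
      Finset.sum_insert (by simp)]
    have := hSk 0 (Nat.zero_le _)
    simp only [add_zero] at this
    calc _ = Z + κ ^ (n + 2) * (T ^ n * ∑ l ∈ Finset.Icc 2 (n + 2), ρ ^ l) := by rw [hZ]; ring
      _ ≤ Z + S := by gcongr
  have b2 : ∀ p ∈ P, ‖wkb lam V D p.1 x * wkb lam V D p.2 x‖ ≤
      K₂ p.1 * K₂ p.2 * (((p.1 + 1 : ℕ) : ℝ) * ((p.2 + 1 : ℕ) : ℝ)) * S := by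
    intro p hp
    simp only [hP, Finset.mem_filter, Finset.mem_product, Finset.mem_range] at hp
    have hp1 := hK₂ p.1
    have hp2 := hK₂ p.2
    have e1 := h₂ p.1 lam V D x κ ρ T hκ hρ hT fun m hm hm' => hu m hm (by omega)
    have e2 := h₂ p.2 lam V D x κ ρ T hκ hρ hT fun m hm hm' => hu m hm (by omega)
    have hs1 : 0 ≤ ∑ l ∈ Finset.Icc 1 (p.1 + 1), ρ ^ l := Finset.sum_nonneg fun _ _ => by positivity
    obtain ⟨k, hk⟩ : ∃ k, p.1 + p.2 = n + k := ⟨p.1 + p.2 - n, by omega⟩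
    rw [norm_mul]
    calc _ ≤ (K₂ p.1 * (T ^ p.1 * (κ ^ (p.1 + 1) * ∑ l ∈ Finset.Icc 1 (p.1 + 1), ρ ^ l))) *
          (K₂ p.2 * (T ^ p.2 * (κ ^ (p.2 + 1) * ∑ l ∈ Finset.Icc 1 (p.2 + 1), ρ ^ l))) :=
          mul_le_mul e1 e2 (norm_nonneg _) (by positivity)
      _ = K₂ p.1 * K₂ p.2 * (κ ^ (n + 2 + k) * (T ^ (n + k) *
          ((∑ l ∈ Finset.Icc 1 (p.1 + 1), ρ ^ l) * ∑ l ∈ Finset.Icc 1 (p.2 + 1), ρ ^ l))) := by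
          rw [← hk, show n + 2 + k = (p.1 + 1) + (p.2 + 1) by omega, pow_add, pow_add]; ring
      _ ≤ K₂ p.1 * K₂ p.2 * (κ ^ (n + 2 + k) * (T ^ (n + k) *
          ((((p.1 + 1 : ℕ) : ℝ) * ((p.2 + 1 : ℕ) : ℝ)) *
            ∑ l ∈ Finset.Icc 2 (p.1 + 1 + (p.2 + 1)), ρ ^ l))) := by
          refine mul_le_mul_of_nonneg_left ?_ (by positivity)
          refine mul_le_mul_of_nonneg_left ?_ (by positivity)
          refine mul_le_mul_of_nonneg_left ?_ (by positivity)
          exact sum_pow_mul_sum_pow_le hρ (p.1 + 1) (p.2 + 1)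
      _ = K₂ p.1 * K₂ p.2 * (((p.1 + 1 : ℕ) : ℝ) * ((p.2 + 1 : ℕ) : ℝ)) *
          (κ ^ (n + 2 + k) * (T ^ (n + k) * ∑ l ∈ Finset.Icc 2 (n + 2 + k), ρ ^ l)) := by
          rw [show p.1 + 1 + (p.2 + 1) = n + 2 + k by omega]; ring
      _ ≤ _ := by
          gcongr
          exact hSk k (by omega)
  rw [remainder]
  calc _ ≤ ‖wkbDeriv lam V D n x‖ + ‖∑ p ∈ P, wkb lam V D p.1 x * wkb lam V D p.2 x‖ :=
        norm_sub_le _ _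
    _ ≤ K₁ * (Z + S) + K₃ * S := by
        refine add_le_add b1 ((norm_sum_le _ _).trans ?_)
        rw [hK₃, Finset.sum_mul]
        exact Finset.sum_le_sum b2
    _ ≤ (K₁ + K₃) * (Z + S) := by
        have : 0 ≤ K₃ * Z := by positivity
        linarith

/-- As `ρ ≲ τ` and `τ ≥ 1`, the term of order `k` is at most a constant times `T^k (κ τ)^{k+1} = (κ
T τ)^k κ τ`. Boundedness of `κ T τ` then makes every order as small as the zeroth. -/
theorem exists_sum_wkb_bound (K : ℝ) (hK : 0 ≤ K) (n : ℕ) : ∃ K₁ ≥ 0, ∀ (lam : ℂ) (V : ℝ → ℂ)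
    (D : ℕ → ℝ → ℂ) (x κ ρ T τ : ℝ), 0 ≤ κ → 0 ≤ ρ → ‖(sqrtAt lam V x)⁻¹‖ ≤ T →
    (∀ m, 1 ≤ m → m ≤ n + 1 → ‖jetAt lam V D m x‖ ≤ K * (κ ^ m * ρ)) → 1 ≤ τ →
    ρ ≤ K * τ → κ * T * τ ≤ K →
    ‖∑ k ∈ Finset.range (n + 1), wkb lam V D k x‖ ≤ K₁ * (κ * τ) := by
  choose K₂ hK₂ h₂ using exists_wkb_bound K
  refine ⟨∑ k ∈ Finset.range (n + 1), K₂ k * (K ^ k * ((k + 1 : ℕ) * (K + 1) ^ (k + 1))),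
    Finset.sum_nonneg fun k _ => by have := hK₂ k; positivity,
    fun lam V D x κ ρ T τ hκ hρ hT hu hτ hρτ hTτ => ?_⟩
  have hT0 : 0 ≤ T := (norm_nonneg _).trans hT
  refine (norm_sum_le _ _).trans ?_
  rw [Finset.sum_mul]
  refine Finset.sum_le_sum fun k hk => ?_
  rw [Finset.mem_range] at hk
  have hk2 := hK₂ k
  refine (h₂ k lam V D x κ ρ T hκ hρ hT fun m hm hm' => hu m hm (by omega)).trans ?_
  have hsum : ∑ l ∈ Finset.Icc 1 (k + 1), ρ ^ l ≤ (k + 1 : ℕ) * ((K + 1) * τ) ^ (k + 1) := by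
    have hle : ∀ l ∈ Finset.Icc 1 (k + 1), ρ ^ l ≤ ((K + 1) * τ) ^ (k + 1) := by
      intro l hl
      rw [Finset.mem_Icc] at hl
      have h1 : ρ ≤ (K + 1) * τ := by linarith
      have h2 : 1 ≤ (K + 1) * τ := by nlinarith
      exact (pow_le_pow_left₀ hρ h1 l).trans (pow_le_pow_right₀ h2 hl.2)
    refine (Finset.sum_le_sum hle).trans ?_
    simp
  calc K₂ k * (T ^ k * (κ ^ (k + 1) * ∑ l ∈ Finset.Icc 1 (k + 1), ρ ^ l))
      ≤ K₂ k * (T ^ k * (κ ^ (k + 1) * ((k + 1 : ℕ) * ((K + 1) * τ) ^ (k + 1)))) := by gcongr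
    _ = K₂ k * ((κ * T * τ) ^ k * ((k + 1 : ℕ) * (K + 1) ^ (k + 1))) * (κ * τ) := by
        rw [mul_pow (K + 1), mul_pow, mul_pow, pow_succ κ, pow_succ τ]; ring
    _ ≤ K₂ k * (K ^ k * ((k + 1 : ℕ) * (K + 1) ^ (k + 1))) * (κ * τ) := by
        have : 0 ≤ κ * T * τ := by positivity
        gcongr

/-! ### Pointwise estimates of the jets and the square root -/

section Pointwise

variable {N : ℕ} {V : ℝ → ℂ} {D : ℕ → ℝ → ℂ} {K κ xb a b : ℝ}

theorem re_sub_eq (x : ℝ) : ((⟨a, b⟩ : ℂ) - V x).re = a - (V x).re := by simp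

theorem im_sub_eq (x : ℝ) : ((⟨a, b⟩ : ℂ) - V x).im = b - (V x).im := by simp

theorem norm_sqrtAt_sq (lam : ℂ) (x : ℝ) : ‖sqrtAt lam V x‖ ^ 2 = ‖lam - V x‖ := by
  rw [← norm_pow, sqrtAt_sq]

theorem norm_sqrtAt_inv_le {x : ℝ} (h : 0 < a - (V x).re) :
    ‖(sqrtAt ⟨a, b⟩ V x)⁻¹‖ ≤ (Real.sqrt (a - (V x).re))⁻¹ := by
  rw [norm_inv]
  refine inv_anti₀ (Real.sqrt_pos.2 h) (Real.sqrt_le_iff.2 ⟨norm_nonneg _, ?_⟩)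
  rw [norm_sqrtAt_sq, ← re_sub_eq (b := b)]
  exact Complex.re_le_norm _

theorem norm_jetAt_le {x : ℝ} (hA : 0 < a - (V x).re) {m : ℕ}
    (h : ‖D m x‖ ≤ K * (κ ^ m * (b + |(V x).re|))) :
    ‖jetAt ⟨a, b⟩ V D m x‖ ≤ K * (κ ^ m * ((b + |(V x).re|) / (a - (V x).re))) := by
  have h1 : a - (V x).re ≤ ‖(⟨a, b⟩ : ℂ) - V x‖ := by
    rw [← re_sub_eq (b := b)]
    exact Complex.re_le_norm _
  rw [jetAt, norm_div, ← mul_div_assoc, ← mul_div_assoc]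
  exact div_le_div₀ ((norm_nonneg _).trans h) h hA h1

/-- The imaginary part of the square root near the turning point. -/
theorem re_I_mul (s : ℂ) : (Complex.I * s).re = -s.im := by simp

theorem sqrtAt_re_pos (lam : ℂ) {x : ℝ} (h : 0 < (lam - V x).re) : 0 < (sqrtAt lam V x).re := by
  have hne : lam - V x ≠ 0 := fun h0 => by rw [h0] at h; simp at h
  have harg : |(lam - V x).arg| < Real.pi / 2 := Complex.abs_arg_lt_pi_div_two_iff.2 (Or.inl h)
  rw [sqrtAt, Complex.cpow_def_of_ne_zero hne, Complex.exp_re]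
  refine mul_pos (Real.exp_pos _) (Real.cos_pos_of_mem_Ioo ?_)
  have : (Complex.log (lam - V x) * (1 / 2)).im = (lam - V x).arg / 2 := by
    rw [show (1 / 2 : ℂ) = ((1 / 2 : ℝ) : ℂ) by push_cast; ring, Complex.im_mul_ofReal,
      Complex.log_im]
    ring
  rw [this]
  rw [abs_lt] at harg
  constructor <;> linarith [harg.1, harg.2, Real.pi_pos]

theorem sqrtAt_re_im (x : ℝ) :
    2 * ((sqrtAt ⟨a, b⟩ V x).re * (sqrtAt ⟨a, b⟩ V x).im) = b - (V x).im := by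
  have h := congrArg Complex.im (sqrtAt_sq (lam := ⟨a, b⟩) (V := V) x)
  rw [im_sub_eq, sq, Complex.mul_im] at h
  linarith

theorem sqrtAt_re_sq (x : ℝ) :
    (sqrtAt ⟨a, b⟩ V x).re ^ 2 = a - (V x).re + (sqrtAt ⟨a, b⟩ V x).im ^ 2 := by
  have h := congrArg Complex.re (sqrtAt_sq (lam := ⟨a, b⟩) (V := V) x)
  rw [re_sub_eq, sq, Complex.mul_re] at h
  linarith

end Pointwise

/-! ### The phase near the turning point -/

/-- The size of the exponent of the pseudomode at the ends of `J_b`, up to constants. -/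
noncomputable def decay (κ A b : ℝ) : ℝ := b / (κ * Real.sqrt (A + b))

section Phase

variable {N : ℕ} {V : ℝ → ℂ} {D : ℕ → ℝ → ℂ} {K κ xb a b : ℝ}

theorem decay_pos {A : ℝ} (hκ : 0 < κ) (hA : 0 < A) (hb : 0 < b) : 0 < decay κ A b := by
  unfold decay; positivity

theorem kappa_mul_decay {A : ℝ} (hκ : 0 < κ) :
    κ * decay κ A b = b / Real.sqrt (A + b) := by
  unfold decay
  rw [mul_div_assoc', mul_comm κ b, mul_comm κ, mul_div_mul_right _ _ hκ.ne']

theorem kappa_mul_decay_sq {A : ℝ} (hκ : 0 < κ) (hA : 0 < A) (hb : 0 < b) :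
    (κ * decay κ A b) ^ 2 * (A + b) = b ^ 2 := by
  rw [kappa_mul_decay hκ, div_pow, Real.sq_sqrt (by positivity)]
  field_simp

theorem LocalBound.xb_mem (_h : LocalBound N V D K κ xb a b) : κ * |xb - xb| < 1 / 2 := by simp

/-- Multiply `κ⁴ ≤ (K b)²` by `b² κ² ≤ K A³` and cancel `b²`. -/
theorem LocalBound.kappa_sq_le_mul (h : LocalBound N V D K κ xb a b) {x : ℝ}
    (hx : κ * |x - xb| < 1 / 2) : κ ^ 2 ≤ K * (a - (V x).re) := by
  have hK := h.one_le_const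
  have hA := h.pos x hx
  have hκ := h.kappa_pos
  have hb := h.one_le
  have h1 := h.cube_lower x hx
  have h2 := h.kappa_sq_le
  have h3 : (κ ^ 2) ^ 3 ≤ (K * (a - (V x).re)) ^ 3 := by
    have e : (κ ^ 2) ^ 3 * b ^ 2 = (κ ^ 2) ^ 2 * (b ^ 2 * κ ^ 2) := by ring
    have h4 : (κ ^ 2) ^ 3 * b ^ 2 ≤ (K * (a - (V x).re)) ^ 3 * b ^ 2 := by
      rw [e]
      calc (κ ^ 2) ^ 2 * (b ^ 2 * κ ^ 2) ≤ (K * b) ^ 2 * (K * (a - (V x).re) ^ 3) := by gcongr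
        _ = (K * (a - (V x).re)) ^ 3 * b ^ 2 := by ring
    exact le_of_mul_le_mul_right h4 (by positivity)
  exact (pow_le_pow_iff_left₀ (by positivity) (by positivity) (by norm_num)).1 h3

/-- This is the condition `κ T τ = O(1)` with `T = A^{-1/2}` and `τ = 1 + b / A`. After squaring it
reduces to `κ² ≲ A` and `κ² b² ≲ A³`. -/
theorem LocalBound.ratio_le (h : LocalBound N V D K κ xb a b) {x : ℝ}
    (hx : κ * |x - xb| < 1 / 2) :
    κ * (Real.sqrt (a - (V x).re))⁻¹ * (1 + b / (a - (V x).re)) ≤ 2 * K := by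
  have hK := h.one_le_const
  have hA := h.pos x hx
  have hκ := h.kappa_pos
  have hb := h.one_le
  have h1 := h.cube_lower x hx
  have h2 := h.kappa_sq_le_mul hx
  set A := a - (V x).re
  have h3 : κ ^ 2 / A ≤ K := by rwa [div_le_iff₀ hA]
  have h4 : κ ^ 2 / A * (b / A) ^ 2 ≤ K := by
    rw [div_pow, div_mul_div_comm, div_le_iff₀ (by positivity)]
    calc κ ^ 2 * b ^ 2 = b ^ 2 * κ ^ 2 := by ring
      _ ≤ K * A ^ 3 := h1
      _ = _ := by ring
  refine le_of_sq_le_sq ?_ (by positivity)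
  have e : (κ * (Real.sqrt A)⁻¹ * (1 + b / A)) ^ 2 = κ ^ 2 / A * (1 + b / A) ^ 2 := by
    rw [mul_pow, mul_pow, inv_pow, Real.sq_sqrt hA.le]; ring
  rw [e]
  have h5 : (1 + b / A) ^ 2 ≤ 2 + 2 * (b / A) ^ 2 := by nlinarith [sq_nonneg (1 - b / A)]
  have h6 : 0 ≤ κ ^ 2 / A := by positivity
  calc κ ^ 2 / A * (1 + b / A) ^ 2 ≤ κ ^ 2 / A * (2 + 2 * (b / A) ^ 2) := by gcongr
    _ ≤ 4 * K := by linarith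
    _ ≤ (2 * K) ^ 2 := by nlinarith

theorem exists_sum_wkb_le (N : ℕ) (hN : 1 < N) (K : ℝ) : ∃ K₂ ≥ 0, ∀ (V : ℝ → ℂ)
    (D : ℕ → ℝ → ℂ) (κ xb a b : ℝ), LocalBound N V D K κ xb a b → ∀ x, κ * |x - xb| < 1 / 2 →
    ‖∑ k ∈ Finset.range (N - 2 + 1), wkb ⟨a, b⟩ V D k x‖ ≤
      K₂ * (κ * (1 + b / (a - (V x).re))) := by
  -- For `K < 1` the claim is vacuous, because `LocalBound` includes `1 ≤ K`.
  by_cases hK : 1 ≤ K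
  swap
  · exact ⟨0, le_rfl, fun V D κ xb a b h => absurd h.one_le_const hK⟩
  obtain ⟨K₂, hK₂, h2⟩ := exists_sum_wkb_bound (2 * K) (by linarith) (N - 2)
  refine ⟨K₂, hK₂, fun V D κ xb a b h x hx => ?_⟩
  have hA := h.pos x hx
  have hb := h.one_le
  refine h2 ⟨a, b⟩ V D x κ ((b + |(V x).re|) / (a - (V x).re)) _ _ h.kappa_pos.le (by positivity)
    (norm_sqrtAt_inv_le hA) (fun m hm hm' => ?_) ?_ ?_ (h.ratio_le hx)
  · refine (norm_jetAt_le hA (h.deriv_le m hm (by omega) x hx)).trans ?_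
    have := h.kappa_pos
    gcongr
    linarith
  · have : 0 ≤ b / (a - (V x).re) := by positivity
    linarith
  · rw [div_le_iff₀ hA]
    have h1 := h.abs_re_le x hx
    have e : 2 * K * (1 + b / (a - (V x).re)) * (a - (V x).re) =
        2 * K * (a - (V x).re) + 2 * K * b := by field_simp
    rw [e]
    nlinarith

theorem LocalBound.norm_sqrtAt_le (h : LocalBound N V D K κ xb a b) {x : ℝ}
    (hx : κ * |x - xb| < 1 / 2) :
    ‖sqrtAt ⟨a, b⟩ V x‖ ≤ K * Real.sqrt (a - (V xb).re + b) := by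
  have hK := h.one_le_const
  have hA := h.pos x hx
  have hb := h.one_le
  have hB := h.pos xb h.xb_mem
  refine le_of_sq_le_sq ?_ (by positivity)
  rw [norm_sqrtAt_sq, mul_pow, Real.sq_sqrt (by positivity)]
  have h1 := Complex.norm_le_abs_re_add_abs_im ((⟨a, b⟩ : ℂ) - V x)
  rw [re_sub_eq, im_sub_eq, abs_of_pos hA, abs_sub_comm] at h1
  have h2 := h.im_upper x hx
  have h3 := h.comparable x xb hx h.xb_mem
  have h4 : K * (b * (κ * |x - xb|)) ≤ K * (b * (1 / 2)) := by gcongr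
  nlinarith

/-- For the square root `s`, `Re(is) = -Im s` and `2 Re s (-Im s) = Im V - b`. The right side grows
at least like `κ b (x - x_b)`, and `Re s` is at most a constant times `(A + b)^{1/2}` with `A` taken
at `x_b`. -/
theorem LocalBound.lower_re_I_sqrtAt (h : LocalBound N V D K κ xb a b) {x : ℝ}
    (hx : κ * |x - xb| < 1 / 2) :
    κ * (κ * decay κ (a - (V xb).re) b) * (x - xb) ^ 2 / (2 * K ^ 2) ≤
      (x - xb) * (Complex.I * sqrtAt ⟨a, b⟩ V x).re := by
  have hK := h.one_le_const
  have hA := h.pos x hx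
  have hb := h.one_le
  have hB := h.pos xb h.xb_mem
  have hκ := h.kappa_pos
  have hre : 0 < (sqrtAt ⟨a, b⟩ V x).re := sqrtAt_re_pos _ (by rwa [re_sub_eq])
  have h1 := h.im_lower x hx
  have h2 := sqrtAt_re_im (a := a) (b := b) (V := V) x
  have h3 := h.norm_sqrtAt_le hx
  have h4 := (Complex.re_le_norm (sqrtAt ⟨a, b⟩ V x)).trans h3
  rw [re_I_mul, kappa_mul_decay hκ]
  set s := sqrtAt ⟨a, b⟩ V x
  set B := Real.sqrt (a - (V xb).re + b)
  have hBp : 0 < B := Real.sqrt_pos.2 (by linarith)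
  have h5 : κ * b * (x - xb) ^ 2 ≤ K * (2 * (K * B)) * ((x - xb) * -s.im) := by
    have e : (V x).im - b = 2 * s.re * (-s.im) := by linarith
    rw [e] at h1
    have hnn : 0 ≤ (x - xb) * -s.im := by
      have h0 : 0 ≤ K * (2 * s.re * -s.im * (x - xb)) := le_trans (by positivity) h1
      have h0' : 0 ≤ (K * (2 * s.re)) * ((x - xb) * -s.im) := by linarith
      exact nonneg_of_mul_nonneg_right h0' (by positivity)
    calc κ * b * (x - xb) ^ 2 ≤ K * (2 * s.re) * ((x - xb) * -s.im) := by linarith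
      _ ≤ _ := by gcongr
  rw [div_le_iff₀ (by positivity), mul_div_assoc', div_mul_eq_mul_div, div_le_iff₀ hBp]
  linarith

/-- The product `Re s |Im s|` is at most a multiple of `b`. If `b ≤ A`, divide by `Re s ≥ A^{1/2}`;
if `A < b`, then either `|Im s| ≤ Re s` follows from the real part of `s²`, so `|Im s|² ≲ b`. Both
bounds match `b² / (A + b)`. -/
theorem LocalBound.abs_re_I_sqrtAt_le (h : LocalBound N V D K κ xb a b) {x : ℝ}
    (hx : κ * |x - xb| < 1 / 2) :
    |(Complex.I * sqrtAt ⟨a, b⟩ V x).re| ≤ 2 * K ^ 2 * (κ * decay κ (a - (V xb).re) b) := by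
  have hK := h.one_le_const
  have hA := h.pos x hx
  have hb := h.one_le
  have hB := h.pos xb h.xb_mem
  have hκ := h.kappa_pos
  have hre : 0 < (sqrtAt ⟨a, b⟩ V x).re := sqrtAt_re_pos _ (by rwa [re_sub_eq])
  have h1 := h.im_upper x hx
  have h2 := sqrtAt_re_im (a := a) (b := b) (V := V) x
  have h3 := sqrtAt_re_sq (a := a) (b := b) (V := V) x
  have h4 := h.comparable xb x h.xb_mem hx
  have h5 := kappa_mul_decay_sq (b := b) hκ hB (by linarith)
  have hd := decay_pos (b := b) hκ hB (by linarith)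
  rw [re_I_mul, abs_neg]
  set s := sqrtAt ⟨a, b⟩ V x
  set A := a - (V x).re
  set B := a - (V xb).re + b with hBdef
  set E := κ * decay κ (a - (V xb).re) b
  have hE : 0 < E := by positivity
  have hBp : 0 < B := by linarith
  have hq : s.re * |s.im| ≤ K * b / 4 := by
    have : 2 * (s.re * |s.im|) = |(V x).im - b| := by
      rw [abs_sub_comm, ← h2, abs_mul, abs_mul, abs_of_pos hre, abs_of_pos (by norm_num : (0:ℝ) < 2)]
    have h6 : K * (b * (κ * |x - xb|)) ≤ K * (b * (1 / 2)) := by gcongr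
    linarith
  have hkey : s.im ^ 2 * B ≤ 2 * K ^ 3 * b ^ 2 := by
    rcases le_or_gt b A with hbA | hbA
    · have h6 : s.im ^ 2 * A ≤ (K * b / 4) ^ 2 := by
        calc s.im ^ 2 * A ≤ s.im ^ 2 * s.re ^ 2 := by
              gcongr
              nlinarith [sq_nonneg s.im]
          _ = (s.re * |s.im|) ^ 2 := by rw [mul_pow, sq_abs]; ring
          _ ≤ _ := by gcongr
      calc s.im ^ 2 * B ≤ s.im ^ 2 * (K * (2 * A)) := by
            gcongr
            exact h4.trans (by gcongr; linarith)
        _ = 2 * K * (s.im ^ 2 * A) := by ring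
        _ ≤ 2 * K * (K * b / 4) ^ 2 := by gcongr
        _ ≤ 2 * K ^ 3 * b ^ 2 := by
            have : 0 ≤ K ^ 3 * b ^ 2 := by positivity
            nlinarith
    · have h6 : s.im ^ 2 ≤ K * b / 4 := by
        have : |s.im| ≤ s.re := by
          refine abs_le_of_sq_le_sq ?_ hre.le
          linarith
        calc s.im ^ 2 = |s.im| * |s.im| := by rw [← sq, sq_abs]
          _ ≤ s.re * |s.im| := by gcongr
          _ ≤ _ := hq
      calc s.im ^ 2 * B ≤ (K * b / 4) * (K * (2 * b)) := by
            gcongr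
            exact h4.trans (by gcongr; linarith)
        _ = K ^ 2 * b ^ 2 / 2 := by ring
        _ ≤ 2 * K ^ 3 * b ^ 2 := by
            have h7 : K ^ 2 ≤ K ^ 3 := pow_le_pow_right₀ hK (by norm_num)
            have h8 : 0 ≤ b ^ 2 := by positivity
            nlinarith
  have h6 : s.im ^ 2 ≤ 2 * K ^ 3 * E ^ 2 := by
    refine le_of_mul_le_mul_right ?_ hBp
    rw [mul_assoc, h5]
    exact hkey
  refine abs_le_of_sq_le_sq ?_ (by positivity)
  have h7 : K ^ 3 ≤ K ^ 4 := pow_le_pow_right₀ hK (by norm_num)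
  have h8 : 0 ≤ E ^ 2 := by positivity
  calc s.im ^ 2 ≤ 2 * K ^ 3 * E ^ 2 := h6
    _ ≤ 4 * K ^ 4 * E ^ 2 := by nlinarith [mul_nonneg (pow_nonneg (by linarith : (0:ℝ) ≤ K) 4) h8, mul_le_mul_of_nonneg_right h7 h8]
    _ = _ := by ring

/-- The lower-order terms have size `κ (1 + b / A)` and the main one `κ d`. If `b ≤ A`, it is enough
that `d` is large. If `A < b`, put `z = b / κ²`: then `(b / A)³ ≤ K z` and `z ≤ 2 K d²`, so `(b /
A)⁶ ≲ z² = z³ / z ≲ d⁶ / z`, and the largeness of `z` supplies the factor `η⁶`. -/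
theorem LocalBound.one_add_div_le (h : LocalBound N V D K κ xb a b) {η : ℝ} (hη : 0 < η)
    (h1 : 2 / η ≤ decay κ (a - (V xb).re) b) (h2 : 512 * K ^ 5 / η ^ 6 ≤ b / κ ^ 2) {x : ℝ}
    (hx : κ * |x - xb| < 1 / 2) :
    1 + b / (a - (V x).re) ≤ η * decay κ (a - (V xb).re) b := by
  have hK := h.one_le_const
  have hA := h.pos x hx
  have hb := h.one_le
  have hB := h.pos xb h.xb_mem
  have hκ := h.kappa_pos
  have h3 := h.cube_lower x hx
  have h4 := h.comparable xb x h.xb_mem hx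
  have h5 := kappa_mul_decay_sq (b := b) hκ hB (by linarith)
  have hd := decay_pos (b := b) hκ hB (by linarith)
  set A := a - (V x).re
  set d := decay κ (a - (V xb).re) b
  set B := a - (V xb).re + b with hBdef
  rcases le_or_gt b A with hbA | hbA
  · have h6 : b / A ≤ 1 := by rwa [div_le_one hA]
    have h7 : 2 ≤ η * d := by rwa [div_le_iff₀ hη, mul_comm] at h1
    linarith
  · have hBp : 0 < B := by linarith
    have h6 : 1 ≤ b / A := by rw [le_div_iff₀ hA]; linarith
    have hB2 : B ≤ 2 * K * b := by nlinarith
    set z := b / κ ^ 2 with hz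
    have hz0 : 0 < z := by positivity
    have h7 : (b / A) ^ 3 ≤ K * z := by
      rw [hz, div_pow, mul_div_assoc', div_le_div_iff₀ (by positivity) (by positivity)]
      calc b ^ 3 * κ ^ 2 = b * (b ^ 2 * κ ^ 2) := by ring
        _ ≤ b * (K * A ^ 3) := by gcongr
        _ = _ := by ring
    have h8 : z ≤ 2 * K * d ^ 2 := by
      rw [hz, div_le_iff₀ (by positivity)]
      have e : (κ * d) ^ 2 * (2 * K * b) ≥ b ^ 2 := by
        rw [← h5]; gcongr
      have e2 : b * b ≤ (2 * K * d ^ 2 * κ ^ 2) * b := by nlinarith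
      exact le_of_mul_le_mul_right e2 (by linarith)
    have h9 : 512 * K ^ 5 ≤ η ^ 6 * z := by
      rw [div_le_iff₀ (by positivity)] at h2
      linarith
    have h10 : (2 * (b / A)) ^ 6 ≤ (η * d) ^ 6 := by
      have e1 : (2 * (b / A)) ^ 6 ≤ 64 * (K * z) ^ 2 := by
        calc (2 * (b / A)) ^ 6 = 64 * ((b / A) ^ 3) ^ 2 := by ring
          _ ≤ _ := by gcongr
      have e2 : z ^ 3 ≤ (2 * K * d ^ 2) ^ 3 := by gcongr
      have e3 : (64 * (K * z) ^ 2) * (8 * K ^ 3) ≤ (η * d) ^ 6 * (8 * K ^ 3) := by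
        calc (64 * (K * z) ^ 2) * (8 * K ^ 3) = (512 * K ^ 5) * z ^ 2 := by ring
          _ ≤ (η ^ 6 * z) * z ^ 2 := by gcongr
          _ = η ^ 6 * z ^ 3 := by ring
          _ ≤ η ^ 6 * (2 * K * d ^ 2) ^ 3 := by gcongr
          _ = _ := by ring
      exact e1.trans (le_of_mul_le_mul_right e3 (by positivity))
    have h11 := (pow_le_pow_iff_left₀ (by positivity) (by positivity) (by norm_num)).1 h10
    linarith

theorem exists_phase_bound (N : ℕ) (hN : 1 < N) (K : ℝ) : ∃ Y > 0, ∀ (V : ℝ → ℂ)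
    (D : ℕ → ℝ → ℂ) (κ xb a b : ℝ), LocalBound N V D K κ xb a b → Y ≤ b / κ ^ 2 →
    Y ≤ decay κ (a - (V xb).re) b → ∀ x, κ * |x - xb| < 1 / 2 →
    κ * (κ * decay κ (a - (V xb).re) b) / (2 * K ^ 2) * (x - xb) ^ 2 -
        κ * decay κ (a - (V xb).re) b / (128 * K ^ 2) * |x - xb| ≤
      (x - xb) * (phase ⟨a, b⟩ V D (N - 2) x).re ∧
    |(phase ⟨a, b⟩ V D (N - 2) x).re| ≤ 4 * K ^ 2 * (κ * decay κ (a - (V xb).re) b) ∧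
    ‖phase ⟨a, b⟩ V D (N - 2) x‖ ≤ K * Real.sqrt (a - (V xb).re + b) +
      κ * decay κ (a - (V xb).re) b := by
  by_cases hK : 1 ≤ K
  swap
  · exact ⟨1, one_pos, fun V D κ xb a b h => absurd h.one_le_const hK⟩
  obtain ⟨K₂, hK₂, h2⟩ := exists_sum_wkb_le N hN K
  -- Chosen so that the terms with `k ≥ 0` add up to at most `κ d / (128 K²)`.
  set η : ℝ := 1 / (128 * K ^ 2 * (K₂ + 1)) with hη
  have hη0 : 0 < η := by positivity
  refine ⟨2 / η + 512 * K ^ 5 / η ^ 6, by positivity, fun V D κ xb a b h hz hd x hx => ?_⟩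
  have p1 : 0 < 2 / η := by positivity
  have p2 : 0 < 512 * K ^ 5 / η ^ 6 := by positivity
  have h3 := h.one_add_div_le hη0 (by linarith) (by linarith) hx
  have h4 := h2 V D κ xb a b h x hx
  have hκ := h.kappa_pos
  have hB := h.pos xb h.xb_mem
  have hb := h.one_le
  have h5 := h.lower_re_I_sqrtAt hx
  have h6 := h.abs_re_I_sqrtAt_le hx
  have h7 := h.norm_sqrtAt_le hx
  have hdp := decay_pos (b := b) hκ hB (by linarith)
  set d := decay κ (a - (V xb).re) b
  have h8 : ‖∑ k ∈ Finset.range (N - 2 + 1), wkb ⟨a, b⟩ V D k x‖ ≤ κ * d / (128 * K ^ 2) := by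
    refine h4.trans ?_
    calc K₂ * (κ * (1 + b / (a - (V x).re))) ≤ (K₂ + 1) * (κ * (η * d)) := by
          have hA := h.pos x hx
          have : 0 ≤ κ * (1 + b / (a - (V x).re)) := by positivity
          have h9 : κ * (1 + b / (a - (V x).re)) ≤ κ * (η * d) := by gcongr
          have h10 : 0 ≤ κ * (η * d) := by positivity
          nlinarith
      _ = _ := by rw [hη]; field_simp
  rw [phase]
  set W := ∑ k ∈ Finset.range (N - 2 + 1), wkb ⟨a, b⟩ V D k x
  have h9 := (Complex.abs_re_le_norm W).trans h8
  have hE : 0 < κ * d := by positivity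
  have hle1 : κ * d / (128 * K ^ 2) ≤ κ * d := by
    rw [div_le_iff₀ (by positivity)]
    nlinarith [mul_pos hE hE, sq_nonneg (K - 1)]
  refine ⟨?_, ?_, ?_⟩
  · rw [Complex.add_re, mul_add]
    have h10 : -(κ * d / (128 * K ^ 2) * |x - xb|) ≤ (x - xb) * W.re := by
      have := neg_abs_le ((x - xb) * W.re)
      rw [abs_mul] at this
      have h11 : |x - xb| * |W.re| ≤ |x - xb| * (κ * d / (128 * K ^ 2)) := by gcongr
      linarith
    have e : κ * (κ * d) / (2 * K ^ 2) * (x - xb) ^ 2 =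
      κ * (κ * d) * (x - xb) ^ 2 / (2 * K ^ 2) := by ring
    rw [e]
    linarith
  · rw [Complex.add_re]
    refine (abs_add_le _ _).trans ?_
    have h10 : 1 ≤ K ^ 2 := one_le_pow₀ hK
    have h11 : κ * d ≤ K ^ 2 * (κ * d) := le_mul_of_one_le_left hE.le h10
    linarith
  · refine (norm_add_le _ _).trans ?_
    rw [norm_mul, Complex.norm_I, one_mul]
    linarith

end Phase

/-! ### Decay of the pseudomode away from the turning point -/

section Decay

variable {N : ℕ} {ν : ℝ} {V : ℝ → ℂ} {D : ℕ → ℝ → ℂ} {K κ xb a b : ℝ}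

/-- Integrate the bound on `p'` from `x₀`: to the right as it stands, to the left after dividing by
the negative `x - x₀`. The linear correction makes the comparison function monotone on each side. -/
theorem le_of_quadratic_le_mul_deriv {p p' : ℝ → ℝ} {I : Set ℝ} (hI : OrdConnected I) {x₀ α β : ℝ}
    (h₀ : x₀ ∈ I) (hp₀ : p x₀ = 0) (hd : ∀ x ∈ I, HasDerivAt p (p' x) x)
    (h : ∀ x ∈ I, α * (x - x₀) ^ 2 - β * |x - x₀| ≤ (x - x₀) * p' x) {x : ℝ} (hx : x ∈ I) :
    α / 2 * (x - x₀) ^ 2 - β * |x - x₀| ≤ p x := by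
  have hder : ∀ s : ℝ, ∀ y ∈ I, HasDerivAt
      (fun y => p y - α / 2 * (y - x₀) ^ 2 + s * (y - x₀)) (p' y - α * (y - x₀) + s) y := by
    intro s y hy
    have h1 := ((hd y hy).sub ((((hasDerivAt_id y).sub_const x₀).pow 2).const_mul (α / 2))).add
      (((hasDerivAt_id y).sub_const x₀).const_mul s)
    refine h1.congr_deriv ?_
    simp only [id, Nat.cast_ofNat]
    ring
  rcases le_total x₀ x with hle | hle
  · have hsub : Icc x₀ x ⊆ I := hI.out h₀ hx
    have hmono : MonotoneOn (fun y => p y - α / 2 * (y - x₀) ^ 2 + β * (y - x₀)) (Icc x₀ x) := by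
      refine monotoneOn_of_deriv_nonneg (convex_Icc _ _)
        (fun y hy => (hder β y (hsub hy)).continuousAt.continuousWithinAt)
        (fun y hy => (hder β y (hsub (interior_subset hy))).differentiableAt.differentiableWithinAt)
        fun y hy => ?_
      rw [(hder β y (hsub (interior_subset hy))).deriv]
      rw [interior_Icc] at hy
      have h1 := h y (hsub ⟨hy.1.le, hy.2.le⟩)
      have h2 : 0 < y - x₀ := by linarith [hy.1]
      rw [abs_of_pos h2] at h1
      refine nonneg_of_mul_nonneg_right (b := p' y - α * (y - x₀) + β) ?_ h2
      linarith
    have h1 := hmono (left_mem_Icc.2 hle) (right_mem_Icc.2 hle) hle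
    simp only [hp₀, sub_self] at h1
    rw [abs_of_nonneg (by linarith)]
    linarith
  · have hsub : Icc x x₀ ⊆ I := hI.out hx h₀
    have hanti : AntitoneOn (fun y => p y - α / 2 * (y - x₀) ^ 2 + -β * (y - x₀)) (Icc x x₀) := by
      refine antitoneOn_of_deriv_nonpos (convex_Icc _ _)
        (fun y hy => (hder (-β) y (hsub hy)).continuousAt.continuousWithinAt)
        (fun y hy => (hder (-β) y
          (hsub (interior_subset hy))).differentiableAt.differentiableWithinAt)
        fun y hy => ?_
      rw [(hder (-β) y (hsub (interior_subset hy))).deriv]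
      rw [interior_Icc] at hy
      have h1 := h y (hsub ⟨hy.1.le, hy.2.le⟩)
      have h2 : 0 < x₀ - y := by linarith [hy.2]
      rw [abs_of_neg (by linarith)] at h1
      by_contra! h3
      have := mul_pos h2 h3
      linarith
    have h1 := hanti (left_mem_Icc.2 hle) (right_mem_Icc.2 hle) hle
    simp only [hp₀, sub_self] at h1
    rw [abs_of_nonpos (by linarith)]
    linarith

theorem hasDerivAt_neg_log_norm {G : ℝ → ℂ} {w : ℂ} {x : ℝ} (h : HasDerivAt G (-(w * G x)) x)
    (h0 : G x ≠ 0) : HasDerivAt (fun x => -Real.log ‖G x‖) w.re x := by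
  have h1 := (h.norm_sq.log (by positivity)).const_mul (-(1 / 2 : ℝ))
  have h2 : ‖G x‖ ^ 2 ≠ 0 := by positivity
  have e : inner ℝ (G x) (-(w * G x)) = -(w.re * ‖G x‖ ^ 2) := by
    rw [Complex.inner, ← Complex.normSq_eq_norm_sq, Complex.normSq_apply]
    simp
    ring
  refine (h1.congr_deriv ?_).congr_of_eventuallyEq (Eventually.of_forall fun y => ?_)
  · rw [e]
    field_simp
  · simp only [Real.log_pow]
    push_cast
    ring

/-- `-log |G|` vanishes at `x₀` and has derivative `Re Φ`; the upper bound on `|G|` integrates the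
quadratic lower bound, the lower bound integrates `|Re Φ| ≤ M`. -/
theorem norm_le_exp_and_exp_le_norm {G Φ : ℝ → ℂ} {I : Set ℝ} (hI : OrdConnected I)
    {x₀ α β M : ℝ} (h₀ : x₀ ∈ I) (hG₀ : G x₀ = 1) (hG : ∀ x ∈ I, G x ≠ 0)
    (hd : ∀ x ∈ I, HasDerivAt G (-(Φ x * G x)) x)
    (h : ∀ x ∈ I, α * (x - x₀) ^ 2 - β * |x - x₀| ≤ (x - x₀) * (Φ x).re)
    (hM : ∀ x ∈ I, |(Φ x).re| ≤ M) {x : ℝ} (hx : x ∈ I) :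
    ‖G x‖ ≤ Real.exp (-(α / 2 * (x - x₀) ^ 2 - β * |x - x₀|)) ∧
      Real.exp (-(M * |x - x₀|)) ≤ ‖G x‖ := by
  have hd' : ∀ x ∈ I, HasDerivAt (fun x => -Real.log ‖G x‖) (Φ x).re x := fun x hx =>
    hasDerivAt_neg_log_norm (hd x hx) (hG x hx)
  have hp₀ : -Real.log ‖G x₀‖ = 0 := by simp [hG₀]
  have h1 := le_of_quadratic_le_mul_deriv hI h₀ hp₀ hd' h hx
  have h2 := hI.convex.norm_image_sub_le_of_norm_hasDerivWithin_le
    (fun x hx => (hd' x hx).hasDerivWithinAt) hM h₀ hx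
  simp only [hp₀, sub_zero, Real.norm_eq_abs] at h2
  have hpos : 0 < ‖G x‖ := norm_pos_iff.2 (hG x hx)
  constructor
  · rw [← Real.log_le_iff_le_exp hpos]
    linarith
  · rw [← Real.le_log_iff_exp_le hpos]
    linarith [le_abs_self (-Real.log ‖G x‖)]

theorem delta_eq {xb : ℝ} (hxb : 0 < xb) : delta ν xb = 1 / (2 * xb ^ ν) := by
  rw [delta, Real.rpow_neg hxb.le]; field_simp

theorem Delta_eq {xb : ℝ} (hxb : 0 < xb) : Delta ν xb = 1 / (8 * xb ^ ν) := by
  rw [Delta, delta_eq hxb]; field_simp; norm_num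

theorem mem_J'_iff {x : ℝ} (hxb : 0 < xb) : x ∈ J' ν xb ↔ xb ^ ν * |x - xb| < 3 / 8 := by
  have hκ : 0 < xb ^ ν := by positivity
  have e : delta ν xb - Delta ν xb = 3 / (8 * xb ^ ν) := by
    rw [delta_eq hxb, Delta_eq hxb]; field_simp; norm_num
  have : J' ν xb = Ioo (xb - 3 / (8 * xb ^ ν)) (xb + 3 / (8 * xb ^ ν)) := by
    rw [J', ← e]; congr 1 <;> ring
  rw [this, mem_Ioo, ← sub_lt_iff_lt_add', sub_lt_comm, ← abs_sub_lt_iff, abs_sub_comm,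
    lt_div_iff₀ (by positivity)]
  constructor <;> intro h <;> nlinarith

theorem IsCutoff.abs_deriv_le {M : ℝ} {ξ : ℝ → ℝ} (h : IsCutoff M ν xb ξ) (hxb : 0 < xb) (x : ℝ) :
    |deriv ξ x| ≤ 8 * M * xb ^ ν := by
  have := h.deriv_le 1 (by simp) x
  rw [iteratedDeriv_one, Delta_eq hxb, pow_one, one_div, inv_inv] at this
  linarith

theorem IsCutoff.abs_deriv_deriv_le {M : ℝ} {ξ : ℝ → ℝ} (h : IsCutoff M ν xb ξ) (hxb : 0 < xb)
    (x : ℝ) : |deriv (deriv ξ) x| ≤ 64 * M * (xb ^ ν) ^ 2 := by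
  have := h.deriv_le 2 (by simp) x
  rw [iteratedDeriv_succ, iteratedDeriv_one, Delta_eq hxb, one_div, inv_pow, inv_inv] at this
  linarith

theorem IsCutoff.deriv_eq_zero {M : ℝ} {ξ : ℝ → ℝ} (h : IsCutoff M ν xb ξ) {x : ℝ}
    (hx : x ∈ J' ν xb) : deriv ξ x = 0 ∧ deriv (deriv ξ) x = 0 := by
  have h1 : ξ =ᶠ[𝓝 x] fun _ => 1 := by
    filter_upwards [isOpen_Ioo.mem_nhds hx] with y hy using h.eq_one y hy
  have h2 : deriv ξ =ᶠ[𝓝 x] fun _ => 0 := by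
    have := h1.deriv
    simpa using this
  exact ⟨h2.self_of_nhds, by rw [h2.deriv_eq]; simp⟩

/-- The cut-off errors are exponentially small relative to the pseudomode. -/
theorem exists_cutoff_bound (N : ℕ) (hN : 1 < N) (K M : ℝ) (hM : 0 < M) : ∃ Y > 0, ∃ K' > 0,
    ∀ (ν : ℝ) (V : ℝ → ℂ) (D : ℕ → ℝ → ℂ) (xb a b : ℝ) (ξ : ℝ → ℝ), IsJet N V D → 0 < xb →
    LocalBound N V D K (xb ^ ν) xb a b →
    (∀ x ∈ Icc (xb - delta ν xb) (xb + delta ν xb), 0 < a - (V x).re) → IsCutoff M ν xb ξ →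
    Y ≤ b / (xb ^ ν) ^ 2 → Y ≤ decay (xb ^ ν) (a - (V xb).re) b →
    Real.log (a - (V xb).re + b) ≤ decay (xb ^ ν) (a - (V xb).re) b / (256 * K ^ 2) →
    ∃ S L yl yr : ℝ, 0 ≤ S ∧ 0 < L ∧ 0 ≤ yl ∧ yl < yr ∧
      (∀ x ∈ Ioo (xb - delta ν xb) (xb + delta ν xb),
        ‖(2 * ((deriv ξ x : ℝ) : ℂ) * phase ⟨a, b⟩ V D (N - 2) x -
          ((deriv (deriv ξ) x : ℝ) : ℂ)) * g ⟨a, b⟩ V (N - 1) xb x‖ ≤ S) ∧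
      (∀ x ∈ Ioo yl yr, L ≤ ‖pseudomode ⟨a, b⟩ V (N - 1) xb ξ x‖) ∧
      S * Real.sqrt ((xb + delta ν xb) - (xb - delta ν xb)) / (L * Real.sqrt (yr - yl)) ≤
        K' * Real.exp (-(decay (xb ^ ν) (a - (V xb).re) b / (128 * K ^ 2))) := by
  by_cases hK : 1 ≤ K
  swap
  · exact ⟨1, one_pos, 1, one_pos, fun ν V D xb a b ξ _ _ h => absurd h.one_le_const hK⟩
  obtain ⟨Y, hY, hphase⟩ := exists_phase_bound N hN K
  -- With this `θ`, the bound `|Re Φ| ≤ 4 K² κ d` costs at most `4 K² θ d = d / (64 K²)` in the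
  -- exponent within distance `θ / κ` of `x_b`.
  obtain ⟨θ, hθ⟩ : ∃ θ : ℝ, θ = 1 / (256 * K ^ 4) := ⟨_, rfl⟩
  have hθ0 : 0 < θ := by rw [hθ]; positivity
  have hθ1 : θ < 3 / 8 := by
    rw [hθ, div_lt_iff₀ (by positivity)]
    have : 1 ≤ K ^ 4 := one_le_pow₀ hK
    linarith
  refine ⟨Y, hY, 80 * M * K ^ 2 * (256 * K ^ 2) / θ, by positivity,
    fun ν V D xb a b ξ hD hxb h hpos hξ hz hd hlog => ?_⟩
  have hph := hphase V D _ xb a b h hz hd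
  have hb := h.one_le
  have hB0 := h.pos xb h.xb_mem
  have hκ := h.kappa_pos
  have hxl := h.xb_pos
  have hκsq := h.kappa_sq_le_mul h.xb_mem
  have hdp := decay_pos (b := b) hκ hB0 (by linarith)
  have hJ : ∀ x, x ∈ Ioo (xb - delta ν xb) (xb + delta ν xb) ↔ xb ^ ν * |x - xb| < 1 / 2 :=
    fun x => mem_J_iff hxb
  have hJ' := fun x => mem_J'_iff (ν := ν) (x := x) hxb
  have hξ1 := hξ.abs_deriv_le hxb
  have hξ2 := hξ.abs_deriv_deriv_le hxb
  have hδ := delta_eq (ν := ν) hxb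
  generalize xb ^ ν = κ at h hz hd hlog hph hκ hxl hκsq hdp hJ hJ' hξ1 hξ2 hδ ⊢
  generalize decay κ (a - (V xb).re) b = d at hd hlog hph hdp ⊢
  obtain ⟨B, hBe⟩ : ∃ B : ℝ, a - (V xb).re + b = B := ⟨_, rfl⟩
  rw [hBe] at hlog hph
  have hB : 0 < B := by linarith
  have hxbJ : xb ∈ Ioo (xb - delta ν xb) (xb + delta ν xb) := by rw [hJ]; simp
  have hlam : (⟨a, b⟩ : ℂ) ≠ 0 := by
    intro h0
    have := congrArg Complex.im h0
    simp at this
    linarith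
  have hG := fun x (hx : x ∈ Ioo (xb - delta ν xb) (xb + delta ν xb)) =>
    norm_le_exp_and_exp_le_norm (G := g ⟨a, b⟩ V (N - 1) xb)
      (Φ := phase ⟨a, b⟩ V D (N - 2)) ordConnected_Ioo hxbJ (g_self _ _)
      (fun x _ => g_ne_zero _ _ _)
      (fun x hx => hD.hasDerivAt_g hN hlam
        (fun y hy => ⟨by rw [hδ] at hy; linarith [hy.1], by rw [re_sub_eq]; exact hpos y hy⟩) hxbJ hx)
      (fun x hx => (hph x ((hJ x).1 hx)).1) (fun x hx => (hph x ((hJ x).1 hx)).2.1) hx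
  have hK2 : 1 ≤ K ^ 2 := one_le_pow₀ hK
  refine ⟨(16 * M * κ * (K * √B + κ * d) + 64 * M * κ ^ 2) * Real.exp (-(d / (32 * K ^ 2))),
    Real.exp (-(d / (64 * K ^ 2))), xb - θ / κ, xb + θ / κ, by positivity, Real.exp_pos _, ?_, ?_,
    fun x hx => ?_, fun x hx => ?_, ?_⟩
  · have : θ / κ ≤ 1 / (2 * κ) := by
      rw [div_le_div_iff₀ hκ (by positivity)]
      nlinarith
    linarith
  · have : 0 < θ / κ := by positivity
    linarith
  · by_cases hx' : x ∈ J' ν xb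
    · obtain ⟨h1, h2⟩ := hξ.deriv_eq_zero hx'
      simp only [h1, h2, Complex.ofReal_zero, mul_zero, zero_mul, sub_zero, norm_zero]
      positivity
    rw [hJ', not_lt] at hx'
    rw [norm_mul]
    refine mul_le_mul ?_ ?_ (norm_nonneg _) (by positivity)
    · refine (norm_sub_le _ _).trans (add_le_add ?_ ?_)
      · rw [norm_mul, norm_mul, Complex.norm_ofNat, Complex.norm_real, Real.norm_eq_abs]
        calc 2 * |deriv ξ x| * ‖phase ⟨a, b⟩ V D (N - 2) x‖
            ≤ 2 * (8 * M * κ) * (K * √B + κ * d) := by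
              gcongr
              · exact hξ1 x
              · exact (hph x ((hJ x).1 hx)).2.2
          _ = _ := by ring
      · rw [Complex.norm_real, Real.norm_eq_abs]
        exact hξ2 x
    · refine (hG x hx).1.trans (Real.exp_le_exp.2 (neg_le_neg ?_))
      have h1 := (hJ x).1 hx
      -- Where `ξ' ≠ 0` one has `s ≥ 3/8`, and there `64 s² - 2 s ≥ 8`: the exponent is at least `d
      -- / (32 K²)`, twice the loss allowed near `x_b`.
      obtain ⟨s, hs⟩ : ∃ s : ℝ, s = κ * |x - xb| := ⟨_, rfl⟩
      have e : κ * (κ * d) / (2 * K ^ 2) / 2 * (x - xb) ^ 2 - κ * d / (128 * K ^ 2) * |x - xb| =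
          (d / (256 * K ^ 2)) * (64 * s ^ 2 - 2 * s) := by
        rw [hs, mul_pow, sq_abs]; field_simp; ring
      have e2 : d / (32 * K ^ 2) = (d / (256 * K ^ 2)) * 8 := by field_simp; norm_num
      rw [e, e2]
      rw [← hs] at h1 hx'
      gcongr
      nlinarith
  · have hx1 : κ * |x - xb| < θ := by
      have : |x - xb| < θ / κ := by rw [abs_lt]; constructor <;> linarith [hx.1, hx.2]
      rwa [lt_div_iff₀ hκ, mul_comm] at this
    have hx2 : x ∈ Ioo (xb - delta ν xb) (xb + delta ν xb) := by rw [hJ]; linarith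
    have hx3 : x ∈ J' ν xb := by rw [hJ']; linarith
    rw [pseudomode, hξ.eq_one x hx3, Complex.ofReal_one, one_mul]
    refine le_trans (Real.exp_le_exp.2 (neg_le_neg ?_)) (hG x hx2).2
    calc 4 * K ^ 2 * (κ * d) * |x - xb| = 4 * K ^ 2 * d * (κ * |x - xb|) := by ring
      _ ≤ 4 * K ^ 2 * d * θ := by gcongr
      _ = d / (64 * K ^ 2) := by rw [hθ]; field_simp; norm_num
  · have hsq : √(xb + delta ν xb - (xb - delta ν xb)) ≤ 1 / θ * √(xb + θ / κ - (xb - θ / κ)) := by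
      have e1 : xb + delta ν xb - (xb - delta ν xb) = 1 / κ := by rw [hδ]; field_simp; ring
      have e2 : xb + θ / κ - (xb - θ / κ) = 2 * θ / κ := by ring
      rw [e1, e2]
      refine Real.sqrt_le_iff.2 ⟨by positivity, ?_⟩
      rw [mul_pow, Real.sq_sqrt (by positivity), div_pow, div_mul_div_comm,
        div_le_div_iff₀ hκ (by positivity)]
      have h1 := mul_pos hθ0 hκ
      nlinarith [mul_pos h1 (sub_pos.2 hθ1)]
    have hW : 0 < √(xb + θ / κ - (xb - θ / κ)) := by
      apply Real.sqrt_pos.2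
      have : 0 < θ / κ := by positivity
      linarith
    obtain ⟨W, hWe⟩ : ∃ W : ℝ, W = √(xb + θ / κ - (xb - θ / κ)) := ⟨_, rfl⟩
    rw [← hWe] at hsq hW ⊢
    -- In units of `q`, the cut-off region gains `8q` and the lower bound near `x_b` loses `4q`. The
    -- algebraic prefactor is `O(exp(2q))`, since `A + b` and `1 + d` are each `O(exp q)`;
    -- `exp(-2q)` remains.
    obtain ⟨q, hq⟩ : ∃ q : ℝ, q = d / (256 * K ^ 2) := ⟨_, rfl⟩
    have hq0 : 0 ≤ q := by rw [hq]; positivity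
    have hBq : B ≤ Real.exp q := by rwa [← Real.log_le_iff_le_exp hB, hq]
    have hdq : 1 + d ≤ 256 * K ^ 2 * Real.exp q := by
      have e : d = 256 * K ^ 2 * q := by rw [hq]; field_simp
      have h1 := Real.add_one_le_exp q
      have h2 : 256 * K ^ 2 * (q + 1) ≤ 256 * K ^ 2 * Real.exp q := by gcongr
      linarith
    have hκB : κ ^ 2 ≤ K * B := hκsq.trans (by gcongr; linarith)
    have hκB2 : κ * √B ≤ K * B := by
      have h1 : κ ≤ √(K * B) := Real.le_sqrt_of_sq_le hκB
      have h2 : √(K * B) ≤ K * √B := by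
        rw [Real.sqrt_mul (by linarith)]
        gcongr
        exact Real.sqrt_le_iff.2 ⟨by linarith, by nlinarith⟩
      calc κ * √B ≤ (K * √B) * √B := by gcongr; exact h1.trans h2
        _ = _ := by rw [mul_assoc, Real.mul_self_sqrt hB.le]
    have hbr : 16 * M * κ * (K * √B + κ * d) + 64 * M * κ ^ 2 ≤ 80 * M * K ^ 2 * (B * (1 + d)) := by
      calc 16 * M * κ * (K * √B + κ * d) + 64 * M * κ ^ 2
          = 16 * M * (K * (κ * √B) + κ ^ 2 * d) + 64 * M * κ ^ 2 := by ring
        _ ≤ 16 * M * (K * (K * B) + (K * B) * d) + 64 * M * (K * B) := by gcongr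
        _ ≤ 16 * M * (K * (K * B) + (K * (K * B)) * d) + 64 * M * (K * (K * B)) := by
            have : K * B ≤ K * (K * B) := le_mul_of_one_le_left (by positivity) hK
            gcongr
        _ ≤ 80 * M * K ^ 2 * (B * (1 + d)) := by
            have : 0 ≤ M * (K * (K * B)) * d := by positivity
            nlinarith
    have hbr2 : 16 * M * κ * (K * √B + κ * d) + 64 * M * κ ^ 2 ≤
        80 * M * K ^ 2 * (256 * K ^ 2) * Real.exp (2 * q) := by
      refine hbr.trans ?_
      calc 80 * M * K ^ 2 * (B * (1 + d))
          ≤ 80 * M * K ^ 2 * (Real.exp q * (256 * K ^ 2 * Real.exp q)) := by gcongr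
        _ = _ := by rw [two_mul, Real.exp_add]; ring
    rw [div_le_iff₀ (by positivity)]
    calc (16 * M * κ * (K * √B + κ * d) + 64 * M * κ ^ 2) * Real.exp (-(d / (32 * K ^ 2))) *
          √(xb + delta ν xb - (xb - delta ν xb))
        ≤ 80 * M * K ^ 2 * (256 * K ^ 2) * Real.exp (2 * q) * Real.exp (-(d / (32 * K ^ 2))) *
          (1 / θ * W) := by gcongr
      _ = 80 * M * K ^ 2 * (256 * K ^ 2) / θ *
          (Real.exp (2 * q) * Real.exp (-(d / (32 * K ^ 2)))) * W := by ring
      _ = 80 * M * K ^ 2 * (256 * K ^ 2) / θ *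
          (Real.exp (-(d / (128 * K ^ 2))) * Real.exp (-(d / (64 * K ^ 2)))) * W := by
          rw [← Real.exp_add, ← Real.exp_add]
          congr 3
          rw [hq]; field_simp; norm_num
      _ = _ := by ring

end Decay

/-! ### Asymptotics in the turning point -/

section Asymptotics

variable {N : ℕ} {ν ε : ℝ} {V : ℝ → ℂ} {D : ℕ → ℝ → ℂ} {X C c : ℝ}

theorem decay_sq {κ A b : ℝ} (hκ : 0 < κ) (hA : 0 < A) (hb : 0 < b) :
    decay κ A b ^ 2 = b ^ 2 / (κ ^ 2 * (A + b)) := by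
  rw [eq_div_iff (by positivity), ← kappa_mul_decay_sq hκ hA hb]; ring

/-- Either `b` is large, and then the decay rate has the order `x ^ (ν + 1 + 2 * ε)`, or `b` is
polynomially bounded in `x`. -/
theorem decay_lower_cases {x A b c₃ : ℝ} (hx : 1 ≤ x) (hC : 1 ≤ C) (hc₃ : 0 < c₃) (hb : 1 ≤ b)
    (hA : 0 < A) (hgrow : x ^ (4 * ν + 2 * ε + 2) ≤ C * b)
    (hA' : A ≤ c₃ * (b ^ 2 * x ^ (-4 * ν - 4 * ε - 2))) :
    (1 / (C * (c₃ + 1)) * x ^ (ν + 1 + 2 * ε) ≤ decay (x ^ ν) A b) ∨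
      (A ≤ (c₃ + 1) * x ^ (4 * ν + 4 * ε + 2) ∧
        1 / (C * (c₃ + 1)) * x ^ (ν + 1 + ε) ≤ decay (x ^ ν) A b) := by
  have hx0 : 0 < x := by linarith
  have hd := decay_pos (κ := x ^ ν) (A := A) (b := b) (by positivity) hA (by linarith)
  have hCc : 1 ≤ C * (c₃ + 1) := by nlinarith
  have hsq : (1 / (C * (c₃ + 1))) ^ 2 ≤ 1 / (C * (c₃ + 1)) := by
    have h1 : 1 / (C * (c₃ + 1)) ≤ 1 := by rw [div_le_one (by positivity)]; exact hCc
    have h2 : 0 < 1 / (C * (c₃ + 1)) := by positivity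
    nlinarith
  have hneg : x ^ (-4 * ν - 4 * ε - 2) = (x ^ (4 * ν + 4 * ε + 2))⁻¹ := by
    rw [← Real.rpow_neg hx0.le]; congr 1; ring
  have hp : 0 < x ^ (4 * ν + 4 * ε + 2) := by positivity
  rw [hneg] at hA'
  have hκ : (x ^ ν) ^ 2 = x ^ (2 * ν) := by
    rw [← Real.rpow_natCast, ← Real.rpow_mul hx0.le]; congr 1; push_cast; ring
  -- At this threshold the two contributions to the bound on `A + b`, namely `b` and `b² x ^ (-4ν -
  -- 4ε - 2)`, balance. Above it the window gives the full exponent `2ε` in `d`; below it `A + b ≲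
  -- b`, and the growth of `Im V` gives the exponent `ε`.
  rcases le_or_gt (x ^ (4 * ν + 4 * ε + 2)) b with h | h
  · left
    refine le_of_sq_le_sq ?_ hd.le
    rw [decay_sq (by positivity) hA (by linarith), mul_pow, hκ]
    have hB : A + b ≤ (c₃ + 1) * (b ^ 2 * (x ^ (4 * ν + 4 * ε + 2))⁻¹) := by
      have : b ≤ b ^ 2 * (x ^ (4 * ν + 4 * ε + 2))⁻¹ := by
        rw [← div_eq_mul_inv, le_div_iff₀ hp]; nlinarith
      linarith
    rw [le_div_iff₀ (by positivity)]
    have e : (x ^ (ν + 1 + 2 * ε)) ^ 2 * x ^ (2 * ν) = x ^ (4 * ν + 4 * ε + 2) := by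
      rw [← Real.rpow_natCast, ← Real.rpow_mul hx0.le, ← Real.rpow_add hx0]
      congr 1; push_cast; ring
    calc (1 / (C * (c₃ + 1))) ^ 2 * (x ^ (ν + 1 + 2 * ε)) ^ 2 * (x ^ (2 * ν) * (A + b))
        = (1 / (C * (c₃ + 1))) ^ 2 * ((x ^ (ν + 1 + 2 * ε)) ^ 2 * x ^ (2 * ν)) * (A + b) := by ring
      _ ≤ 1 / (C * (c₃ + 1)) * x ^ (4 * ν + 4 * ε + 2) *
          ((c₃ + 1) * (b ^ 2 * (x ^ (4 * ν + 4 * ε + 2))⁻¹)) := by rw [e]; gcongr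
      _ = b ^ 2 / C := by field_simp
      _ ≤ b ^ 2 := div_le_self (by positivity) hC
  · right
    have hA2 : A ≤ c₃ * b := by
      refine hA'.trans ?_
      gcongr
      rw [← div_eq_mul_inv, div_le_iff₀ hp]; nlinarith
    refine ⟨by nlinarith, ?_⟩
    refine le_of_sq_le_sq ?_ hd.le
    rw [decay_sq (by positivity) hA (by linarith), mul_pow, hκ]
    rw [le_div_iff₀ (by positivity)]
    have e : (x ^ (ν + 1 + ε)) ^ 2 * x ^ (2 * ν) = x ^ (4 * ν + 2 * ε + 2) := by
      rw [← Real.rpow_natCast, ← Real.rpow_mul hx0.le, ← Real.rpow_add hx0]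
      congr 1; push_cast; ring
    calc (1 / (C * (c₃ + 1))) ^ 2 * (x ^ (ν + 1 + ε)) ^ 2 * (x ^ (2 * ν) * (A + b))
        = (1 / (C * (c₃ + 1))) ^ 2 * ((x ^ (ν + 1 + ε)) ^ 2 * x ^ (2 * ν)) * (A + b) := by ring
      _ ≤ 1 / (C * (c₃ + 1)) * (C * b) * ((c₃ + 1) * b) := by
          rw [e]; gcongr; linarith
      _ = b ^ 2 := by field_simp

/-- `log (A + b)` is bounded by a constant plus `2 log b + 2 log x_b`, which is negligible against
`x_b ^ (ν + 1 + ε)` and hence against `d`. When `b` is only polynomially large, `exp(-c d)` beats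
every power of `x_b`, in particular the one bounding the first algebraic term of the rate from
below. -/
theorem TailBound.exists_decay_bound (h : TailBound N ν ε V D X C c) (hD : IsJet N V D)
    (hN : 1 < N) (hν : -1 ≤ ν) (hε : 0 < ε) {c₃ K : ℝ} (hc₃ : 0 < c₃) (hK : 1 ≤ K) (Y : ℝ) :
    ∃ c' > 0, ∃ K' > 0, ∃ X₁, ∀ xb a b, X ≤ xb → X₁ ≤ xb → (V xb).im = b → 0 < a - (V xb).re →
      a - (V xb).re ≤ c₃ * (b ^ 2 * xb ^ (-4 * ν - 4 * ε - 2)) →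
      Y ≤ b / (xb ^ ν) ^ 2 ∧ Y ≤ decay (xb ^ ν) (a - (V xb).re) b ∧
      Real.log (a - (V xb).re + b) ≤ decay (xb ^ ν) (a - (V xb).re) b / (256 * K ^ 2) ∧
      Real.exp (-(decay (xb ^ ν) (a - (V xb).re) b / (128 * K ^ 2))) ≤
        Real.exp (-c' * xb ^ (ν + 1 + 2 * ε)) +
          K' * (xb ^ ((N : ℝ) * ν) * (b / (a - (V xb).re) ^ ((N : ℝ) / 2))) := by
  have hC := h.one_le_const
  obtain ⟨c₅, hc₅⟩ : ∃ t : ℝ, t = 1 / (C * (c₃ + 1)) := ⟨_, rfl⟩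
  have hc₅0 : 0 < c₅ := by rw [hc₅]; positivity
  -- The power to beat: `A^{N/2}` accounts for the first summand, and `x ^ (N ν) ≥ x ^ (-N)` for the
  -- second.
  obtain ⟨P, hP⟩ : ∃ t : ℝ, t = |4 * ν + 4 * ε + 2| * (N / 2) + N := ⟨_, rfl⟩
  have hP0 : 0 ≤ P := by rw [hP]; positivity
  -- The `5` covers `log (c₃ + 1) + 2 log b + 2 log x`, each logarithm being at most `η x ^ (ν + 1 +
  -- ε)`; the `P` covers `P log x`.
  obtain ⟨η, hη⟩ : ∃ t : ℝ, t = c₅ / (256 * K ^ 2) / (P + 5) := ⟨_, rfl⟩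
  have hη0 : 0 < η := by rw [hη]; positivity
  obtain ⟨X₀, hX₀⟩ := h.log_im_isLittleO hD hN hν hε hη0
  have hlog : ∀ᶠ x : ℝ in atTop, Real.log x ≤ η * x ^ ε := by
    filter_upwards [(isLittleO_log_rpow_atTop hε).bound hη0, eventually_ge_atTop 1] with x hx hx1
    rw [Real.norm_eq_abs, Real.norm_eq_abs, abs_of_nonneg (Real.log_nonneg hx1),
      abs_of_nonneg (by positivity)] at hx
    exact hx
  have htend := tendsto_rpow_atTop hε
  have hall := hlog.and <| (htend.eventually_ge_atTop (Real.log (c₃ + 1) / η)).and <|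
    (htend.eventually_ge_atTop (C * Y)).and (htend.eventually_ge_atTop (Y / c₅))
  obtain ⟨X₁, hX₁⟩ := eventually_atTop.1 hall
  refine ⟨c₅ / (128 * K ^ 2), by positivity, (c₃ + 1) ^ ((N : ℝ) / 2), by positivity,
    max X₀ X₁, fun x a b hx hx' hb hA hA' => ?_⟩
  obtain ⟨h1, h2, h3, h4⟩ := hX₁ x ((le_max_right _ _).trans hx')
  have h5 := hX₀ x ((le_max_left _ _).trans hx')
  have hgrow := h.growth x hx
  have hb1 := h.im_pos x hx
  rw [hb] at h5 hgrow hb1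
  have hx1 : 1 ≤ x := h.one_le.trans hx
  have hx0 : 0 < x := by linarith
  have hcases := decay_lower_cases hx1 hC hc₃ hb1 hA hgrow hA'
  rw [← hc₅] at hcases
  generalize a - (V x).re = A at hA hA' hcases ⊢
  have hxε : x ^ ε ≤ x ^ (ν + 1 + ε) := Real.rpow_le_rpow_of_exponent_le hx1 (by linarith)
  have hxε0 : 0 < x ^ ε := by positivity
  have hd1 : c₅ * x ^ (ν + 1 + ε) ≤ decay (x ^ ν) A b := by
    rcases hcases with hc | hc
    · refine le_trans ?_ hc
      gcongr
      linarith
    · exact hc.2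
  have hd2 : c₅ * x ^ ε ≤ decay (x ^ ν) A b := le_trans (by gcongr) hd1
  have hηd : η * (P + 5) * x ^ (ν + 1 + ε) ≤ decay (x ^ ν) A b / (256 * K ^ 2) := by
    have e : η * (P + 5) = c₅ / (256 * K ^ 2) := by rw [hη]; field_simp
    rw [e, div_mul_eq_mul_div]
    gcongr
  refine ⟨?_, ?_, ?_, ?_⟩
  · rw [le_div_iff₀ (by positivity)]
    have hκ : (x ^ ν) ^ 2 = x ^ (2 * ν) := by
      rw [← Real.rpow_natCast, ← Real.rpow_mul hx0.le]; congr 1; push_cast; ring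
    have e : x ^ ε * x ^ (2 * ν) ≤ x ^ (4 * ν + 2 * ε + 2) := by
      rw [← Real.rpow_add hx0]
      exact Real.rpow_le_rpow_of_exponent_le hx1 (by linarith)
    have h6 : C * Y * x ^ (2 * ν) ≤ C * b := by
      refine le_trans ?_ (e.trans hgrow)
      gcongr
    rw [hκ]
    refine le_of_mul_le_mul_left ?_ (by linarith : 0 < C)
    linarith
  · refine le_trans ?_ hd2
    rwa [div_le_iff₀ hc₅0, mul_comm] at h4
  · have hB : A + b ≤ (c₃ + 1) * (b ^ 2 * x ^ 2) := by
      have h6 : x ^ (-4 * ν - 4 * ε - 2) ≤ x ^ 2 := by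
        rw [← Real.rpow_natCast]
        exact Real.rpow_le_rpow_of_exponent_le hx1 (by push_cast; linarith)
      have h7 : A ≤ c₃ * (b ^ 2 * x ^ 2) := hA'.trans (by gcongr)
      have h8 : b ≤ b ^ 2 * x ^ 2 := by
        have : 1 ≤ x ^ 2 := one_le_pow₀ hx1
        nlinarith
      linarith
    have h6 := Real.log_le_log (by linarith) hB
    rw [Real.log_mul (by positivity) (by positivity), Real.log_mul (by positivity) (by positivity),
      Real.log_pow, Real.log_pow] at h6
    push_cast at h6
    rw [div_le_iff₀ hη0, mul_comm] at h2
    refine le_trans ?_ hηd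
    have h7 : η * x ^ ε ≤ η * x ^ (ν + 1 + ε) := by gcongr
    have h8 : 0 ≤ η * P * x ^ (ν + 1 + ε) := by positivity
    linarith
  · rcases hcases with hc | ⟨hc, -⟩
    · have h6 : Real.exp (-(decay (x ^ ν) A b / (128 * K ^ 2))) ≤
          Real.exp (-(c₅ / (128 * K ^ 2)) * x ^ (ν + 1 + 2 * ε)) := by
        apply Real.exp_le_exp.2
        rw [neg_mul, neg_le_neg_iff, div_mul_eq_mul_div]
        gcongr
      have h7 : 0 ≤ (c₃ + 1) ^ ((N : ℝ) / 2) * (x ^ ((N : ℝ) * ν) * (b / A ^ ((N : ℝ) / 2))) := by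
        positivity
      linarith
    · have h6 : Real.exp (-(decay (x ^ ν) A b / (128 * K ^ 2))) ≤ x ^ (-P) := by
        rw [Real.rpow_def_of_pos hx0 (-P)]
        apply Real.exp_le_exp.2
        have e : decay (x ^ ν) A b / (128 * K ^ 2) = 2 * (decay (x ^ ν) A b / (256 * K ^ 2)) := by
          field_simp; ring
        rw [e, mul_neg, neg_le_neg_iff]
        have h8 : Real.log x * P ≤ η * x ^ (ν + 1 + ε) * P := by
          gcongr
          exact h1.trans (by gcongr)
        have h9 : 0 ≤ η * x ^ (ν + 1 + ε) := by positivity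
        have h10 : 0 ≤ η * x ^ (ν + 1 + ε) * P := by positivity
        linarith
      have h7 : x ^ (-P) ≤
          (c₃ + 1) ^ ((N : ℝ) / 2) * (x ^ ((N : ℝ) * ν) * (b / A ^ ((N : ℝ) / 2))) := by
        have h8 : A ^ ((N : ℝ) / 2) ≤
            (c₃ + 1) ^ ((N : ℝ) / 2) * x ^ (|4 * ν + 4 * ε + 2| * (N / 2)) := by
          rw [Real.rpow_mul hx0.le, ← Real.mul_rpow (by linarith) (by positivity)]
          refine Real.rpow_le_rpow hA.le (hc.trans ?_) (by positivity)
          gcongr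
          exact le_abs_self _
        have h9 : x ^ (-(N : ℝ)) ≤ x ^ ((N : ℝ) * ν) := by
          apply Real.rpow_le_rpow_of_exponent_le hx1
          have : (0 : ℝ) ≤ N := by positivity
          nlinarith
        have h10 : 0 < A ^ ((N : ℝ) / 2) := by positivity
        calc x ^ (-P) = x ^ (-(N : ℝ)) * (x ^ (|4 * ν + 4 * ε + 2| * (N / 2)))⁻¹ := by
              rw [← Real.rpow_neg hx0.le, ← Real.rpow_add hx0, hP]; congr 1; ring
          _ ≤ x ^ ((N : ℝ) * ν) * ((c₃ + 1) ^ ((N : ℝ) / 2) * (b / A ^ ((N : ℝ) / 2))) := by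
              gcongr
              rw [inv_le_iff_one_le_mul₀ (by positivity), mul_div_assoc', div_mul_eq_mul_div,
                le_div_iff₀ h10, one_mul]
              refine h8.trans ?_
              calc _ = (c₃ + 1) ^ ((N : ℝ) / 2) * 1 * x ^ (|4 * ν + 4 * ε + 2| * (N / 2)) := by ring
                _ ≤ _ := by gcongr
          _ = _ := by ring
      have h8 := Real.exp_pos (-(c₅ / (128 * K ^ 2)) * x ^ (ν + 1 + 2 * ε))
      linarith

end Asymptotics

/-! ### The remainder and the rate -/

/-- The algebraic part of the rate. -/
noncomputable def wkbRate (N : ℕ) (ν : ℝ) (V : ℝ → ℂ) (xb a b : ℝ) : ℝ :=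
  xb ^ ((N : ℝ) * ν) * (⨆ x : J ν xb, (b + |(V x).re|) / (a - (V x).re) ^ ((N : ℝ) / 2)) +
  ∑ k ∈ Finset.range (N - 1), ∑ l ∈ Finset.Icc 2 (N + k),
    xb ^ (((N : ℝ) + k) * ν) *
      (⨆ x : J ν xb, (b + |(V x).re|) ^ l / (a - (V x).re) ^ (((N : ℝ) - 2 + k) / 2 + l))

theorem rate_eq (N : ℕ) (ν ε c : ℝ) (V : ℝ → ℂ) (xb a b : ℝ) :
    rate N ν ε c V xb a b = Real.exp (-c * xb ^ (ν + 1 + 2 * ε)) + wkbRate N ν V xb a b := by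
  rw [rate, wkbRate, add_assoc]

section Rate

variable {N : ℕ} {ν : ℝ} {V : ℝ → ℂ} {D : ℕ → ℝ → ℂ} {K xb a b A₀ : ℝ}

/-- A real supremum over an unbounded family takes the default value zero, so boundedness must be
known before the supremum can dominate its members. The uniform lower bound `A₀` on `a - Re V`
provides it. -/
theorem LocalBound.bddAbove (h : LocalBound N V D K (xb ^ ν) xb a b) (hxb : 0 < xb) (hA₀ : 0 < A₀)
    (hA : ∀ x ∈ J ν xb, A₀ ≤ a - (V x).re) (l : ℕ) {s : ℝ} (hs : 0 ≤ s) :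
    BddAbove (range fun x : J ν xb => (b + |(V x).re|) ^ l / (a - (V x).re) ^ s) := by
  have hK := h.one_le_const
  have hb := h.one_le
  refine ⟨(K * (K * (a - (V xb).re + b))) ^ l / A₀ ^ s, ?_⟩
  rintro _ ⟨⟨x, hx⟩, rfl⟩
  have hx' := (mem_J_iff hxb).1 hx
  have h1 := h.abs_re_le x hx'
  have h2 := h.comparable x xb hx' h.xb_mem
  have h3 := h.pos x hx'
  have h4 : b + |(V x).re| ≤ K * (K * (a - (V xb).re + b)) := by
    calc b + |(V x).re| ≤ K * (a - (V x).re + b) := by nlinarith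
      _ ≤ _ := by gcongr
  have h5 := hA x hx
  have h6 : 0 ≤ b + |(V x).re| := by positivity
  dsimp only
  refine div_le_div₀ (pow_nonneg (h6.trans h4) l) (pow_le_pow_left₀ h6 h4 l) (by positivity)
    (Real.rpow_le_rpow hA₀.le h5 hs)

theorem LocalBound.le_iSup (h : LocalBound N V D K (xb ^ ν) xb a b) (hxb : 0 < xb) (hA₀ : 0 < A₀)
    (hA : ∀ x ∈ J ν xb, A₀ ≤ a - (V x).re) (l : ℕ) {s : ℝ} (hs : 0 ≤ s) {x : ℝ}
    (hx : x ∈ J ν xb) : (b + |(V x).re|) ^ l / (a - (V x).re) ^ s ≤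
      ⨆ x : J ν xb, (b + |(V x).re|) ^ l / (a - (V x).re) ^ s :=
  le_ciSup (h.bddAbove hxb hA₀ hA l hs) ⟨x, hx⟩

theorem LocalBound.iSup_nonneg (h : LocalBound N V D K (xb ^ ν) xb a b) (hxb : 0 < xb) (l : ℕ)
    (s : ℝ) : 0 ≤ ⨆ x : J ν xb, (b + |(V x).re|) ^ l / (a - (V x).re) ^ s := by
  refine Real.iSup_nonneg fun ⟨x, hx⟩ => ?_
  have h3 := h.pos x ((mem_J_iff hxb).1 hx)
  have hb := h.one_le
  positivity

theorem LocalBound.first_le_wkbRate (h : LocalBound N V D K (xb ^ ν) xb a b) (hxb : 0 < xb) :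
    xb ^ ((N : ℝ) * ν) * (⨆ x : J ν xb, (b + |(V x).re|) / (a - (V x).re) ^ ((N : ℝ) / 2)) ≤
      wkbRate N ν V xb a b :=
  le_add_of_nonneg_right <| Finset.sum_nonneg fun _ _ => Finset.sum_nonneg fun _ _ =>
    mul_nonneg (by positivity) (h.iSup_nonneg hxb _ _)

theorem LocalBound.wkbRate_nonneg (h : LocalBound N V D K (xb ^ ν) xb a b) (hxb : 0 < xb) :
    0 ≤ wkbRate N ν V xb a b := by
  refine le_trans (mul_nonneg (by positivity) ?_) (h.first_le_wkbRate hxb)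
  simpa using h.iSup_nonneg hxb 1 ((N : ℝ) / 2)

theorem inv_sqrt_pow_mul_div_pow {A M : ℝ} (hA : 0 < A) (j l : ℕ) :
    (√A)⁻¹ ^ j * (M / A) ^ l = M ^ l / A ^ ((j : ℝ) / 2 + l) := by
  rw [Real.rpow_add hA, Real.rpow_natCast, inv_pow, Real.sqrt_eq_rpow, ← Real.rpow_natCast,
    ← Real.rpow_mul hA.le, div_pow]
  have e : (1 / 2 : ℝ) * j = j / 2 := by ring
  rw [e]
  have : 0 < A ^ ((j : ℝ) / 2) := by positivity
  field_simp

/-- With `T = A^{-1/2}` the products `T^j ρ^l` are exactly the quotients in the rate. The bound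
holds only almost everywhere, since the remainder contains the derivative of order `N` of `V`. -/
theorem exists_remainder_le_wkbRate (N : ℕ) (hN : 1 < N) (K : ℝ) : ∃ K₁ ≥ 0, ∀ (ν : ℝ)
    (V : ℝ → ℂ) (D : ℕ → ℝ → ℂ) (xb a b A₀ : ℝ), 0 < xb →
    LocalBound N V D K (xb ^ ν) xb a b → 0 < A₀ → (∀ x ∈ J ν xb, A₀ ≤ a - (V x).re) →
    ∀ᵐ x, x ∈ J ν xb → ‖remainder ⟨a, b⟩ V D (N - 2) x‖ ≤ K₁ * wkbRate N ν V xb a b := by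
  obtain ⟨n, rfl⟩ : ∃ n, N = n + 2 := ⟨N - 2, by omega⟩
  obtain ⟨K₁, hK₁, hrem⟩ := exists_remainder_bound K n
  refine ⟨K₁, hK₁, fun ν V D xb a b A₀ hxb h hA₀ hAJ => ?_⟩
  filter_upwards [h.ae_deriv_le] with x hx hxJ
  have hx' := (mem_J_iff hxb).1 hxJ
  have hA := h.pos x hx'
  have hb := h.one_le
  have hκ := h.kappa_pos
  refine (hrem ⟨a, b⟩ V D x (xb ^ ν) ((b + |(V x).re|) / (a - (V x).re)) (√(a - (V x).re))⁻¹ hκ.le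
    (by positivity) (norm_sqrtAt_inv_le hA) fun m hm hm' => norm_jetAt_le hA ?_).trans ?_
  · rcases hm'.lt_or_eq with hlt | rfl
    · exact h.deriv_le m hm hlt x hx'
    · exact hx hx'
  have hpow : ∀ j : ℕ, (xb ^ ν) ^ j = xb ^ ((j : ℝ) * ν) := fun j => by
    rw [← Real.rpow_natCast, ← Real.rpow_mul hxb.le, mul_comm]
  gcongr
  rw [wkbRate]
  refine add_le_add ?_ (Finset.sum_le_sum fun k _ => Finset.sum_le_sum fun l _ => ?_)
  · rw [hpow]
    gcongr
    have h1 := inv_sqrt_pow_mul_div_pow (M := b + |(V x).re|) hA n 1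
    have h2 := h.le_iSup hxb hA₀ hAJ 1 (s := ((n + 2 : ℕ) : ℝ) / 2) (by positivity) hxJ
    have e : (n : ℝ) / 2 + (1 : ℕ) = ((n + 2 : ℕ) : ℝ) / 2 := by push_cast; ring
    rw [e] at h1
    simp only [pow_one] at h1 h2
    exact h1.trans_le h2
  · have e1 : (xb ^ ν) ^ (n + 2 + k) = xb ^ ((((n + 2 : ℕ) : ℝ) + k) * ν) := by
      rw [hpow]; push_cast; rfl
    have e2 : ((n + k : ℕ) : ℝ) / 2 + l = (((n + 2 : ℕ) : ℝ) - 2 + k) / 2 + l := by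
      push_cast; ring
    rw [e1, inv_sqrt_pow_mul_div_pow hA, e2]
    gcongr
    refine h.le_iSup hxb hA₀ hAJ l ?_ hxJ
    rw [← e2]
    positivity

/-- The window holds on the open interval only; its nonstrict inequality passes to the closure by
continuity, and `|a| / c₂` remains a positive lower bound at the endpoints. -/
theorem InWindow.pos_of_mem_Icc {c₁ c₂ c₃ ε : ℝ} (hw : InWindow c₁ c₂ c₃ ν ε V xb a b)
    (hc₁ : 0 < c₁) (hc₂ : 0 < c₂) (hb : 0 < b) (hxb : 0 < xb) (hJ0 : 0 < xb - delta ν xb)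
    (hV : ContinuousOn V (Ioi 0)) :
    0 < |a| / c₂ ∧ ∀ x ∈ Icc (xb - delta ν xb) (xb + delta ν xb), |a| / c₂ ≤ a - (V x).re := by
  have hδ : 0 < delta ν xb := by unfold delta; positivity
  have hmem : xb ∈ J ν xb := ⟨by linarith, by linarith⟩
  have ha : 0 < |a| := by
    have h1 : 0 < b ^ (2 / 3 : ℝ) * xb ^ (2 * ν / 3) := by positivity
    exact pos_of_mul_pos_right (h1.trans_le (hw xb hmem).1) hc₁.le
  refine ⟨by positivity, fun x hx => ?_⟩
  have hcl : closure (J ν xb) = Icc (xb - delta ν xb) (xb + delta ν xb) :=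
    closure_Ioo (by linarith)
  rw [← hcl] at hx
  refine le_on_closure (f := fun _ => |a| / c₂) (g := fun x => a - (V x).re) (s := J ν xb)
    (fun y hy => ?_) continuousOn_const ?_ hx
  · rw [div_le_iff₀ hc₂, mul_comm]
    exact (hw y hy).2.1
  · rw [hcl]
    refine continuousOn_const.sub (Complex.continuous_re.comp_continuousOn (hV.mono fun y hy => ?_))
    exact hJ0.trans_le hy.1

end Rate

end Pseudomode

/-! ### Assembly of the estimate -/

theorem mainTheorem3 (N : ℕ) (hN : 1 < N) (ν ε₁ : ℝ) (V : ℝ → ℂ)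
    (hV : Pseudomode.Admissible N ν ε₁ V)
    (c₁ c₂ c₃ K : ℝ) (hc₁ : 0 < c₁) (hc₂ : 0 < c₂) (hc₃ : 0 < c₃) (hK : 0 < K) :
    ∃ c > 0, ∃ C > 0, ∃ b₀ > 0, ∀ b ≥ b₀,
      ∃ xb > 0, (V xb).im = b ∧ (∀ y > 0, (V y).im = b → y = xb) ∧
        ∀ a : ℝ, Pseudomode.InWindow c₁ c₂ c₃ ν ε₁ V xb a b →
        ∀ ξ : ℝ → ℝ, Pseudomode.IsCutoff K ν xb ξ →
        ∀ lam : ℂ, lam = ⟨a, b⟩ →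
        ∀ f : ℝ → ℂ, f = Pseudomode.pseudomode lam V (N - 1) xb ξ →
          0 < Pseudomode.l2norm f ∧
          ∃ h : ℝ → ℂ, Pseudomode.IsSchrodinger V f h ∧
            Pseudomode.l2norm (fun x => h x - lam * f x) / Pseudomode.l2norm f ≤
              C * Pseudomode.rate N ν ε₁ c V xb a b := by
  obtain ⟨D, hD⟩ := Pseudomode.exists_isJet hN hV.sobolev hV.continuousOn
  obtain ⟨X, C, c, hT⟩ := hV.exists_tailBound hN hD
  have hν := hV.neg_one_le hT hD hN
  obtain ⟨K₀, hK₀⟩ := hT.exists_localBound hD hN hν hV.eps_pos hc₁ hc₂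
  obtain ⟨K₁, hK₁, hrem⟩ := Pseudomode.exists_remainder_le_wkbRate N hN K₀
  obtain ⟨Y, hY, K₂, hK₂, hcut⟩ := Pseudomode.exists_cutoff_bound N hN K₀ K hK
  obtain ⟨c', hc', K₃, hK₃, X₁, hdecay⟩ :=
    -- `1 ≤ K₀` becomes available only once some `LocalBound` holds, hence the maximum, which is
    -- removed below.
    hT.exists_decay_bound hD hN hν hV.eps_pos hc₃ (le_max_left 1 K₀) Y
  have hX1 := hT.one_le
  -- Moving the tail threshold to `max (2 * X) X₁` puts `x_b` far enough out for both the local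
  -- bounds and the decay bounds.
  obtain ⟨b₀, hb₀, hturn⟩ := hV.exists_turning_point
    (hT.mono (X' := max (2 * X) X₁) (le_max_of_le_left (by linarith))) hD hN
  refine ⟨c', hc', K₁ + K₂ * (1 + K₃), by positivity, b₀, hb₀, fun b hb => ?_⟩
  obtain ⟨xb, hxb, hVB, huniq⟩ := hturn b hb
  have hX2 : 2 * X ≤ xb := (le_max_left _ _).trans hxb
  have hX3 : X₁ ≤ xb := (le_max_right _ _).trans hxb
  have hxb0 : 0 < xb := by linarith
  refine ⟨xb, hxb0, hVB, huniq, ?_⟩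
  rintro a hw ξ hξ lam rfl f rfl
  have hL := hK₀ c₃ xb a b hX2 hVB hw
  rw [max_eq_right hL.one_le_const] at hdecay
  have hb1 := hL.one_le
  have hxbl : 0 < xb - Pseudomode.delta ν xb := by
    rw [Pseudomode.delta_eq hxb0]; exact hL.xb_pos
  have hδ : 0 < Pseudomode.delta ν xb := by unfold Pseudomode.delta; positivity
  have hxbJ : xb ∈ Pseudomode.J ν xb := ⟨by linarith, by linarith⟩
  have hA := hL.pos xb hL.xb_mem
  obtain ⟨hA₀, hAI⟩ := hw.pos_of_mem_Icc hc₁ hc₂ (by linarith) hxb0 hxbl hV.continuousOn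
  have hAJ : ∀ x ∈ Pseudomode.J ν xb, |a| / c₂ ≤ a - (V x).re := fun x hx =>
    hAI x (Ioo_subset_Icc_self hx)
  have hpos : ∀ x ∈ Icc (xb - Pseudomode.delta ν xb) (xb + Pseudomode.delta ν xb),
      0 < a - (V x).re := fun x hx => hA₀.trans_le (hAI x hx)
  obtain ⟨h1, h2, h3, h4⟩ := hdecay xb a b (by linarith) hX3 hVB hA (hw xb hxbJ).2.2
  obtain ⟨S, L, yl, yr, hS, hL0, hyl, hylr, hs, hl, hfin⟩ :=
    hcut ν V D xb a b ξ hD hxb0 hL hpos hξ h1 h2 h3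
  have hW0 := hL.wkbRate_nonneg hxb0
  have hlam : (⟨a, b⟩ : ℂ) ≠ 0 := fun h0 => by
    have := congrArg Complex.im h0
    simp only [Complex.zero_im] at this
    linarith
  obtain ⟨hne, h, hh, hle⟩ := hD.quasimode hN hlam hxbl hxbJ
    (fun x hx => by rw [Pseudomode.re_sub_eq]; exact hpos x hx) hξ.smooth hξ.eq_zero
    (mul_nonneg hK₁ hW0) hS (hrem ν V D xb a b _ hxb0 hL hA₀ hAJ) hs hL0 hyl hylr hl
  refine ⟨hne, h, hh, hle.trans ?_⟩
  -- The value at `x_b` is one member of the first supremum; it absorbs the cut-off error when `b`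
  -- is polynomially bounded.
  have hfirst : xb ^ ((N : ℝ) * ν) * (b / (a - (V xb).re) ^ ((N : ℝ) / 2)) ≤
      Pseudomode.wkbRate N ν V xb a b := by
    refine le_trans ?_ (hL.first_le_wkbRate hxb0)
    have h5 := hL.le_iSup hxb0 hA₀ hAJ 1 (s := (N : ℝ) / 2) (by positivity) hxbJ
    simp only [pow_one] at h5
    gcongr
    refine le_trans ?_ h5
    gcongr
    exact le_add_of_nonneg_right (abs_nonneg _)
  rw [Pseudomode.rate_eq]
  generalize Pseudomode.wkbRate N ν V xb a b = W at hW0 hfirst ⊢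
  have hE := Real.exp_pos (-c' * xb ^ (ν + 1 + 2 * ε₁))
  generalize Real.exp (-c' * xb ^ (ν + 1 + 2 * ε₁)) = E at hE h4 ⊢
  calc _ ≤ K₁ * W + K₂ * (E + K₃ * W) := by
        refine add_le_add_right (hfin.trans ?_) _
        gcongr
        exact h4.trans (by gcongr)
    _ ≤ _ := by
        have e1 : 0 ≤ K₁ * E := mul_nonneg hK₁ hE.le
        have e2 : 0 ≤ K₂ * W := mul_nonneg hK₂.le hW0
        have e3 : 0 ≤ K₂ * K₃ * E := by positivity
        linarith
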